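/- Let $p\ge 1$, $q\ge 0$, let $M$ be a compact smooth manifold (without boundary) of dimension $p+q$, let $F\subseteq TM$ be the tangent bundle of a smooth foliation of $M$ of dimension $p$ and codimension $q$, let $g$ be a smooth Euclidean metric on the bundle $F$, and let $\nu$ be a holonomy invariant transverse measure: a countably additive map from the Borel transversals (Borel subsets of $M$ meeting every leaf in a countable set) to $[0,\infty]$ such that $\nu(B)=\nu(C)$ whenever there is a Borel bijection $\psi:B\to C$ with $\psi(x)$ in the leaf of $x$ for all $x$, and $\nu(K)<\infty$ for every compact subset $K$ of a ($q$-dimensional, embedded) smooth transversal. It is extended to all Borel sets $A$ by $\nu(A)=\sup\{\nu(B): B\subseteq A \text{ a Borel transversal}\}$. For a smooth $f:M\to\mathbb R$ let $\mathrm{Crit}_F(f)=\{x\in M: df_x|_{F_x}=0\}$. For $x\in \mathrm{Crit}_F(f)$ let $d^2_xf:T_xM\times F_x\to\mathbb R$, $d^2_xf(X,Y)=X(Yf)(x)$ ($Y$ being extended to a section of $F$; the value does not depend on the extension), and let the longitudinal Hessian $d^2_Ff$ at $x$ be the restriction of $d^2_xf$ to $F_x\times F_x$. A point $x\in\mathrm{Crit}_F(f)$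 is * *Morse of index $i$* if $d^2_Ff$ is nondegenerate at $x$ and $i$ is the maximal dimension of a subspace of $F_x$ on which it is negative definite; * *of birth-death type* if the kernel of $d^2_Ff$ at $x$ is one-dimensional, the third derivative of $f$ along the leaf does not vanish on nonzero vectors of this kernel, and $d^2_xf:T_xM\to F_x^*$ is surjective (equivalently, in some foliated chart $(x,y)\in\mathbb R^p\times\mathbb R^q$ centred at the point, $f(x,y)=f(0,y)+\tfrac13x_1^3-y_1x_1+\sum_{j\ge2}\pm x_j^2$). The function $f$ is *nice* if it is smooth, every point of $\mathrm{Crit}_F(f)$ is Morse or of birth-death type, and the union of the leaves that contain a longitudinal critical point of $f$ that is not Morse has $\nu$-measure zero. Let $\mathrm{Crit}^i_F(f)$ be the set of Morse points of index $i$, let $\mathrm{Crit}^r_F(f)$ be the set of points of $\mathrm{Crit}_F(f)$ at which $\mathrm{Crit}_F(f)$ is transverse to the foliation, i.e. $\ker(d^2_xf:T_xM\to F_x^*)+F_x=T_xM$, and let $E_p(d^2_Ff)(x)$ be the $p$-th (that is, the smallest) singular value of $d^2_Ff$ at $x$ with respect to $g_x$, where singular values are listed in decreasing order with multiplicity. Then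 for every nice function $f:M\to\mathbb R$ and every $\epsilon>0$ there exists a nice function $h:M\to\mathbb R$ such that 1. $\displaystyle\int_{\mathrm{Crit}^r_F(h)}\frac1{E_p(d^2_Fh)}\,d\nu<\infty$; 2. for every $i$, the numbers $\nu(\mathrm{Crit}^i_F(f))$ and $\nu(\mathrm{Crit}^i_F(h))$ are finite and $|\nu(\mathrm{Crit}^i_F(h))-\nu(\mathrm{Crit}^i_F(f))|\le\epsilon$. -/

import Mathlib

open Set MeasureTheory
open scoped Manifold ContDiff ENNReal

noncomputable section

/-- Euclidean coordinate space. -/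
abbrev RSpace (k : ℕ) : Type := EuclideanSpace ℝ (Fin k)

/-- The change of coordinates `e' ∘ e⁻¹` has, near every point of its domain, the form
`(a, t) ↦ (h₁(a, t), h₂(t))`, where `a` is the coordinate along the leaves and `t` the transverse
coordinate. -/
def FoliatedTransition {p q : ℕ} {M : Type*} [TopologicalSpace M]
    (e e' : OpenPartialHomeomorph M (RSpace p × RSpace q)) : Prop :=
  ∀ x ∈ e.source ∩ e'.source, ∃ h₂ : RSpace q → RSpace q,
    ∀ᶠ z in nhds (e x), (e' (e.symm z)).2 = h₂ z.2

/-- A chart with values in `ℝᵖ × ℝ^q` that is a diffeomorphism onto its image. -/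
def IsSmoothChart {p q : ℕ} {M : Type*} [TopologicalSpace M] [ChartedSpace (RSpace (p + q)) M]
    (e : OpenPartialHomeomorph M (RSpace p × RSpace q)) : Prop :=
  ContMDiffOn (𝓡 (p + q)) 𝓘(ℝ, RSpace p × RSpace q) ∞ e e.source ∧
  ContMDiffOn 𝓘(ℝ, RSpace p × RSpace q) (𝓡 (p + q)) ∞ e.symm e.target

/-- A smooth foliation of dimension `p` and codimension `q` of a smooth manifold `M`, given by an
atlas of foliated charts; the plaques of a chart are the sets on which the second coordinate is
constant. -/
structure Foliation (p q : ℕ) (M : Type*) [TopologicalSpace M]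
    [ChartedSpace (RSpace (p + q)) M] where
  charts : Set (OpenPartialHomeomorph M (RSpace p × RSpace q))
  covers : ∀ x : M, ∃ e ∈ charts, x ∈ e.source
  smooth : ∀ e ∈ charts, IsSmoothChart e
  compatible : ∀ e ∈ charts, ∀ e' ∈ charts, FoliatedTransition e e'

namespace Foliation

variable {p q : ℕ} {M : Type*} [TopologicalSpace M] [ChartedSpace (RSpace (p + q)) M]

/-- Membership in the maximal foliated atlas. -/
def IsFoliatedChart (F : Foliation p q M)
    (e : OpenPartialHomeomorph M (RSpace p × RSpace q)) : Prop :=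
  IsSmoothChart e ∧ ∀ e' ∈ F.charts, FoliatedTransition e e' ∧ FoliatedTransition e' e

/-- A chart of the atlas around `x`. -/
def chartAt (F : Foliation p q M) (x : M) : OpenPartialHomeomorph M (RSpace p × RSpace q) :=
  (F.covers x).choose

/-- `x` and `y` lie in a common plaque: they are joined by a segment inside a plaque of a chart. -/
def PlaqueRel (F : Foliation p q M) (x y : M) : Prop :=
  ∃ e ∈ F.charts, x ∈ e.source ∧ y ∈ e.source ∧ (e x).2 = (e y).2 ∧
    segment ℝ (e x) (e y) ⊆ e.target

/-- The leaf through `x`: all points that can be reached by a chain of plaques. -/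
def leaf (F : Foliation p q M) (x : M) : Set M := {y | Relation.EqvGen F.PlaqueRel x y}

/-- The differential at `x` of a map `e` to `ℝᵖ × ℝ^q`. -/
def chartDeriv (e : OpenPartialHomeomorph M (RSpace p × RSpace q)) (x : M) :
    TangentSpace (𝓡 (p + q)) x →ₗ[ℝ] RSpace p × RSpace q :=
  (mfderiv (𝓡 (p + q)) 𝓘(ℝ, RSpace p × RSpace q) e x).toLinearMap

/-- The subspace `F_x ⊆ T_x M` of vectors tangent to the leaves. -/
def tangent (F : Foliation p q M) (x : M) : Submodule ℝ (TangentSpace (𝓡 (p + q)) x) :=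
  ⨅ e ∈ {e ∈ F.charts | x ∈ e.source},
    LinearMap.ker (LinearMap.snd ℝ (RSpace p) (RSpace q) ∘ₗ chartDeriv e x)

instance (F : Foliation p q M) (x : M) : FiniteDimensional ℝ (F.tangent x) :=
  haveI : FiniteDimensional ℝ (TangentSpace (𝓡 (p + q)) x) :=
    inferInstanceAs (FiniteDimensional ℝ (RSpace (p + q)))
  inferInstance

/-- The set `Crit_F(f)` of longitudinal critical points: `df_x` vanishes on `F_x`. -/
def crit (F : Foliation p q M) (f : M → ℝ) : Set M :=
  {x | ∀ v ∈ F.tangent x, (mfderiv (𝓡 (p + q)) 𝓘(ℝ, ℝ) f x v : ℝ) = 0}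

/-- The second derivative `d²_x f : T_x M × F_x → ℝ`, `(X, Y) ↦ X(Y f)(x)` at a longitudinal
critical point `x`, where `Y` is extended to a section of `F`. It is computed in a foliated chart,
with the extension of `Y` that is constant in the chart; at a longitudinal critical point the
result does not depend on these choices. -/
def hess (F : Foliation p q M) (f : M → ℝ) (x : M) :
    TangentSpace (𝓡 (p + q)) x →ₗ[ℝ] F.tangent x →ₗ[ℝ] ℝ :=
  ((LinearMap.mk₂ ℝ
    (fun X Y : RSpace p × RSpace q =>
      fderiv ℝ (fderiv ℝ (f ∘ (F.chartAt x).symm)) (F.chartAt x x) X Y)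
    (by simp) (by simp) (by simp) (by simp)).compl₁₂
      (chartDeriv (F.chartAt x) x) (chartDeriv (F.chartAt x) x ∘ₗ (F.tangent x).subtype))

/-- The longitudinal Hessian `d²_F f`: the restriction of `d²_x f` to `F_x × F_x`. -/
def leafHess (F : Foliation p q M) (f : M → ℝ) (x : M) : LinearMap.BilinForm ℝ (F.tangent x) :=
  F.hess f x ∘ₗ (F.tangent x).subtype

/-- The third derivative of `f` at `x` along the leaf in the direction `v ∈ F_x`, in a foliated
chart. If `x` is a longitudinal critical point and `v` is in the kernel of the longitudinal
Hessian, it does not depend on the chart. -/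
def cubic (F : Foliation p q M) (f : M → ℝ) (x : M) (v : F.tangent x) : ℝ :=
  iteratedDeriv 3
    (fun s : ℝ => f ((F.chartAt x).symm (F.chartAt x x + s • chartDeriv (F.chartAt x) x v))) 0

/-- `x` is a Morse longitudinal critical point: a nondegenerate critical point of the restriction
of `f` to the leaf of `x`. -/
def IsMorsePoint (F : Foliation p q M) (f : M → ℝ) (x : M) : Prop :=
  x ∈ F.crit f ∧ (F.leafHess f x).Nondegenerate

/-- The set `Crit^i_F(f)` of Morse longitudinal critical points of index `i`; the index is the
largest dimension of a subspace of `F_x` on which the Hessian is negative definite. -/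
def morseCrit (F : Foliation p q M) (f : M → ℝ) (i : ℕ) : Set M :=
  {x | F.IsMorsePoint f x ∧ sigNeg (F.leafHess f x).toQuadraticMap = i}

/-- `x` is a birth-death longitudinal critical point: the kernel of the longitudinal Hessian is a
line, the third derivative along the leaf does not vanish on that line, and the family of
functions on the leaves unfolds the singularity, i.e. `d²_x f : T_x M → F_x^*` is onto. -/
def IsBirthDeath (F : Foliation p q M) (f : M → ℝ) (x : M) : Prop :=
  x ∈ F.crit f ∧
  Module.finrank ℝ (LinearMap.ker (F.leafHess f x)) = 1 ∧
  (∀ v ∈ LinearMap.ker (F.leafHess f x), v ≠ 0 → F.cubic f x v ≠ 0) ∧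
  Function.Surjective (F.hess f x)

/-- The set `Crit^r_F(f)` of points of `Crit_F(f)` at which `Crit_F(f)` is transverse to the
foliation; the tangent space of `Crit_F(f)` at `x` is the kernel of `d²_x f : T_x M → F_x^*`. -/
def regCrit (F : Foliation p q M) (f : M → ℝ) : Set M :=
  {x ∈ F.crit f | LinearMap.ker (F.hess f x) ⊔ F.tangent x = ⊤}

/-- An embedded `q`-dimensional submanifold transverse to the foliation: locally a slice
`{a = const}` of a foliated chart. -/
def IsSmoothTransversal (F : Foliation p q M) (T : Set M) : Prop :=
  ∀ x ∈ T, ∃ e, F.IsFoliatedChart e ∧ x ∈ e.source ∧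
    T ∩ e.source = {y ∈ e.source | (e y).1 = (e x).1}

/-- A Borel transversal: a Borel set that meets every leaf in a countable set. -/
def IsBorelTransversal [MeasurableSpace M] (F : Foliation p q M) (B : Set M) : Prop :=
  MeasurableSet B ∧ ∀ x, (B ∩ F.leaf x).Countable

/-- A smooth Euclidean metric on the bundle `F` of vectors tangent to the leaves. -/
structure EuclideanMetric [IsManifold (𝓡 (p + q)) ∞ M] (F : Foliation p q M) where
  form : ∀ x : M, LinearMap.BilinForm ℝ (F.tangent x)
  symm : ∀ x v w, form x v w = form x w v
  pos : ∀ x v, v ≠ 0 → 0 < form x v v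
  smooth : ∀ U : Set M, IsOpen U → ∀ X Y : ∀ x : M, F.tangent x,
    ContMDiffOn (𝓡 (p + q)) (𝓡 (p + q)).tangent ∞
      (fun x => (⟨x, (X x : TangentSpace (𝓡 (p + q)) x)⟩ : TangentBundle (𝓡 (p + q)) M)) U →
    ContMDiffOn (𝓡 (p + q)) (𝓡 (p + q)).tangent ∞
      (fun x => (⟨x, (Y x : TangentSpace (𝓡 (p + q)) x)⟩ : TangentBundle (𝓡 (p + q)) M)) U →
    ContMDiffOn (𝓡 (p + q)) 𝓘(ℝ, ℝ) ∞ (fun x => form x (X x) (Y x)) U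

namespace EuclideanMetric

variable [IsManifold (𝓡 (p + q)) ∞ M] {F : Foliation p q M}

/-- The inner product on `F_x`. -/
@[reducible] def core (g : F.EuclideanMetric) (x : M) : InnerProductSpace.Core ℝ (F.tangent x) where
  inner v w := g.form x v w
  conj_inner_symm v w := g.symm x w v
  re_inner_nonneg v := by
    by_cases h : v = 0
    · simp [h]
    · exact (g.pos x v h).le
  add_left u v w := by simp
  smul_left u v r := by simp
  definite v h := by
    by_contra hv
    exact (g.pos x v hv).ne' h

theorem nondegenerate (g : F.EuclideanMetric) (x : M) : (g.form x).Nondegenerate := by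
  constructor
  · intro v h
    by_contra hv
    exact (g.pos x v hv).ne' (h v)
  · intro v h
    by_contra hv
    exact (g.pos x v hv).ne' (h v)

/-- The endomorphism `A` of `F_x` with `g(A v, w) = d²_F f(v, w)`. -/
def hessEnd (g : F.EuclideanMetric) (f : M → ℝ) (x : M) : F.tangent x →ₗ[ℝ] F.tangent x :=
  ((g.form x).toDual (g.nondegenerate x)).symm.toLinearMap ∘ₗ F.leafHess f x

/-- The singular values of the longitudinal Hessian at `x` with respect to `g_x`, in decreasing
order with multiplicity; `k = 1` gives the largest one, `k = p` the smallest one. -/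
def singularValue (g : F.EuclideanMetric) (f : M → ℝ) (k : ℕ) (x : M) : ℝ :=
  letI : NormedAddCommGroup (F.tangent x) := (g.core x).toNormedAddCommGroup
  letI : InnerProductSpace ℝ (F.tangent x) := InnerProductSpace.ofCore (g.core x).toCore
  (g.hessEnd f x).singularValues (k - 1)

end EuclideanMetric

/-- A holonomy invariant transverse measure: a countably additive map on Borel transversals,
invariant under Borel bijections that move points along leaves, and finite on compact subsets of
smooth transversals. The values on sets that are not Borel transversals carry no meaning. -/
structure TransverseMeasure [MeasurableSpace M] (F : Foliation p q M) where
  val : Set M → ℝ≥0∞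
  val_empty : val ∅ = 0
  val_iUnion : ∀ B : ℕ → Set M, (∀ k, F.IsBorelTransversal (B k)) →
    Pairwise (fun k l => Disjoint (B k) (B l)) → val (⋃ k, B k) = ∑' k, val (B k)
  invariant : ∀ B C : Set M, F.IsBorelTransversal B → F.IsBorelTransversal C →
    ∀ ψ : B ≃ᵐ C, (∀ x : B, (ψ x : M) ∈ F.leaf x) → val B = val C
  finite : ∀ T K : Set M, F.IsSmoothTransversal T → IsCompact K → K ⊆ T → val K < ⊤

section BorelTransversals

variable [MeasurableSpace M] {F : Foliation p q M}

theorem IsBorelTransversal.inter {B A : Set M} (hB : F.IsBorelTransversal B)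
    (hA : MeasurableSet A) : F.IsBorelTransversal (B ∩ A) :=
  ⟨hB.1.inter hA, fun x => (hB.2 x).mono (by intro y hy; exact ⟨hy.1.1, hy.2⟩)⟩

theorem IsBorelTransversal.union {B C : Set M} (hB : F.IsBorelTransversal B)
    (hC : F.IsBorelTransversal C) : F.IsBorelTransversal (B ∪ C) :=
  ⟨hB.1.union hC.1, fun x => by
    rw [union_inter_distrib_right]
    exact (hB.2 x).union (hC.2 x)⟩

theorem isBorelTransversal_empty : F.IsBorelTransversal (∅ : Set M) :=
  ⟨MeasurableSet.empty, fun x => by simp⟩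

theorem TransverseMeasure.val_mono (ν : F.TransverseMeasure) {B C : Set M}
    (hB : F.IsBorelTransversal B) (hC : F.IsBorelTransversal C) (h : B ⊆ C) :
    ν.val B ≤ ν.val C := by
  let S : ℕ → Set M := fun k => if k = 0 then B else if k = 1 then C \ B else ∅
  have hS : (⋃ k, S k) = C := by
    ext x
    simp only [mem_iUnion, S]
    constructor
    · rintro ⟨k, hk⟩
      split_ifs at hk
      · exact h hk
      · exact hk.1
      · exact hk.elim
    · intro hx
      by_cases hxB : x ∈ B
      · exact ⟨0, by simpa using hxB⟩
      · exact ⟨1, by simpa using ⟨hx, hxB⟩⟩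
  have hT : ∀ k, F.IsBorelTransversal (S k) := by
    intro k
    simp only [S]
    split_ifs
    · exact hB
    · rw [sdiff_eq]; exact hC.inter hB.1.compl
    · exact isBorelTransversal_empty
  have hd : Pairwise (fun k l => Disjoint (S k) (S l)) := by
    intro k l hkl
    simp only [S]
    split_ifs <;> first
      | (exfalso; omega)
      | exact disjoint_sdiff_right
      | exact disjoint_sdiff_left
      | simp
  have := ν.val_iUnion S hT hd
  rw [hS] at this
  rw [this]
  exact ENNReal.le_tsum 0

/-- The extension of a transverse measure to a measure on all Borel sets: the measure of a Borel
set `A` is the supremum of the measures of the Borel transversals contained in `A`. -/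
def TransverseMeasure.toMeasure (ν : F.TransverseMeasure) : Measure M :=
  Measure.ofMeasurable
    (fun A _ => ⨆ B : {B : Set M // F.IsBorelTransversal B}, ν.val (B ∩ A))
    (by simp [ν.val_empty])
    (by
      intro A hA hd
      have h1 : ∀ B : {B : Set M // F.IsBorelTransversal B},
          ν.val (B ∩ ⋃ i, A i) = ∑' i, ν.val (B ∩ A i) := by
        intro B
        rw [inter_iUnion]
        refine ν.val_iUnion _ (fun i => B.2.inter (hA i)) ?_
        intro i j hij
        exact (hd hij).mono inter_subset_right inter_subset_right
      simp only [h1, ENNReal.tsum_eq_iSup_sum]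
      rw [iSup_comm]
      congr 1
      funext s
      rw [ENNReal.finsetSum_iSup]
      intro B C
      refine ⟨⟨B ∪ C, B.2.union C.2⟩, fun i => ⟨?_, ?_⟩⟩
      · exact ν.val_mono (B.2.inter (hA i)) ((B.2.union C.2).inter (hA i))
          (inter_subset_inter_left _ subset_union_left)
      · exact ν.val_mono (C.2.inter (hA i)) ((B.2.union C.2).inter (hA i))
          (inter_subset_inter_left _ subset_union_right))

/-- The extension agrees with the transverse measure on Borel transversals. -/
theorem TransverseMeasure.toMeasure_apply (ν : F.TransverseMeasure) {B : Set M}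
    (hB : F.IsBorelTransversal B) : ν.toMeasure B = ν.val B := by
  rw [TransverseMeasure.toMeasure, Measure.ofMeasurable_apply _ hB.1]
  apply le_antisymm
  · exact iSup_le fun C => ν.val_mono (C.2.inter hB.1) hB inter_subset_right
  · exact le_iSup_of_le ⟨B, hB⟩ (by simp)

end BorelTransversals

/-- A nice function: smooth, all longitudinal critical points are Morse or of birth-death type,
and the union of the leaves on which `f` is not Morse is negligible for `ν`. -/
structure IsNice [MeasurableSpace M] (F : Foliation p q M) (ν : F.TransverseMeasure)
    (f : M → ℝ) : Prop where
  smooth : ContMDiff (𝓡 (p + q)) 𝓘(ℝ, ℝ) ∞ f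
  morse_or_birthDeath : ∀ x ∈ F.crit f, F.IsMorsePoint f x ∨ F.IsBirthDeath f x
  null : ν.toMeasure {x | ∃ y ∈ F.leaf x, y ∈ F.crit f ∧ ¬ F.IsMorsePoint f y} = 0

end Foliation

end

/-! The degenerate critical points of `f` form a compact set `B` whose saturation is `ν`-null. So
`B` is covered by finitely many foliated boxes in each of which the relevant part of `B` projects
into an open set `W i` of small transverse measure. The function is changed only over these sets: `h
= f + ∑ χ i ⟨c i, x⟩`, where `x` is the leaf coordinate of the box `i` and the cut-off `χ i` equals
1 near a compact `K i`; the interiors of the `K i` cover `B`.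

Small `c`. By compactness three properties of `f` persist: all critical points are Morse or of
birth-death type (`eventually_morse_or_birthDeath`), they are Morse outside the interiors of the `K
i` (`eventually_isMorsePoint`), and each plaque of a box carries at most two of them
(`exists_box_atMostTwo`, since a fold and its small `C²` perturbations have at most two zeros). The
last property bounds the critical set over `W i` by twice the measure of `W i`, for `f` and for `h`.
As `f` and `h` agree elsewhere, this controls the change of the number of Morse points.

Almost every `c`. On `K i`, moving `c i` by `-a` subtracts the constant `a` from the leafwise
gradient `G`, so critical points become solutions of `G = a` (`IsTranslationFamily`). Sard's theorem
on each plaque and Fubini show that the degenerate critical points project to a null set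
(`ae_measure_eq_zero`); hence their saturation is null and `h` is nice. The area formula says that
the integral over `a` of the sum of `1 / |det DG|` over the solutions of `G = a` is the volume of a
part of the plaque. It stays finite after integration over the transverse variable, so the sum is
integrable for almost every parameter (`ae_exists_lintegral_lt_top`). Since `|det|` is locally at
most a constant times the smallest singular value, this is the required integrability near `B`;
elsewhere the critical points are Morse and the integrand is locally bounded.

Measure theory. Holonomy invariance turns `ν` inside a box into a finite measure `μ` on the
transverse coordinate. Since `ν` is known only on transversals, Borel sets with countable plaque
sections must be cut into countably many Borel sheets that meet each plaque at most once. This is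
the Lusin–Novikov theorem (`MeasurableSet.exists_iUnion_injOn`), which also provides the sheets of
critical points used with the area formula. -/

noncomputable section

set_option linter.unusedSectionVars false

/-! ### The Lusin–Novikov theorem -/

section

namespace LusinNovikov

section Topological

variable {P X : Type*} [MeasurableSpace P] (π : P → X)

/-- A Borel set that is a countable union of Borel sets on which `π` is injective. -/
def IsSmall (D : Set P) : Prop :=
  ∃ S : Set (Set P), S.Countable ∧ (∀ A ∈ S, MeasurableSet A ∧ InjOn π A) ∧ D = ⋃₀ S

/-- The sets of the family `𝒰` meet a common fibre of `π` outside every small set. -/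
def IsGood (𝒰 : Set (Set P)) : Prop :=
  ∀ D, IsSmall π D → ∃ x, ∀ U ∈ 𝒰, ∃ z ∈ U, z ∉ D ∧ π z = x

variable {π}

theorem isSmall_empty : IsSmall π (∅ : Set P) :=
  ⟨∅, countable_empty, by simp, by simp⟩

theorem IsSmall.measurableSet {D : Set P} (h : IsSmall π D) : MeasurableSet D := by
  obtain ⟨S, hS, hA, rfl⟩ := h
  exact MeasurableSet.sUnion hS fun A hAS => (hA A hAS).1

theorem IsSmall.iUnion {ι : Type*} [Countable ι] {D : ι → Set P} (h : ∀ i, IsSmall π (D i)) :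
    IsSmall π (⋃ i, D i) := by
  choose S hS hA hD using h
  refine ⟨⋃ i, S i, countable_iUnion hS, ?_, ?_⟩
  · intro A hA'
    obtain ⟨i, hi⟩ := mem_iUnion.1 hA'
    exact hA i A hi
  · rw [sUnion_iUnion]
    exact iUnion_congr hD

theorem IsSmall.union {D E : Set P} (hD : IsSmall π D) (hE : IsSmall π E) :
    IsSmall π (D ∪ E) := by
  rw [union_eq_iUnion]
  exact IsSmall.iUnion fun b => by cases b <;> assumption

theorem isSmall_of_injOn {A : Set P} (hA : MeasurableSet A) (h : InjOn π A) : IsSmall π A :=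
  ⟨{A}, countable_singleton A, by simpa using ⟨hA, h⟩, by simp⟩

theorem IsGood.mono {𝒰 𝒱 : Set (Set P)} (h : IsGood π 𝒰) (hs : 𝒱 ⊆ 𝒰) : IsGood π 𝒱 :=
  fun D hD => (h D hD).imp fun _ hx U hU => hx U (hs hU)

end Topological

theorem AnalyticSet.inter' {α : Type*} [TopologicalSpace α] [T2Space α] {s t : Set α}
    (hs : AnalyticSet s) (ht : AnalyticSet t) : AnalyticSet (s ∩ t) := by
  rw [inter_eq_iInter]
  exact AnalyticSet.iInter fun b => by cases b <;> assumption

/-- An analytic set on which a continuous map is injective is contained in a Borel set with the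
same property. -/
theorem exists_measurableSet_injOn {P X : Type*} [TopologicalSpace P] [PolishSpace P]
    [MeasurableSpace P] [BorelSpace P] [TopologicalSpace X] [T2Space X] {π : P → X}
    (hπ : Continuous π) {Q : Set P} (hQ : AnalyticSet Q) (hinj : InjOn π Q) :
    ∃ R, Q ⊆ R ∧ MeasurableSet R ∧ InjOn π R := by
  -- `N A` collects the points that share a fibre with a different point of `A`, so `π` is injective
  -- on `A` exactly when `A` misses `N A`. One separation of `Q` from `N Q` is not enough; the
  -- second one, from `N Q₁`, excludes every pair of distinct points of `Q₁ ∩ Q₂` in one fibre.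
  let N : Set P → Set P := fun A => {z' | ∃ z ∈ A, π z = π z' ∧ z ≠ z'}
  have hN : ∀ A, AnalyticSet A → AnalyticSet (N A) := by
    intro A hA
    have h1 : IsClosed {w : P × P | π w.1 = π w.2} :=
      isClosed_eq (hπ.comp continuous_fst) (hπ.comp continuous_snd)
    have h2 : MeasurableSet {w : P × P | w.1 ≠ w.2} :=
      (isClosed_eq continuous_fst continuous_snd).measurableSet.compl
    have h3 := AnalyticSet.inter' (AnalyticSet.inter' (hA.preimage (f := (Prod.fst : P × P → P))
      continuous_fst) h1.analyticSet) h2.analyticSet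
    convert! h3.image_of_continuous continuous_snd using 1
    ext z'
    simp only [N, mem_ofPred, mem_image, mem_inter_iff, mem_preimage, Prod.exists]
    constructor
    · rintro ⟨z, hz, h, h'⟩
      exact ⟨z, z', ⟨⟨hz, h⟩, h'⟩, rfl⟩
    · rintro ⟨z, w, ⟨⟨hz, h⟩, h'⟩, rfl⟩
      exact ⟨z, hz, h, h'⟩
  have d1 : Disjoint Q (N Q) := by
    rw [Set.disjoint_left]
    rintro z hz ⟨w, hw, h, h'⟩
    exact h' (hinj hw hz h)
  obtain ⟨Q₁, hQ₁, hd₁, hm₁⟩ := hQ.measurablySeparable (hN Q hQ) d1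
  have d2 : Disjoint Q (N Q₁) := by
    rw [Set.disjoint_left]
    rintro z hz ⟨w, hw, h, h'⟩
    exact Set.disjoint_left.1 hd₁ ⟨z, hz, h.symm, h'.symm⟩ hw
  obtain ⟨Q₂, hQ₂, hd₂, hm₂⟩ := hQ.measurablySeparable (hN Q₁ hm₁.analyticSet) d2
  refine ⟨Q₁ ∩ Q₂, subset_inter hQ₁ hQ₂, hm₁.inter hm₂, ?_⟩
  intro z hz w hw h
  by_contra hne
  exact Set.disjoint_left.1 hd₂ ⟨z, hz.1, h, hne⟩ hw.2

section Metric

variable {P X : Type*} [MetricSpace P] [CompleteSpace P] [SecondCountableTopology P]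
  [MeasurableSpace P] [BorelSpace P] [TopologicalSpace X] [T2Space X] {π : P → X}

/-- If no pair of small separated basis sets works, each pair has a small set witnessing this, and
the countable union `E` of the witnesses is still small. Two distinct points of one fibre that lie
in `U` outside `E`, with the fibre meeting all of `𝒰` outside `E`, would contradict the witness of a
pair of basis sets around them. So `π` is injective on the set `Q` of such points, `Q` lies in a
small Borel set `R`, and goodness tested against `E ∪ R` fails. -/
theorem IsGood.split (hπ : Continuous π) {U : Set P} {𝒰 : Set (Set P)} (h𝒰 : 𝒰.Countable)
    (hop : ∀ V ∈ 𝒰, IsOpen V) (hU : IsOpen U) (hg : IsGood π (insert U 𝒰)) {ε : ℝ} (hε : 0 < ε) :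
    ∃ V : Bool → Set P, (∀ b, IsOpen (V b) ∧ closure (V b) ⊆ U ∧
      Metric.ediam (V b) ≤ ENNReal.ofReal ε) ∧ Disjoint (V false) (V true) ∧
      IsGood π (range V ∪ 𝒰) := by
  by_contra hcon
  push Not at hcon
  let ℬ := TopologicalSpace.countableBasis P
  have hℬ : TopologicalSpace.IsTopologicalBasis ℬ := TopologicalSpace.isBasis_countableBasis P
  have hℬc : ℬ.Countable := TopologicalSpace.countable_countableBasis P
  have hbasis : ∀ z ∈ U, ∀ r > 0, ∃ B ∈ ℬ, z ∈ B ∧ B ⊆ Metric.ball z r ∧ closure B ⊆ U ∧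
      Metric.ediam B ≤ ENNReal.ofReal ε := by
    intro z hz r hr
    obtain ⟨s, hs, hsU⟩ := Metric.isOpen_iff.1 hU z hz
    let t := min (min r (s / 2)) (ε / 2)
    have ht : 0 < t := by simp only [t]; positivity
    obtain ⟨B, hB, hzB, hBt⟩ := hℬ.exists_subset_of_mem_open (Metric.mem_ball_self ht)
      (Metric.isOpen_ball (x := z) (ε := t))
    refine ⟨B, hB, hzB, hBt.trans (Metric.ball_subset_ball ?_), ?_, ?_⟩
    · exact (min_le_left _ _).trans (min_le_left _ _)
    · refine (closure_mono hBt).trans (Metric.closure_ball_subset_closedBall.trans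
        ((Metric.closedBall_subset_ball ?_).trans hsU))
      have : t ≤ s / 2 := (min_le_left _ _).trans (min_le_right _ _)
      linarith
    · have h2 : 2 * t ≤ ε := by
        have : t ≤ ε / 2 := min_le_right _ _
        linarith
      refine Metric.ediam_le fun x hx y hy => ?_
      rw [edist_dist]
      apply ENNReal.ofReal_le_ofReal
      have h3 := Metric.mem_ball.1 (hBt hx)
      have h4 := Metric.mem_ball'.1 (hBt hy)
      linarith [dist_triangle x z y]
  let I := {B : ℬ × ℬ // closure (B.1 : Set P) ⊆ U ∧ closure (B.2 : Set P) ⊆ U ∧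
    Metric.ediam (B.1 : Set P) ≤ ENNReal.ofReal ε ∧
    Metric.ediam (B.2 : Set P) ≤ ENNReal.ofReal ε ∧ Disjoint (B.1 : Set P) B.2}
  have : Countable ℬ := hℬc.to_subtype
  have hbad : ∀ B : I, ∃ D, IsSmall π D ∧
      ¬ ∃ x, ∀ V ∈ range (fun b : Bool => cond b (B.1.2 : Set P) B.1.1) ∪ 𝒰,
        ∃ z ∈ V, z ∉ D ∧ π z = x := by
    rintro ⟨⟨B₁, B₂⟩, h1, h2, h3, h4, h5⟩
    have := hcon (fun b : Bool => cond b (B₂ : Set P) B₁) ?_ h5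
    · simpa [IsGood] using this
    · intro b
      cases b
      · exact ⟨hℬ.isOpen B₁.2, h1, h3⟩
      · exact ⟨hℬ.isOpen B₂.2, h2, h4⟩
  choose D hD hDbad using hbad
  let E := ⋃ B : I, D B
  have hE : IsSmall π E := IsSmall.iUnion hD
  have : Countable 𝒰 := h𝒰.to_subtype
  -- The index `Option 𝒰` adds `U` itself to the family, so that the intersection of analytic sets
  -- runs over a nonempty index.
  let Q : Set P := (U ∩ Eᶜ) ∩ π ⁻¹' (⋂ V : Option 𝒰, π '' ((V.elim U (fun W => W)) ∩ Eᶜ))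
  have hopen : ∀ V : Option 𝒰, IsOpen (V.elim U (fun W => (W : Set P))) := by
    rintro (_ | V)
    · exact hU
    · exact hop _ V.2
  have hQ : AnalyticSet Q := by
    refine AnalyticSet.inter' (hU.measurableSet.inter hE.measurableSet.compl).analyticSet
      (AnalyticSet.preimage (AnalyticSet.iInter fun V => ?_) hπ)
    exact ((hopen V).measurableSet.inter hE.measurableSet.compl).analyticSet.image_of_continuous hπ
  have hinj : InjOn π Q := by
    intro z hz w hw hzw
    by_contra hne
    have hd : 0 < dist z w / 2 := by have := dist_pos.2 hne; positivity
    obtain ⟨B₁, hB₁, hz₁, hb₁, hc₁, he₁⟩ := hbasis z hz.1.1 _ hd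
    obtain ⟨B₂, hB₂, hz₂, hb₂, hc₂, he₂⟩ := hbasis w hw.1.1 _ hd
    let B : I := ⟨(⟨B₁, hB₁⟩, ⟨B₂, hB₂⟩), hc₁, hc₂, he₁, he₂,
      (Metric.ball_disjoint_ball (by linarith)).mono hb₁ hb₂⟩
    have hED : ∀ y, y ∉ E → y ∉ D B := fun y hy hy' => hy (mem_iUnion.2 ⟨B, hy'⟩)
    refine hDbad B ⟨π z, ?_⟩
    rintro V (⟨b, rfl⟩ | hV)
    · cases b
      · exact ⟨z, hz₁, hED z hz.1.2, rfl⟩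
      · exact ⟨w, hz₂, hED w hw.1.2, hzw.symm⟩
    · obtain ⟨y, hy, hyz⟩ := mem_iInter.1 hz.2 (some ⟨V, hV⟩)
      exact ⟨y, hy.1, hED y hy.2, hyz⟩
  obtain ⟨R, hQR, hR, hRinj⟩ := exists_measurableSet_injOn hπ hQ hinj
  obtain ⟨x, hx⟩ := hg (E ∪ R) (hE.union (isSmall_of_injOn hR hRinj))
  obtain ⟨z, hz, hzE, rfl⟩ := hx U (mem_insert _ _)
  refine hzE (Or.inr (hQR ⟨⟨hz, fun h => hzE (Or.inl h)⟩, mem_iInter.2 ?_⟩))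
  rintro (_ | V)
  · exact ⟨z, ⟨hz, fun h => hzE (Or.inl h)⟩, rfl⟩
  · obtain ⟨y, hy, hyE, hyz⟩ := hx V (mem_insert_of_mem _ V.2)
    exact ⟨y, ⟨hy, fun h => hyE (Or.inl h)⟩, hyz⟩

/-- All sets of one level must be split while they keep a common fibre. They are split one at a
time: those already split and those still waiting form the side family of `IsGood.split`. -/
theorem IsGood.split_finset (hπ : Continuous π) {ι : Type*} (T : Finset ι) {U : ι → Set P}
    (hU : ∀ i ∈ T, IsOpen (U i)) (hg : IsGood π (U '' T)) {ε : ℝ} (hε : 0 < ε) :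
    ∃ V : ι → Bool → Set P, (∀ i ∈ T, (∀ b, IsOpen (V i b) ∧ closure (V i b) ⊆ U i ∧
      Metric.ediam (V i b) ≤ ENNReal.ofReal ε) ∧ Disjoint (V i false) (V i true)) ∧
      IsGood π {W | ∃ i ∈ T, ∃ b, W = V i b} := by
  classical
  suffices ∀ S ⊆ T, ∃ V : ι → Bool → Set P,
      (∀ i ∈ S, (∀ b, IsOpen (V i b) ∧ closure (V i b) ⊆ U i ∧
      Metric.ediam (V i b) ≤ ENNReal.ofReal ε) ∧ Disjoint (V i false) (V i true)) ∧
      IsGood π ({W | ∃ i ∈ S, ∃ b, W = V i b} ∪ U '' (T \ S : Finset ι)) by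
    obtain ⟨V, h1, h2⟩ := this T subset_rfl
    exact ⟨V, h1, h2.mono subset_union_left⟩
  intro S
  induction S using Finset.induction_on with
  | empty =>
    intro _
    exact ⟨fun _ _ => ∅, by simp, hg.mono (by simp)⟩
  | insert j S hj ih =>
    intro hS
    obtain ⟨V, hV, hVg⟩ := ih ((Finset.subset_insert j S).trans hS)
    have hjT : j ∈ T := hS (Finset.mem_insert_self j S)
    let 𝒰 : Set (Set P) := {W | ∃ i ∈ S, ∃ b, W = V i b} ∪ U '' (T \ insert j S : Finset ι)
    have hfin : 𝒰.Finite := by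
      refine Set.Finite.union ?_ ((Finset.finite_toSet _).image _)
      have : {W | ∃ i ∈ S, ∃ b, W = V i b} = ⋃ i ∈ S, range (V i) := by
        ext W; simp
      rw [this]
      exact S.finite_toSet.biUnion fun i _ => finite_range _
    have hop : ∀ W ∈ 𝒰, IsOpen W := by
      rintro W (⟨i, hi, b, rfl⟩ | ⟨i, hi, rfl⟩)
      · exact ((hV i hi).1 b).1
      · exact hU i (Finset.mem_sdiff.1 hi).1
    have hins : insert (U j) 𝒰 ⊆ {W | ∃ i ∈ S, ∃ b, W = V i b} ∪ U '' (T \ S : Finset ι) := by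
      rintro W (rfl | hW | ⟨i, hi, rfl⟩)
      · exact Or.inr ⟨j, by simp [hjT, hj], rfl⟩
      · exact Or.inl hW
      · refine Or.inr ⟨i, ?_, rfl⟩
        simp only [Finset.coe_sdiff, Finset.coe_insert, mem_sdiff, Finset.mem_coe,
          mem_insert_iff, not_or] at hi ⊢
        exact ⟨hi.1, hi.2.2⟩
    obtain ⟨V', hV', hd, hg'⟩ := (hVg.mono hins).split hπ hfin.countable hop (hU j hjT) hε
    refine ⟨Function.update V j V', ?_, hg'.mono ?_⟩
    · intro i hi
      by_cases hij : i = j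
      · subst hij
        simp only [Function.update_self]
        exact ⟨hV', hd⟩
      · simp only [Function.update_of_ne hij]
        exact hV i (Finset.mem_of_mem_insert_of_ne hi hij)
    · rintro W (⟨i, hi, b, rfl⟩ | hW)
      · by_cases hij : i = j
        · subst hij
          simp only [Function.update_self]
          exact Or.inl ⟨b, rfl⟩
        · simp only [Function.update_of_ne hij]
          exact Or.inr (Or.inl ⟨i, Finset.mem_of_mem_insert_of_ne hi hij, b, rfl⟩)
      · exact Or.inr (Or.inr hW)

/-- A continuous map with countable fibres on a Polish space is injective on each of countably
many Borel sets that cover the space. -/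
theorem isSmall_univ (hπ : Continuous π) (hc : ∀ x, (π ⁻¹' {x}).Countable) :
    IsSmall π (univ : Set P) := by
  by_contra hns
  -- Badness of `{univ}` would give a small set containing every fibre, that is, the whole space.
  have hg0 : IsGood π {(univ : Set P)} := by
    intro D hD
    by_contra hcon
    push Not at hcon
    apply hns
    convert! hD
    refine (eq_univ_of_forall fun z => ?_).symm
    by_contra hz
    obtain ⟨U, hU, h⟩ := hcon (π z)
    rw [mem_singleton_iff] at hU
    subst hU
    exact h z (mem_univ z) hz rfl
  let T : ℕ → Finset (List Bool) := fun n => (List.finite_length_eq Bool n).toFinset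
  have hT : ∀ n l, l ∈ T n ↔ l.length = n := fun n l => by simp [T]
  let St : ℕ → Type _ := fun n =>
    {U : List Bool → Set P // (∀ l ∈ T n, IsOpen (U l)) ∧ IsGood π (U '' (T n))}
  have step : ∀ n (U : St n), ∃ V : St (n + 1), ∀ l ∈ T n,
      (∀ b, closure (V.1 (b :: l)) ⊆ U.1 l ∧
        Metric.ediam (V.1 (b :: l)) ≤ ENNReal.ofReal (1 / ((n : ℝ) + 1))) ∧
      Disjoint (V.1 (false :: l)) (V.1 (true :: l)) := by
    intro n U
    obtain ⟨V, hV, hVg⟩ := IsGood.split_finset hπ (T n) U.2.1 U.2.2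
      (ε := 1 / ((n : ℝ) + 1)) (by positivity)
    -- Words of length `n + 1` are nonempty, so the default value in `headD` never matters.
    refine ⟨⟨fun l => V l.tail (l.headD false), ?_, hVg.mono ?_⟩, ?_⟩
    · intro l hl
      rw [hT] at hl
      cases l with
      | nil => simp at hl
      | cons b l => exact ((hV l ((hT n l).2 (by simpa using hl))).1 b).1
    · rintro W ⟨l, hl, rfl⟩
      rw [Finset.mem_coe, hT] at hl
      cases l with
      | nil => simp at hl
      | cons b l => exact ⟨l, (hT n l).2 (by simpa using hl), b, rfl⟩
    · intro l hl
      exact ⟨fun b => ((hV l hl).1 b).2, (hV l hl).2⟩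
  choose nxt hnxt using step
  let s0 : St 0 := ⟨fun _ => univ, by simp, hg0.mono (by rintro W ⟨_, _, rfl⟩; rfl)⟩
  let s : ∀ n, St n := fun n => Nat.rec s0 nxt n
  have hs : ∀ n, s (n + 1) = nxt n (s n) := fun n => rfl
  let A : List Bool → Set P := fun l => (s l.length).1 l
  have hA : ∀ l b, closure (A (b :: l)) ⊆ A l ∧
      Metric.ediam (A (b :: l)) ≤ ENNReal.ofReal (1 / ((l.length : ℝ) + 1)) := fun l b =>
    (hnxt l.length (s l.length) l ((hT _ _).2 rfl)).1 b
  have hdisj : CantorScheme.Disjoint A := by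
    intro l
    have h := (hnxt l.length (s l.length) l ((hT _ _).2 rfl)).2
    intro a b hab
    cases a <;> cases b
    · exact absurd rfl hab
    · exact h
    · exact h.symm
    · exact absurd rfl hab
  have hanti : CantorScheme.ClosureAntitone A := fun l b => (hA l b).1
  have hdiam : CantorScheme.VanishingDiam A := by
    intro x
    rw [← Filter.tendsto_add_atTop_iff_nat 1]
    have h0 : Filter.Tendsto (fun n : ℕ => ENNReal.ofReal (1 / ((n : ℝ) + 1))) Filter.atTop
        (nhds 0) := by
      have := ENNReal.tendsto_ofReal (tendsto_one_div_add_atTop_nhds_zero_nat (𝕜 := ℝ))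
      simpa using this
    refine tendsto_of_tendsto_of_tendsto_of_le_of_le tendsto_const_nhds h0 (fun _ => zero_le) ?_
    intro n
    have := (hA (PiNat.res x n) (x n)).2
    rw [PiNat.res_length] at this
    exact this
  have hcommon : ∀ n, ∃ x, ∀ l : List Bool, l.length = n → ∃ z ∈ A l, π z = x := by
    intro n
    obtain ⟨x, hx⟩ := (s n).2.2 ∅ isSmall_empty
    refine ⟨x, fun l hl => ?_⟩
    obtain ⟨z, hz, -, h⟩ := hx _ ⟨l, (hT n l).2 hl, rfl⟩
    subst hl
    exact ⟨z, hz, h⟩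
  have hne : ∀ l, (A l).Nonempty := fun l => by
    obtain ⟨x, hx⟩ := hcommon l.length
    obtain ⟨z, hz, -⟩ := hx l rfl
    exact ⟨z, hz⟩
  have hdom := CantorScheme.ClosureAntitone.map_of_vanishingDiam hdiam hanti hne
  let y : (ℕ → Bool) → P := fun β => (CantorScheme.inducedMap A).2 ⟨β, hdom ▸ mem_univ β⟩
  have hy : ∀ β n, y β ∈ A (PiNat.res β n) := fun β n => CantorScheme.map_mem _ n
  have hyinj : Function.Injective y := by
    intro β γ h
    simpa using hdisj.map_injective h
  choose x hx using hcommon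
  -- The sets of level `n` meet a common fibre, over `x n`. Along every branch `β` the chosen points
  -- converge to `y β`, so the one sequence `x` converges to `π (y β)` for all `β` at once, and the
  -- distinct points `y β` share a fibre.
  have hlim : ∀ β, Filter.Tendsto x Filter.atTop (nhds (π (y β))) := by
    intro β
    choose z hz hzx using fun n => hx n (PiNat.res β n) (PiNat.res_length β n)
    have h1 : Filter.Tendsto z Filter.atTop (nhds (y β)) := by
      rw [tendsto_iff_edist_tendsto_0]
      refine tendsto_of_tendsto_of_tendsto_of_le_of_le tendsto_const_nhds (hdiam β)
        (fun _ => zero_le) fun n => ?_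
      exact Metric.edist_le_ediam_of_mem (hz n) (hy β n)
    have h2 := (hπ.tendsto (y β)).comp h1
    refine h2.congr fun n => hzx n
  have hfib : range y ⊆ π ⁻¹' {π (y fun _ => false)} := by
    rintro _ ⟨β, rfl⟩
    exact tendsto_nhds_unique (hlim β) (hlim _)
  have hcount : (range y).Countable := (hc _).mono hfib
  have h5 : Cardinal.mk (ℕ → Bool) = Cardinal.continuum := by simp
  have h3 : Countable (ℕ → Bool) := by
    have := hcount.to_subtype
    exact (Equiv.ofInjective y hyinj).countable_iff.2 this
  have h4 : Cardinal.mk (ℕ → Bool) ≤ Cardinal.aleph0 := Cardinal.mk_le_aleph0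
  rw [h5] at h4
  exact absurd h4 (not_le.2 Cardinal.aleph0_lt_continuum)

end Metric

/-- A finer Polish topology makes `π` continuous without changing the Borel sets, and smallness only
refers to the latter. -/
theorem isSmall_univ_of_measurable {P X : Type*} [t : TopologicalSpace P] [PolishSpace P]
    [m : MeasurableSpace P] [BorelSpace P] [TopologicalSpace X] [SecondCountableTopology X]
    [T2Space X] [MeasurableSpace X] [OpensMeasurableSpace X] {π : P → X} (hπ : Measurable π)
    (hc : ∀ x, (π ⁻¹' {x}).Countable) : IsSmall π (univ : Set P) := by
  obtain ⟨t', ht', hcont, hpol⟩ := hπ.exists_continuous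
  have hb : @borel P t' = @borel P t := borel_eq_borel_of_le hpol inferInstance ht'
  have hb' : @BorelSpace P t' m := @BorelSpace.mk P t' m (by
    rw [hb]; exact BorelSpace.measurable_eq)
  let _ := @TopologicalSpace.upgradeIsCompletelyMetrizable P t' inferInstance
  exact @isSmall_univ P X _ _ _ m hb' _ _ π hcont hc

end LusinNovikov

open LusinNovikov in
/-- The **Lusin–Novikov theorem**: a Borel set whose sections are countable is the disjoint union
of countably many Borel sets whose sections have at most one point. -/
theorem MeasurableSet.exists_iUnion_injOn {Ω X : Type*} [MeasurableSpace Ω] [StandardBorelSpace Ω]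
    [TopologicalSpace X] [SecondCountableTopology X] [T2Space X] [MeasurableSpace X]
    [OpensMeasurableSpace X] {π : Ω → X} {S : Set Ω} (hS : MeasurableSet S)
    (hπ : Measurable (fun z : S => π z)) (hc : ∀ x, (S ∩ π ⁻¹' {x}).Countable) :
    ∃ D : ℕ → Set Ω, (∀ n, MeasurableSet (D n)) ∧ (∀ n, InjOn π (D n)) ∧
      Pairwise (fun m n => Disjoint (D m) (D n)) ∧ ⋃ n, D n = S := by
  have hstd : StandardBorelSpace S := hS.standardBorel
  let _ := upgradeStandardBorel S
  obtain ⟨F, hF, hFA, hU⟩ : IsSmall (fun z : S => π z) (univ : Set S) := by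
    refine isSmall_univ_of_measurable hπ fun x => ?_
    refine ((hc x).preimage Subtype.val_injective).mono ?_
    exact fun z hz => (⟨z.2, hz⟩ : (z : Ω) ∈ S ∩ π ⁻¹' {x})
  obtain ⟨A, hA⟩ := (hF.insert ∅).exists_eq_range (insert_nonempty _ _)
  have hmem : ∀ n, MeasurableSet (A n) ∧ InjOn (fun z : S => π z) (A n) := by
    intro n
    rcases (hA ▸ mem_range_self n : A n ∈ insert ∅ F) with h | h
    · rw [h]; exact ⟨MeasurableSet.empty, injOn_empty _⟩
    · exact hFA _ h
  refine ⟨disjointed fun n => Subtype.val '' A n, fun n => ?_, fun n => ?_,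
    disjoint_disjointed _, ?_⟩
  · exact MeasurableSet.disjointed (fun n => hS.subtype_image (hmem n).1) n
  · refine InjOn.mono (disjointed_subset _ n) ?_
    rintro _ ⟨z, hz, rfl⟩ _ ⟨w, hw, rfl⟩ h
    exact congrArg _ ((hmem n).2 hz hw h)
  · rw [iUnion_disjointed, ← image_iUnion]
    have : ⋃ n, A n = univ := by
      rw [hU, ← sUnion_range, ← hA]
      simp
    rw [this, image_univ, Subtype.range_coe]

end

/-! ### Boxes, plaques and saturations -/

section

/-- Applied to the transverse coordinate on two transversals of a box with the same projection, this
yields the Borel holonomy map to which the invariance of `ν` refers. -/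
theorem MeasurableEmbedding.exists_measurableEquiv {A B Y : Type*} [MeasurableSpace A]
    [MeasurableSpace B] [MeasurableSpace Y] {f : A → Y} {g : B → Y} (hf : MeasurableEmbedding f)
    (hg : MeasurableEmbedding g) (h : range f = range g) : ∃ e : A ≃ᵐ B, ∀ a, g (e a) = f a := by
  have h1 : ∀ a, ∃ b, g b = f a := fun a => h.subset (mem_range_self a)
  have h2 : ∀ b, ∃ a, f a = g b := fun b => h.superset (mem_range_self b)
  choose u hu using h1
  choose v hv using h2
  refine ⟨⟨⟨u, v, fun a => hf.injective (by rw [hv, hu]), fun b => hg.injective (by rw [hu, hv])⟩,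
    fun S hS => ?_, fun S hS => ?_⟩, hu⟩
  · have : u ⁻¹' S = f ⁻¹' (g '' S) := by
      ext a
      simp only [mem_preimage, mem_image]
      exact ⟨fun ha => ⟨u a, ha, hu a⟩, fun ⟨b, hb, hba⟩ => by
        rwa [hg.injective ((hu a).trans hba.symm)]⟩
    exact this ▸ hf.measurable (hg.measurableSet_image.2 hS)
  · have : v ⁻¹' S = g ⁻¹' (f '' S) := by
      ext b
      simp only [mem_preimage, mem_image]
      exact ⟨fun ha => ⟨v b, ha, hv b⟩, fun ⟨a, ha, hab⟩ => by
        rwa [hf.injective ((hv b).trans hab.symm)]⟩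
    exact this ▸ hg.measurable (hf.measurableSet_image.2 hS)

theorem ContinuousOn.measurableSet_inter_preimage {A Y : Type*} [TopologicalSpace A]
    [MeasurableSpace A] [OpensMeasurableSpace A] [TopologicalSpace Y] [MeasurableSpace Y]
    [BorelSpace Y] {f : A → Y} {s : Set A} (hf : ContinuousOn f s) (hs : MeasurableSet s)
    {t : Set Y} (ht : MeasurableSet t) : MeasurableSet (s ∩ f ⁻¹' t) := by
  have h := hs.subtype_image ((continuousOn_iff_continuous_domRestrict.1 hf).measurable ht)
  convert! h using 1
  ext x
  simp [and_comm]

namespace Foliation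

variable {p q : ℕ} {M : Type*} [TopologicalSpace M] [ChartedSpace (RSpace (p + q)) M]

/-- A product of open balls in a foliated chart. -/
structure Box (F : Foliation p q M) where
  chart : OpenPartialHomeomorph M (RSpace p × RSpace q)
  mem : chart ∈ F.charts
  a : RSpace p
  b : RSpace q
  r : ℝ
  pos : 0 < r
  sub : Metric.closedBall a r ×ˢ Metric.closedBall b r ⊆ chart.target

namespace Box

variable {F : Foliation p q M} (k : F.Box)

/-- The image of the box in the coordinate space. -/
def ball : Set (RSpace p × RSpace q) := Metric.ball k.a k.r ×ˢ Metric.ball k.b k.r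

/-- The box as a subset of the manifold. -/
def dom : Set M := k.chart.source ∩ k.chart ⁻¹' k.ball

/-- The transverse coordinate. -/
def tr (x : M) : RSpace q := (k.chart x).2

theorem ball_subset_target : k.ball ⊆ k.chart.target :=
  (prod_mono Metric.ball_subset_closedBall Metric.ball_subset_closedBall).trans k.sub

theorem isOpen_ball : IsOpen k.ball := Metric.isOpen_ball.prod Metric.isOpen_ball

theorem convex_ball : Convex ℝ k.ball :=
  Convex.prod (_root_.convex_ball _ _) (_root_.convex_ball _ _)

theorem isOpen_dom : IsOpen k.dom := k.chart.isOpen_inter_preimage k.isOpen_ball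

theorem symm_mem_dom {z : RSpace p × RSpace q} (hz : z ∈ k.ball) : k.chart.symm z ∈ k.dom := by
  have h := k.ball_subset_target hz
  refine ⟨k.chart.map_target h, ?_⟩
  rw [mem_preimage, k.chart.right_inv h]
  exact hz

theorem continuousOn_chart : ContinuousOn k.chart k.dom := k.chart.continuousOn.mono inter_subset_left

theorem continuousOn_tr : ContinuousOn k.tr k.dom := continuous_snd.comp_continuousOn k.continuousOn_chart

theorem injOn_chart : InjOn k.chart k.dom := k.chart.injOn.mono inter_subset_left

theorem mem_leaf {x y : M} (hx : x ∈ k.dom) (hy : y ∈ k.dom) (h : k.tr x = k.tr y) :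
    y ∈ F.leaf x :=
  Relation.EqvGen.rel _ _ ⟨k.chart, k.mem, hx.1, hy.1, h,
    (k.convex_ball.segment_subset hx.2 hy.2).trans k.ball_subset_target⟩

theorem exists_transition (l : F.Box) {x : M} (hk : x ∈ k.dom) (hl : x ∈ l.dom) :
    ∃ h : RSpace q → RSpace q, ∀ᶠ y in nhds x, l.tr y = h (k.tr y) := by
  obtain ⟨h, hh⟩ := F.compatible k.chart k.mem l.chart l.mem x ⟨hk.1, hl.1⟩
  refine ⟨h, ?_⟩
  have h1 := (k.chart.continuousAt hk.1).eventually hh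
  filter_upwards [h1, k.chart.open_source.mem_nhds hk.1] with y hy hys
  rw [k.chart.left_inv hys] at hy
  exact hy

end Box

theorem exists_box (F : Foliation p q M) {e : OpenPartialHomeomorph M (RSpace p × RSpace q)}
    (he : e ∈ F.charts) {x : M} (hx : x ∈ e.source) {R : ℝ} (hR : 0 < R) :
    ∃ k : F.Box, k.chart = e ∧ k.a = (e x).1 ∧ k.b = (e x).2 ∧ k.r ≤ R ∧ x ∈ k.dom := by
  obtain ⟨s, hs, hsub⟩ := Metric.isOpen_iff.1 e.open_target (e x) (e.map_source hx)
  have hr : 0 < min (s / 2) R := by positivity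
  refine ⟨⟨e, he, (e x).1, (e x).2, min (s / 2) R, hr, ?_⟩, rfl, rfl, rfl, min_le_right _ _, hx, ?_⟩
  · rw [closedBall_prod_same]
    refine (Metric.closedBall_subset_ball ?_).trans hsub
    have := min_le_left (s / 2) R
    linarith
  · exact ⟨Metric.mem_ball_self hr, Metric.mem_ball_self hr⟩

theorem exists_box_mem (F : Foliation p q M) (x : M) : ∃ k : F.Box, x ∈ k.dom := by
  obtain ⟨e, he, hx⟩ := F.covers x
  obtain ⟨k, -, -, -, -, h⟩ := F.exists_box he hx one_pos
  exact ⟨k, h⟩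

/-- The leaf relation is generated by the plaques of any family of boxes that covers `M`. -/
theorem leaf_subset_eqvGen (F : Foliation p q M) {𝒞 : Set F.Box}
    (h𝒞 : ∀ x, ∃ k ∈ 𝒞, x ∈ k.dom) (x : M) : F.leaf x ⊆
      {y | Relation.EqvGen (fun x y => ∃ k ∈ 𝒞, x ∈ k.dom ∧ y ∈ k.dom ∧ k.tr x = k.tr y) x y} := by
  intro y hy
  set R : M → M → Prop := fun x y => ∃ k ∈ 𝒞, x ∈ k.dom ∧ y ∈ k.dom ∧ k.tr x = k.tr y with hR
  have hEq := Relation.EqvGen.is_equivalence R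
  have key : ∀ x y, F.PlaqueRel x y → Relation.EqvGen R x y := by
    rintro x y ⟨e, he, hx, hy, hxy, hseg⟩
    have hsnd : ∀ z ∈ segment ℝ (e x) (e y), z.2 = (e x).2 := by
      rintro z ⟨s, t, -, -, hst, rfl⟩
      simp [← hxy, ← add_smul, hst]
    -- Nearby points of the segment lie in one plaque of a box of the cover, because transition maps
    -- preserve plaques locally. Connectedness of the segment extends this to its end points.
    have := (convex_segment (e x) (e y)).isPreconnected.induction₂
      (fun z w => Relation.EqvGen R (e.symm z) (e.symm w)) ?_
      (fun _ _ _ _ _ _ => hEq.trans) (fun _ _ _ _ => hEq.symm)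
      (left_mem_segment ℝ _ _) (right_mem_segment ℝ _ _)
    · simpa [e.left_inv hx, e.left_inv hy] using this
    · intro z hz
      obtain ⟨k, hk, hzk⟩ := h𝒞 (e.symm z)
      have hzt := hseg hz
      obtain ⟨h, hh⟩ := F.compatible e he k.chart k.mem (e.symm z) ⟨e.map_target hzt, hzk.1⟩
      rw [e.right_inv hzt] at hh
      have h1 : ∀ᶠ w in nhds z, e.symm w ∈ k.dom :=
        (e.continuousAt_symm hzt).eventually (k.isOpen_dom.mem_nhds hzk)
      filter_upwards [nhdsWithin_le_nhds h1, nhdsWithin_le_nhds hh, self_mem_nhdsWithin]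
        with w hw1 hw2 hw3
      refine Relation.EqvGen.rel _ _ ⟨k, hk, hzk, hw1, ?_⟩
      have h3 := hh.self_of_nhds
      simp only [Box.tr]
      rw [h3, hw2, hsnd z hz, hsnd w hw3]
  have hy' : Relation.EqvGen F.PlaqueRel x y := hy
  induction hy' with
  | rel x y h => exact key x y h
  | refl x => exact hEq.refl x
  | symm x y _ ih => exact hEq.symm (ih ‹_›)
  | trans x y z _ _ ih1 ih2 => exact hEq.trans (ih1 ‹_›) (ih2 ‹_›)

section Saturation

variable {F : Foliation p q M}

/-- The union of the leaves that meet `A`. -/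
def saturation (F : Foliation p q M) (A : Set M) : Set M := {x | ∃ y ∈ F.leaf x, y ∈ A}

theorem exists_countable_boxes [SecondCountableTopology M] (F : Foliation p q M) :
    ∃ 𝒞 : Set F.Box, 𝒞.Countable ∧ ∀ x, ∃ k ∈ 𝒞, x ∈ k.dom := by
  choose k hk using F.exists_box_mem
  obtain ⟨t, ht, -, h⟩ := (HereditarilyLindelofSpace.isLindelof (univ : Set M)).elim_nhds_subcover
    (fun x => (k x).dom) (fun x _ => (k x).isOpen_dom.mem_nhds (hk x))
  refine ⟨k '' t, ht.image k, fun x => ?_⟩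
  obtain ⟨y, hy, hxy⟩ := mem_iUnion₂.1 (h (mem_univ x))
  exact ⟨k y, mem_image_of_mem k hy, hxy⟩

/-- A notion of smallness for sets of plaques of boxes: a σ-ideal that is preserved by the local
holonomy maps. -/
structure IsPlaqueIdeal (J : F.Box → Set (RSpace q) → Prop) : Prop where
  mono : ∀ k A B, A ⊆ B → J k B → J k A
  iUnion : ∀ k (ι : Type) (S : ι → Set (RSpace q)), Countable ι → (∀ i, J k (S i)) →
    J k (⋃ i, S i)
  loc : ∀ k l N, J k N → ∀ x ∈ k.dom ∩ l.dom, ∃ O ∈ nhds x,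
      J l (l.tr '' (O ∩ (k.dom ∩ l.dom) ∩ k.tr ⁻¹' N))

namespace IsPlaqueIdeal

variable {J : F.Box → Set (RSpace q) → Prop}

theorem biUnion (hJ : IsPlaqueIdeal J) {ι : Type*} {k : F.Box} {T : Set ι} (hT : T.Countable)
    {S : ι → Set (RSpace q)} (h : ∀ i ∈ T, J k (S i)) : J k (⋃ i ∈ T, S i) := by
  rcases T.eq_empty_or_nonempty with rfl | hne
  · have := hJ.iUnion k Empty (fun _ => ∅) inferInstance (by simp)
    simpa using this
  · obtain ⟨f, rfl⟩ := hT.exists_eq_range hne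
    refine hJ.mono k _ _ ?_ (hJ.iUnion k ℕ (fun n => S (f n)) inferInstance fun n => h _ ⟨n, rfl⟩)
    simp

/-- The axiom `loc` handles a neighbourhood of each point; by the Lindelöf property countably many
of these cover the overlap. -/
theorem transfer [SecondCountableTopology M] (hI : IsPlaqueIdeal J)
    {k l : F.Box} {N : Set (RSpace q)} (hN : J k N) : J l (l.tr '' ((k.dom ∩ l.dom) ∩ k.tr ⁻¹' N)) := by
  choose! O hO hJ using hI.loc k l N hN
  obtain ⟨t, ht, hts, h⟩ := (HereditarilyLindelofSpace.isLindelof (k.dom ∩ l.dom)).elim_nhds_subcover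
    O hO
  refine hI.mono l _ _ ?_ (hI.biUnion ht fun x hx => hJ x (hts x hx))
  rintro _ ⟨y, hy, rfl⟩
  obtain ⟨x, hx, hyx⟩ := mem_iUnion₂.1 (h hy.1)
  exact mem_iUnion₂.2 ⟨x, hx, y, ⟨⟨hyx, hy.1⟩, hy.2⟩, rfl⟩

/-- Smallness passes from a set to its saturation. -/
theorem saturation [SecondCountableTopology M] (hI : IsPlaqueIdeal J)
    {A : Set M} (hA : ∀ k : F.Box, J k (k.tr '' (A ∩ k.dom))) (k : F.Box) :
    J k (k.tr '' (_root_.Foliation.saturation F A ∩ k.dom)) := by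
  obtain ⟨𝒞, h𝒞, hcov⟩ := F.exists_countable_boxes
  -- `S n` contains the points joined to `A` by at most `n` plaques of the countable cover. Each
  -- step preserves smallness, and the union is invariant under the leaf relation.
  let S : ℕ → Set M := fun n => Nat.rec A
    (fun _ B => B ∪ ⋃ k ∈ 𝒞, {y | y ∈ k.dom ∧ k.tr y ∈ k.tr '' (B ∩ k.dom)}) n
  have hS : ∀ n, S (n + 1) = S n ∪ ⋃ k ∈ 𝒞, {y | y ∈ k.dom ∧ k.tr y ∈ k.tr '' (S n ∩ k.dom)} :=
    fun n => rfl
  have hJ : ∀ n (k : F.Box), J k (k.tr '' (S n ∩ k.dom)) := by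
    intro n
    induction n with
    | zero => exact hA
    | succ n ih =>
      intro l
      have h1 : J l (⋃ k ∈ 𝒞, l.tr '' ((k.dom ∩ l.dom) ∩ k.tr ⁻¹' (k.tr '' (S n ∩ k.dom)))) :=
        hI.biUnion h𝒞 fun k _ => hI.transfer (ih k)
      have h2 := hI.iUnion l Bool (fun b => cond b (l.tr '' (S n ∩ l.dom)) _) inferInstance
        (fun b => by cases b; exacts [h1, ih l])
      refine hI.mono l _ _ ?_ h2
      rintro _ ⟨y, ⟨hy, hyl⟩, rfl⟩
      rw [hS] at hy
      rcases hy with hy | hy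
      · exact mem_iUnion.2 ⟨true, y, ⟨hy, hyl⟩, rfl⟩
      · obtain ⟨k, hk, hy1, hy2⟩ := mem_iUnion₂.1 hy
        exact mem_iUnion.2 ⟨false, mem_iUnion₂.2 ⟨k, hk, y, ⟨⟨hy1, hyl⟩, hy2⟩, rfl⟩⟩
  refine hI.mono k _ _ ?_ (hI.iUnion k ℕ (fun n => k.tr '' (S n ∩ k.dom)) inferInstance fun n => hJ n k)
  rw [← image_iUnion, ← iUnion_inter]
  refine image_mono (inter_subset_inter_left _ ?_)
  rintro x ⟨y, hy, hyA⟩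
  have hxy := F.leaf_subset_eqvGen hcov x hy
  have : ∀ x y, Relation.EqvGen (fun x y => ∃ k ∈ 𝒞, x ∈ k.dom ∧ y ∈ k.dom ∧ k.tr x = k.tr y) x y →
      (x ∈ ⋃ n, S n ↔ y ∈ ⋃ n, S n) := by
    intro x y hxy
    induction hxy with
    | rel x y h =>
      obtain ⟨k, hk, hx, hy, hxy⟩ := h
      simp only [mem_iUnion]
      constructor
      · rintro ⟨n, hn⟩
        exact ⟨n + 1, Or.inr (mem_iUnion₂.2 ⟨k, hk, hy, x, ⟨hn, hx⟩, hxy⟩)⟩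
      · rintro ⟨n, hn⟩
        exact ⟨n + 1, Or.inr (mem_iUnion₂.2 ⟨k, hk, hx, y, ⟨hn, hy⟩, hxy.symm⟩)⟩
    | refl x => rfl
    | symm x y _ ih => exact ih.symm
    | trans x y z _ _ ih1 ih2 => exact ih1.trans ih2
  exact (this x y hxy).2 (mem_iUnion.2 ⟨0, hyA⟩)

end IsPlaqueIdeal

theorem isPlaqueIdeal_countable :
    IsPlaqueIdeal fun (_ : F.Box) (N : Set (RSpace q)) => N.Countable where
  mono _ _ _ h hB := hB.mono h
  iUnion _ _ S _ h := countable_iUnion h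
  loc := by
    rintro k l N hN x ⟨hk, hl⟩
    obtain ⟨h, hh⟩ := k.exists_transition l hk hl
    refine ⟨_, hh, (hN.image h).mono ?_⟩
    rintro _ ⟨y, ⟨⟨hy, -⟩, hyN⟩, rfl⟩
    exact ⟨_, hyN, Eq.symm hy⟩

/-- The leaf of `x` lies in the saturation of `{x}`, and countability is a plaque ideal. -/
theorem countable_tr_leaf [SecondCountableTopology M] (k : F.Box) (x : M) : (k.tr '' (F.leaf x ∩ k.dom)).Countable := by
  have h := isPlaqueIdeal_countable.saturation (A := {x})
    (fun k : F.Box => ((countable_singleton x).mono inter_subset_left).image _) k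
  refine h.mono (image_mono (inter_subset_inter_left _ fun y hy => ?_))
  have h1 : x ∈ F.leaf y := (Relation.EqvGen.is_equivalence F.PlaqueRel).symm hy
  exact ⟨x, h1, rfl⟩

end Saturation

end Foliation

end

/-! ### The transverse measure inside a box -/

section

namespace Foliation

variable {p q : ℕ} {M : Type*} [TopologicalSpace M] [ChartedSpace (RSpace (p + q)) M]

theorem isFoliatedChart_of_mem {F : Foliation p q M}
    {e : OpenPartialHomeomorph M (RSpace p × RSpace q)} (he : e ∈ F.charts) :
    F.IsFoliatedChart e :=
  ⟨F.smooth e he, fun e' he' => ⟨F.compatible e he e' he', F.compatible e' he' e he⟩⟩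

namespace Box

variable {F : Foliation p q M} (k : F.Box)

/-- The central transversal of a box. -/
def slice : Set M := k.dom ∩ k.chart ⁻¹' ({k.a} ×ˢ univ)

theorem symm_mem_slice {t : RSpace q} (ht : t ∈ Metric.ball k.b k.r) :
    k.chart.symm (k.a, t) ∈ k.slice ∧ k.tr (k.chart.symm (k.a, t)) = t := by
  have h : (k.a, t) ∈ k.ball := ⟨Metric.mem_ball_self k.pos, ht⟩
  have h2 := k.chart.right_inv (k.ball_subset_target h)
  refine ⟨⟨k.symm_mem_dom h, ?_⟩, by simp [tr, h2]⟩
  simp [h2]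

theorem injOn_tr_slice : InjOn k.tr k.slice := by
  intro x hx y hy h
  refine k.injOn_chart hx.1 hy.1 (Prod.ext ?_ h)
  exact hx.2.1.trans hy.2.1.symm

section Measurable

variable [MeasurableSpace M] [BorelSpace M]

theorem measurableSet_dom : MeasurableSet k.dom := k.isOpen_dom.measurableSet

theorem measurableSet_inter_tr {D : Set M} (hD : MeasurableSet D) (hsub : D ⊆ k.dom)
    {N : Set (RSpace q)} (hN : MeasurableSet N) : MeasurableSet (D ∩ k.tr ⁻¹' N) :=
  (k.continuousOn_tr.mono hsub).measurableSet_inter_preimage hD hN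

theorem measurableSet_slice : MeasurableSet k.slice :=
  k.continuousOn_chart.measurableSet_inter_preimage k.measurableSet_dom
    ((measurableSet_singleton _).prod MeasurableSet.univ)

theorem aemeasurable_tr (μ : Measure M) {D : Set M} (hD : MeasurableSet D) (hsub : D ⊆ k.dom) :
    AEMeasurable k.tr (μ.restrict D) :=
  (k.continuousOn_tr.mono hsub).aemeasurable hD

variable [PolishSpace M]

theorem measurableSet_image_tr {D : Set M} (hD : MeasurableSet D) (hsub : D ⊆ k.dom)
    (hinj : InjOn k.tr D) : MeasurableSet (k.tr '' D) :=
  hD.image_of_continuousOn_injOn (k.continuousOn_tr.mono hsub) hinj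

/-- A leaf runs through countably many plaques of the box, and `D` has at most one point on each of
them. -/
theorem isBorelTransversal {D : Set M} (hD : MeasurableSet D) (hsub : D ⊆ k.dom)
    (hinj : InjOn k.tr D) : F.IsBorelTransversal D := by
  refine ⟨hD, fun x => ?_⟩
  refine Set.countable_of_injective_of_countable_image (f := k.tr) (hinj.mono inter_subset_left) ?_
  refine (countable_tr_leaf k x).mono (image_mono ?_)
  exact fun y hy => (⟨hy.2, hsub hy.1⟩ : y ∈ F.leaf x ∩ k.dom)

variable (ν : F.TransverseMeasure)

/-- Holonomy invariance inside a box. -/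
theorem measure_eq_of_image_eq {D E : Set M} (hD : MeasurableSet D) (hDs : D ⊆ k.dom)
    (hDi : InjOn k.tr D) (hE : MeasurableSet E) (hEs : E ⊆ k.dom) (hEi : InjOn k.tr E)
    (h : k.tr '' D = k.tr '' E) : ν.toMeasure D = ν.toMeasure E := by
  have hD' := k.isBorelTransversal hD hDs hDi
  have hE' := k.isBorelTransversal hE hEs hEi
  rw [ν.toMeasure_apply hD', ν.toMeasure_apply hE']
  have h1 := (k.continuousOn_tr.mono hDs).measurableEmbedding hD hDi
  have h2 := (k.continuousOn_tr.mono hEs).measurableEmbedding hE hEi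
  obtain ⟨ψ, hψ⟩ := h1.exists_measurableEquiv h2 (by rw [range_domRestrict, range_domRestrict, h])
  exact ν.invariant D E hD' hE' ψ fun x => k.mem_leaf (hDs x.2) (hEs (ψ x).2) (hψ x).symm

/-- The transverse measure of a box, as a measure on the transverse coordinate space. -/
def μ : Measure (RSpace q) := (ν.toMeasure.restrict k.slice).map k.tr

theorem μ_apply {N : Set (RSpace q)} (hN : MeasurableSet N) :
    k.μ ν N = ν.toMeasure (k.slice ∩ k.tr ⁻¹' N) := by
  rw [μ, Measure.map_apply_of_aemeasurable
    (k.aemeasurable_tr _ k.measurableSet_slice inter_subset_left) hN,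
    Measure.restrict_apply' k.measurableSet_slice, inter_comm]

/-- Sliding along plaques identifies `D` with the part of the central slice over its projection. -/
theorem measure_eq {D : Set M} (hD : MeasurableSet D) (hDs : D ⊆ k.dom) (hDi : InjOn k.tr D) :
    ν.toMeasure D = k.μ ν (k.tr '' D) := by
  have hm := k.measurableSet_image_tr hD hDs hDi
  rw [k.μ_apply ν hm]
  refine k.measure_eq_of_image_eq ν hD hDs hDi
    (k.measurableSet_inter_tr k.measurableSet_slice inter_subset_left hm)
    (inter_subset_left.trans inter_subset_left) (k.injOn_tr_slice.mono inter_subset_left) ?_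
  ext t
  constructor
  · rintro ⟨x, hx, rfl⟩
    obtain ⟨h1, h2⟩ := k.symm_mem_slice (hDs hx).2.2
    exact ⟨_, ⟨h1, by rw [mem_preimage]; exact ⟨x, hx, h2.symm⟩⟩, h2⟩
  · rintro ⟨x, hx, rfl⟩
    exact hx.2

theorem lintegral_eq {D : Set M} (hD : MeasurableSet D) (hDs : D ⊆ k.dom) (hDi : InjOn k.tr D)
    {g : RSpace q → ℝ≥0∞} (hg : Measurable g) :
    ∫⁻ x in D, g (k.tr x) ∂ν.toMeasure = ∫⁻ t in k.tr '' D, g t ∂(k.μ ν) := by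
  have hae := k.aemeasurable_tr ν.toMeasure hD hDs
  have h : (ν.toMeasure.restrict D).map k.tr = (k.μ ν).restrict (k.tr '' D) := by
    ext N hN
    rw [Measure.map_apply_of_aemeasurable hae hN, Measure.restrict_apply' hD,
      Measure.restrict_apply hN, inter_comm, k.measure_eq ν (k.measurableSet_inter_tr hD hDs hN)
      (inter_subset_left.trans hDs) (hDi.mono inter_subset_left), image_inter_preimage, inter_comm]
  rw [← h, lintegral_map' hg.aemeasurable hae]

instance isFiniteMeasure_μ : IsFiniteMeasure (k.μ ν) := by
  refine ⟨?_⟩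
  rw [k.μ_apply ν MeasurableSet.univ]
  -- The full chart slice `T` is a smooth transversal, and its part `K` over the closed ball is
  -- compact. The closed balls in `Box.sub` serve this finiteness.
  let T : Set M := k.chart.source ∩ k.chart ⁻¹' ({k.a} ×ˢ univ)
  let K : Set M := k.chart.symm '' ({k.a} ×ˢ Metric.closedBall k.b k.r)
  have hsub : ({k.a} ×ˢ Metric.closedBall k.b k.r : Set (RSpace p × RSpace q)) ⊆ k.chart.target :=
    (prod_mono (singleton_subset_iff.2 (Metric.mem_closedBall_self k.pos.le)) subset_rfl).trans k.sub
  have hK : IsCompact K := (isCompact_singleton.prod (isCompact_closedBall _ _)).image_of_continuousOn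
    (k.chart.symm.continuousOn.mono hsub)
  have hT : F.IsSmoothTransversal T := by
    rintro x ⟨hx, hxa⟩
    refine ⟨k.chart, isFoliatedChart_of_mem k.mem, hx, ?_⟩
    ext y
    have hxa' : (k.chart x).1 = k.a := hxa.1
    simp only [T, mem_inter_iff, mem_preimage, mem_prod, mem_singleton_iff, mem_univ, and_true,
      mem_ofPred, hxa']
    tauto
  have hKT : K ⊆ T := by
    rintro _ ⟨z, hz, rfl⟩
    refine ⟨k.chart.map_target (hsub hz), ?_⟩
    rw [mem_preimage, k.chart.right_inv (hsub hz)]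
    exact ⟨hz.1, mem_univ _⟩
  have hfin := ν.finite T K hT hK hKT
  have hsl : F.IsBorelTransversal k.slice :=
    k.isBorelTransversal k.measurableSet_slice inter_subset_left k.injOn_tr_slice
  -- `K` may reach beyond the open box, so it is covered by countably many boxes of the same chart,
  -- where the countability of plaques applies.
  have hbt : F.IsBorelTransversal K := by
    refine ⟨hK.measurableSet, fun x => ?_⟩
    have : Nonempty F.Box := ⟨k⟩
    choose! l hlc hl using fun (y : M) (hy : y ∈ K) =>
      (F.exists_box k.mem (hKT hy).1 one_pos).imp fun l hl => And.intro hl.1 hl.2.2.2.2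
    obtain ⟨t, ht, htK, hcov⟩ := (HereditarilyLindelofSpace.isLindelof K).elim_nhds_subcover
      (fun y => (l y).dom) fun y hy => (l y).isOpen_dom.mem_nhds (hl y hy)
    refine (ht.biUnion fun y hy => ?_ : (⋃ y ∈ t, K ∩ F.leaf x ∩ (l y).dom).Countable).mono
      fun z hz => ?_
    · refine Set.countable_of_injective_of_countable_image (f := (l y).tr) ?_
        ((countable_tr_leaf (l y) x).mono (image_mono fun z hz => mem_inter hz.1.2 hz.2))
      intro z hz w hw hzw
      have hz1 := hKT hz.1.1
      have hw1 := hKT hw.1.1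
      simp only [tr, hlc y (htK y hy)] at hzw
      exact k.chart.injOn hz1.1 hw1.1 (Prod.ext (hz1.2.1.trans hw1.2.1.symm) hzw)
    · obtain ⟨y, hy, hzy⟩ := mem_iUnion₂.1 (hcov hz.1)
      exact mem_iUnion₂.2 ⟨y, hy, hz, hzy⟩
  refine lt_of_le_of_lt ?_ (lt_of_le_of_lt (ν.val_mono hsl hbt ?_) hfin)
  · rw [preimage_univ, inter_univ, ν.toMeasure_apply hsl]
  · rintro x ⟨⟨hx, hxb⟩, hxa⟩
    exact ⟨k.chart x, ⟨hxa.1, Metric.ball_subset_closedBall hxb.2⟩, k.chart.left_inv hx⟩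

/-- A Borel set in a box with countable plaque sections is a disjoint union of countably many Borel
sets that meet each plaque at most once. -/
theorem exists_iUnion_injOn {D : Set M} (hD : MeasurableSet D) (hDs : D ⊆ k.dom)
    (hc : ∀ t, (D ∩ k.tr ⁻¹' {t}).Countable) :
    ∃ E : ℕ → Set M, (∀ n, MeasurableSet (E n)) ∧ (∀ n, InjOn k.tr (E n)) ∧
      Pairwise (fun m n => Disjoint (E m) (E n)) ∧ ⋃ n, E n = D :=
  hD.exists_iUnion_injOn
    (continuousOn_iff_continuous_domRestrict.1 (k.continuousOn_tr.mono hDs)).measurable hc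

/-- Cut `D` into countably many sheets. The sum of the indicators of their projections counts the
points of `D` on a plaque, which is at most 2 and vanishes off `W`; integrating it against `μ` gives
the bound. -/
theorem measure_le_two_mul {D : Set M} (hD : MeasurableSet D) (hDs : D ⊆ k.dom)
    (h2 : ∀ x ∈ D, ∀ y ∈ D, ∀ z ∈ D, k.tr x = k.tr y → k.tr y = k.tr z → x = y ∨ y = z ∨ x = z)
    {W : Set (RSpace q)} (hW : MeasurableSet W) (hDW : k.tr '' D ⊆ W) :
    ν.toMeasure D ≤ 2 * k.μ ν W := by
  have hcard : ∀ t (s : Finset M), (∀ x ∈ s, x ∈ D ∧ k.tr x = t) → s.card ≤ 2 := by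
    intro t s hs
    by_contra hlt
    push Not at hlt
    obtain ⟨x, hx, y, hy, z, hz, hxy, hxz, hyz⟩ := Finset.two_lt_card.1 hlt
    rcases h2 x (hs x hx).1 y (hs y hy).1 z (hs z hz).1 ((hs x hx).2.trans (hs y hy).2.symm)
      ((hs y hy).2.trans (hs z hz).2.symm) with h | h | h
    exacts [hxy h, hyz h, hxz h]
  obtain ⟨E, hE, hEi, hEd, rfl⟩ := k.exists_iUnion_injOn hD hDs (fun t => by
    by_contra hcon
    have hinf : (D ∩ k.tr ⁻¹' {t}).Infinite := fun hf => hcon hf.countable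
    obtain ⟨s, hs, hs3⟩ := hinf.exists_subset_card_eq 3
    have := hcard t s fun x hx => hs hx
    omega)
  have hEs : ∀ n, E n ⊆ k.dom := fun n => (subset_iUnion E n).trans hDs
  rw [measure_iUnion hEd hE]
  have hm : ∀ n, MeasurableSet (k.tr '' E n) := fun n =>
    k.measurableSet_image_tr (hE n) (hEs n) (hEi n)
  calc ∑' n, ν.toMeasure (E n) = ∑' n, ∫⁻ t, (k.tr '' E n).indicator 1 t ∂(k.μ ν) := by
        refine tsum_congr fun n => ?_
        rw [lintegral_indicator_one (hm n), k.measure_eq ν (hE n) (hEs n) (hEi n)]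
    _ = ∫⁻ t, ∑' n, (k.tr '' E n).indicator 1 t ∂(k.μ ν) :=
        (lintegral_tsum fun n => (measurable_one.indicator (hm n)).aemeasurable).symm
    _ ≤ ∫⁻ t, W.indicator (fun _ => 2) t ∂(k.μ ν) := by
        refine lintegral_mono fun t => ?_
        by_cases ht : t ∈ W
        · rw [indicator_of_mem ht, ENNReal.tsum_eq_iSup_sum]
          refine iSup_le fun s => ?_
          classical
          rw [Finset.sum_indicator_eq_sum_filter]
          simp only [Pi.one_apply, Finset.sum_const, nsmul_eq_mul, mul_one]
          have hne : ∀ n, ∃ x : M, t ∈ k.tr '' E n → x ∈ E n ∧ k.tr x = t := by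
            intro n
            by_cases h : t ∈ k.tr '' E n
            · exact h.imp fun x hx _ => hx
            · exact ⟨k.chart.symm (k.a, k.b), fun h' => absurd h' h⟩
          choose x hx' using hne
          have hx : ∀ n ∈ s.filter fun n => t ∈ k.tr '' E n, x n ∈ E n ∧ k.tr (x n) = t :=
            fun n hn => hx' n (Finset.mem_filter.1 hn).2
          have hle := hcard t ((s.filter fun n => t ∈ k.tr '' E n).image x) (by
            intro y hy
            obtain ⟨n, hn, rfl⟩ := Finset.mem_image.1 hy
            exact ⟨mem_iUnion.2 ⟨n, (hx n hn).1⟩, (hx n hn).2⟩)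
          rw [Finset.card_image_of_injOn] at hle
          · exact_mod_cast hle
          · intro m hm n hn hmn
            by_contra hne
            exact Set.disjoint_left.1 (hEd hne) (hx m hm).1 (hmn ▸ (hx n hn).1)
        · rw [indicator_of_notMem ht]
          simp only [nonpos_iff_eq_zero, ENNReal.tsum_eq_zero]
          intro n
          refine indicator_of_notMem (fun h => ht (hDW ?_)) _
          exact image_mono (subset_iUnion E n) h
    _ = 2 * k.μ ν W := by rw [lintegral_indicator_const hW]

/-- The set is a union of plaques and in general not a transversal, so its measure is a supremum
over transversals inside it. Each of these splits into sheets, whose measures are those of their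
projections, contained in a null set. -/
theorem measure_preimage_eq_zero {N : Set (RSpace q)} (hN : k.μ ν N = 0) :
    ν.toMeasure (k.dom ∩ k.tr ⁻¹' N) = 0 := by
  let N' := toMeasurable (k.μ ν) N
  have hN' : k.μ ν N' = 0 := (measure_toMeasurable N).trans hN
  have hm : MeasurableSet (k.dom ∩ k.tr ⁻¹' N') :=
    k.measurableSet_inter_tr k.measurableSet_dom subset_rfl (measurableSet_toMeasurable _ _)
  refine measure_mono_null (t := k.dom ∩ k.tr ⁻¹' N')
    (inter_subset_inter_right _ (preimage_mono (subset_toMeasurable _ _))) ?_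
  rw [TransverseMeasure.toMeasure, Measure.ofMeasurable_apply _ hm, ENNReal.iSup_eq_zero]
  rintro ⟨B, hB⟩
  have hB' := hB.inter hm
  change ν.val (B ∩ (k.dom ∩ k.tr ⁻¹' N')) = 0
  rw [← ν.toMeasure_apply hB']
  have hs : B ∩ (k.dom ∩ k.tr ⁻¹' N') ⊆ k.dom := fun x hx => hx.2.1
  obtain ⟨E, hE, hEi, hEd, hU⟩ := k.exists_iUnion_injOn hB'.1 hs (fun t => by
    rcases (B ∩ (k.dom ∩ k.tr ⁻¹' N') ∩ k.tr ⁻¹' {t}).eq_empty_or_nonempty with h | ⟨x, hx⟩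
    · rw [h]; exact countable_empty
    · refine (hB'.2 x).mono fun y hy => ?_
      have hl : y ∈ F.leaf x := k.mem_leaf (hs hx.1) (hs hy.1) (hx.2.trans hy.2.symm)
      exact mem_inter hy.1 hl)
  rw [← hU]
  refine measure_iUnion_null fun n => ?_
  have hEn : E n ⊆ B ∩ (k.dom ∩ k.tr ⁻¹' N') := (subset_iUnion E n).trans hU.subset
  rw [k.measure_eq ν (hE n) (hEn.trans hs) (hEi n)]
  refine measure_mono_null ?_ hN'
  rintro _ ⟨x, hx, rfl⟩
  exact (hEn hx).2.2

theorem μ_eq_zero {N : Set (RSpace q)} (hN : MeasurableSet N)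
    (h : ν.toMeasure (k.dom ∩ k.tr ⁻¹' N) = 0) : k.μ ν N = 0 := by
  rw [k.μ_apply ν hN]
  exact measure_mono_null (inter_subset_inter_left _ inter_subset_left) h

end Measurable

end Box

section Null

variable [MeasurableSpace M] [BorelSpace M] [PolishSpace M] {F : Foliation p q M}
  (ν : F.TransverseMeasure)

/-- Near `x` every plaque crosses the slice of the chart of `k` through `x`. The part `S` of this
slice over the null set is a null transversal, and both transverse coordinates are injective on it.
So its projection in `l` is null, and sliding along plaques shows that it contains the projection of
everything near `x` over `N`. -/
theorem isPlaqueIdeal_null : IsPlaqueIdeal fun (k : F.Box) N => k.μ ν N = 0 where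
  mono _ _ _ h hB := measure_mono_null h hB
  iUnion _ _ _ _ h := measure_iUnion_null h
  loc := by
    rintro k l N hN x ⟨hk, hl⟩
    obtain ⟨h, hh⟩ := l.exists_transition k hl hk
    let N' := toMeasurable (k.μ ν) N
    have hN' : k.μ ν N' = 0 := (measure_toMeasurable N).trans hN
    obtain ⟨h', hh'⟩ := k.exists_transition l hk hl
    obtain ⟨V, hV, hVo, hxV⟩ := eventually_nhds_iff.1 (hh.and (hh'.and
      ((k.isOpen_dom.inter l.isOpen_dom).mem_nhds ⟨hk, hl⟩)))
    let S : Set M := (V ∩ (k.dom ∩ k.chart ⁻¹' ({(k.chart x).1} ×ˢ univ))) ∩ (k.dom ∩ k.tr ⁻¹' N')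
    have hSl : S ⊆ l.dom := fun y hy => (hV y hy.1.1).2.2.2
    have hS : MeasurableSet S := (hVo.measurableSet.inter
      (k.continuousOn_chart.measurableSet_inter_preimage k.measurableSet_dom
        ((measurableSet_singleton _).prod MeasurableSet.univ))).inter
      (k.measurableSet_inter_tr k.measurableSet_dom subset_rfl (measurableSet_toMeasurable _ _))
    have hSi : InjOn l.tr S := by
      intro y hy z hz hyz
      refine k.injOn_chart hy.1.2.1 hz.1.2.1 (Prod.ext (hy.1.2.2.1.trans hz.1.2.2.1.symm) ?_)
      change k.tr y = k.tr z
      rw [(hV y hy.1.1).1, (hV z hz.1.1).1, hyz]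
    have h0 : l.μ ν (l.tr '' S) = 0 := by
      rw [← l.measure_eq ν hS hSl hSi]
      exact measure_mono_null inter_subset_right (k.measure_preimage_eq_zero ν hN')
    have hz : k.chart x ∈ k.chart.target := k.chart.map_source hk.1
    have hcont : ContinuousAt (fun y => ((k.chart x).1, k.tr y)) x :=
      continuousAt_const.prodMk (continuous_snd.continuousAt.comp (k.chart.continuousAt hk.1))
    have hcont' : ContinuousAt (fun y => k.chart.symm ((k.chart x).1, k.tr y)) x :=
      ContinuousAt.comp (f := fun y => ((k.chart x).1, k.tr y)) (k.chart.continuousAt_symm hz) hcont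
    have hval : k.chart.symm ((k.chart x).1, k.tr x) = x := k.chart.left_inv hk.1
    have hVx : V ∈ nhds (k.chart.symm ((k.chart x).1, k.tr x)) := by
      rw [hval]; exact hVo.mem_nhds hxV
    refine ⟨V ∩ {y | k.chart.symm ((k.chart x).1, k.tr y) ∈ V ∧
      ((k.chart x).1, k.tr y) ∈ k.chart.target}, ?_, ?_⟩
    · refine Filter.inter_mem (hVo.mem_nhds hxV) ?_
      exact (hcont'.eventually hVx).and (hcont.eventually (k.chart.open_target.mem_nhds hz))
    · refine measure_mono_null ?_ h0
      rintro _ ⟨y, ⟨⟨⟨hyV, hy1, hy2⟩, hyk, hyl⟩, hyN⟩, rfl⟩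
      have hr : k.chart (k.chart.symm ((k.chart x).1, k.tr y)) = ((k.chart x).1, k.tr y) :=
        k.chart.right_inv hy2
      have htr : k.tr (k.chart.symm ((k.chart x).1, k.tr y)) = k.tr y := by
        rw [Box.tr, hr]
      have hd := (hV _ hy1).2.2.1
      refine ⟨k.chart.symm ((k.chart x).1, k.tr y), ⟨⟨hy1, hd, ?_⟩, hd, ?_⟩, ?_⟩
      · rw [mem_preimage, hr]
        exact ⟨rfl, mem_univ _⟩
      · rw [mem_preimage, htr]
        exact subset_toMeasurable _ _ hyN
      · rw [(hV _ hy1).2.1, (hV _ hyV).2.1, htr]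

theorem measure_saturation_eq_zero {A : Set M} (hA : ∀ k : F.Box, k.μ ν (k.tr '' (A ∩ k.dom)) = 0) :
    ν.toMeasure (F.saturation A) = 0 := by
  obtain ⟨𝒞, h𝒞, hcov⟩ := F.exists_countable_boxes
  refine measure_mono_null (t := ⋃ k ∈ 𝒞, (k.dom ∩ k.tr ⁻¹' (k.tr '' (F.saturation A ∩ k.dom))))
    (fun x hx => ?_) ((measure_biUnion_null_iff h𝒞).2 fun k _ =>
      k.measure_preimage_eq_zero ν ((isPlaqueIdeal_null ν).saturation hA k))
  obtain ⟨k, hk, hxk⟩ := hcov x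
  exact mem_iUnion₂.2 ⟨k, hk, hxk, x, ⟨hx, hxk⟩, rfl⟩

end Null

end Foliation

end

/-! ### Counting zeros near a fold -/

section

section ZeroCount

/-- Adding `c x (1 - x) / 2` makes `ψ` convex, and the sum still vanishes at both ends, hence is
nonpositive between them. No sign of `c` is needed. -/
theorem le_of_second_deriv_ge {ψ ψ' ψ'' : ℝ → ℝ} {c θ : ℝ}
    (h1 : ∀ x ∈ Icc (0 : ℝ) 1, HasDerivAt ψ (ψ' x) x)
    (h2 : ∀ x ∈ Icc (0 : ℝ) 1, HasDerivAt ψ' (ψ'' x) x)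
    (hc : ∀ x ∈ Icc (0 : ℝ) 1, c ≤ ψ'' x) (h0 : ψ 0 = 0) (h3 : ψ 1 = 0) (hθ : θ ∈ Icc (0 : ℝ) 1) :
    ψ θ ≤ -(c * (θ * (1 - θ)) / 2) := by
  have hconv : ConvexOn ℝ (Icc (0 : ℝ) 1) (fun x => ψ x + c * (x * (1 - x)) / 2) := by
    refine convexOn_of_hasDerivWithinAt2_nonneg (convex_Icc 0 1)
      (f' := fun x => ψ' x + c * (1 - 2 * x) / 2) (f'' := fun x => ψ'' x - c) ?_ ?_ ?_ ?_
    · intro x hx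
      refine ContinuousAt.continuousWithinAt ?_
      exact (h1 x hx).continuousAt.add (by fun_prop)
    · intro x hx
      refine HasDerivAt.hasDerivWithinAt ?_
      refine (h1 x (interior_subset hx)).add ?_
      have h := (((hasDerivAt_id x).mul ((hasDerivAt_id x).const_sub 1)).const_mul c).div_const 2
      convert! h using 1
      simp only [id]
      ring
    · intro x hx
      refine HasDerivAt.hasDerivWithinAt ?_
      have h := ((((hasDerivAt_id x).const_mul 2).const_sub 1).const_mul c).div_const 2
      convert! (h2 x (interior_subset hx)).add h using 1
      ring
    · intro x hx
      linarith [hc x (interior_subset hx)]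
  have h := hconv.2 (left_mem_Icc.2 zero_le_one) (right_mem_Icc.2 zero_le_one)
    (sub_nonneg.2 hθ.2) hθ.1 (by ring)
  simp only [smul_eq_mul, h0, h3] at h
  have he : (1 - θ) * 0 + θ * 1 = θ := by ring
  rw [he] at h
  linarith

variable {X : Type*} [NormedAddCommGroup X] [InnerProductSpace ℝ X]

theorem ContinuousLinearMap.exists_pos_mul_norm_le [FiniteDimensional ℝ X] {H : X →L[ℝ] X}
    (h : ∀ v, H v = 0 → v = 0) : ∃ κ > 0, ∀ v, κ * ‖v‖ ≤ ‖H v‖ := by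
  have hker : LinearMap.ker H.toLinearMap = ⊥ := LinearMap.ker_eq_bot'.2 h
  obtain ⟨K, hK, hH⟩ := LinearMap.exists_antilipschitzWith H.toLinearMap hker
  refine ⟨(K : ℝ)⁻¹, by positivity, fun v => ?_⟩
  have := hH.le_mul_dist v 0
  simp only [dist_zero_right, map_zero] at this
  rw [inv_mul_le_iff₀ (by positivity)]
  exact this

/-- A bilinear map close to `T` is positive in directions close to `e` if `T` is positive at `e`. -/
theorem le_inner_bilin {T B : X →L[ℝ] X →L[ℝ] X} {e w : X} (he : ‖e‖ = 1) {τ K η ρ L : ℝ}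
    (hτ : τ = inner ℝ e (T e e)) (hB : ∀ v w, ‖B v w‖ ≤ K * ‖v‖ * ‖w‖) (hK0 : 0 < K)
    (hBT : ‖B - T‖ ≤ η) (hL0 : 0 < L) (hη2 : η + 6 * K * ρ ≤ τ / 2) (hwL : ‖w‖ ≤ 2 * ρ * L)
    (hwL' : ‖w‖ ≤ L) : L ^ 2 * (τ / 2) ≤ inner ℝ e (B (L • e + w) (L • e + w)) := by
  have hb : ∀ u u' : X, |inner ℝ e (B u u')| ≤ K * ‖u‖ * ‖u'‖ := fun u u' => by
    refine (abs_real_inner_le_norm _ _).trans ?_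
    rw [he, one_mul]; exact hB u u'
  have hee : τ - η ≤ inner ℝ e (B e e) := by
    have h1 : |inner ℝ e ((B - T) e e)| ≤ η := by
      refine (abs_real_inner_le_norm _ _).trans ?_
      rw [he, one_mul]
      refine ((B - T).le_of_opNorm₂_le_of_le hBT he.le he.le).trans ?_
      linarith
    have h2 : (B - T) e e = B e e - T e e := rfl
    rw [h2, inner_sub_right, ← hτ] at h1
    linarith [(abs_le.1 h1).1]
  have h1 := (abs_le.1 (hb e w)).1
  have h2 := (abs_le.1 (hb w e)).1
  have h3 := (abs_le.1 (hb w w)).1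
  rw [he] at h1 h2
  have hexp : inner ℝ e (B (L • e + w) (L • e + w)) = L ^ 2 * inner ℝ e (B e e)
      + L * (inner ℝ e (B e w) + inner ℝ e (B w e)) + inner ℝ e (B w w) := by
    have : B (L • e + w) (L • e + w) = L • L • B e e + L • B w e + (L • B e w + B w w) := by
      rw [map_add (B (L • e + w)), map_smul, map_add B, map_smul B]
      simp only [FunLike.coe_add, FunLike.coe_smul, Pi.add_apply, Pi.smul_apply, smul_add]
    rw [this]
    simp only [inner_add_right, inner_smul_right]
    ring
  rw [hexp]
  -- With `‖w‖ ≤ 2ρL` and `‖w‖ ≤ L` the mixed terms cost at most `4KρL²` and the last one `2KρL²`;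
  -- this is the `6Kρ` in `hη2`.
  have h4 : K * ‖w‖ * ‖w‖ ≤ K * ‖w‖ * L := by gcongr
  have h5 : K * ‖w‖ * L ≤ K * (2 * ρ * L) * L := by gcongr
  nlinarith [mul_le_mul_of_nonneg_left hee (sq_nonneg L),
    mul_le_mul_of_nonneg_left hη2 (sq_nonneg L), mul_le_mul_of_nonneg_left h1 hL0.le,
    mul_le_mul_of_nonneg_left h2 hL0.le]

set_option maxHeartbeats 400000 in
/-- Quantitative core of the bound on the number of zeros near a fold: the zeros `a, b, d` lie in
this order along the kernel direction `e`. -/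
theorem no_three_ordered_zeros {H : X →L[ℝ] X} {T : X →L[ℝ] X →L[ℝ] X}
    (hsymm : ∀ v w, inner ℝ (H v) w = inner ℝ v (H w)) {e : X} (he : ‖e‖ = 1) (hHe : H e = 0)
    {κ τ K η : ℝ} (hκ : 0 < κ) (hH : ∀ w, inner ℝ e w = 0 → κ * ‖w‖ ≤ ‖H w‖)
    (hτ : τ = inner ℝ e (T e e)) (hK : ‖T‖ + 1 ≤ K) (hη : 0 < η) (hη1 : η ≤ 1)
    (hηκ : η ≤ κ / 2) (hη2 : η + 6 * K * (η / κ) ≤ τ / 2) (hη3 : η * (4 * K / κ) < τ / 4)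
    {s : Set X} (hs : Convex ℝ s) {Ψ : X → X} {D : X → X →L[ℝ] X} {D2 : X → X →L[ℝ] X →L[ℝ] X}
    (hD : ∀ x ∈ s, HasFDerivAt Ψ (D x) x) (hD2 : ∀ x ∈ s, HasFDerivAt D (D2 x) x)
    (hDH : ∀ x ∈ s, ‖D x - H‖ ≤ η) (hD2T : ∀ x ∈ s, ‖D2 x - T‖ ≤ η)
    {a b d : X} (ha : a ∈ s) (hb : b ∈ s) (hd : d ∈ s) (hΨa : Ψ a = 0) (hΨb : Ψ b = 0)
    (hΨd : Ψ d = 0) (hab : inner ℝ e a < inner ℝ e b) (hbd : inner ℝ e b < inner ℝ e d) : False := by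
  have hK0 : 0 < K := by linarith [norm_nonneg T]
  have hmv : ∀ x ∈ s, ∀ y ∈ s, ‖Ψ y - Ψ x - H (y - x)‖ ≤ η * ‖y - x‖ := fun x hx y hy =>
    hs.norm_image_sub_le_of_norm_hasFDerivWithin_le' (fun z hz => (hD z hz).hasFDerivWithinAt)
      hDH hx hy
  have hD2K : ∀ x ∈ s, ∀ v w, ‖D2 x v w‖ ≤ K * ‖v‖ * ‖w‖ := by
    intro x hx v w
    refine (D2 x).le_of_opNorm₂_le_of_le ?_ le_rfl le_rfl
    linarith [hD2T x hx, norm_le_insert' (D2 x) T]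
  set v := d - a with hv
  set L := inner ℝ e v with hL
  have hL0 : 0 < L := by rw [hL, hv, inner_sub_right]; linarith
  set w := v - L • e with hw
  have hew : inner ℝ e w = 0 := by
    rw [hw, inner_sub_right, inner_smul_right, real_inner_self_eq_norm_sq, he, ← hL]; ring
  have hvw : v = L • e + w := by rw [hw]; abel
  have hvnorm : ‖v‖ ≤ L + ‖w‖ := by
    rw [hvw]
    refine (norm_add_le _ _).trans ?_
    rw [norm_smul, he, Real.norm_of_nonneg hL0.le, mul_one]
  -- Both ends of the chord are zeros, so `‖H v‖ ≤ η ‖v‖`, while `H v = H w` with `w` orthogonal to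
  -- `e`. Thus the chord is almost parallel to the kernel.
  have hwL : ‖w‖ ≤ 2 * (η / κ) * L := by
    have h1 := hmv a ha d hd
    rw [hΨa, hΨd, sub_zero, zero_sub, norm_neg, ← hv] at h1
    have h2 : H v = H w := by rw [hvw, map_add, map_smul, hHe, smul_zero, zero_add]
    rw [h2] at h1
    have h3 := hH w hew
    have h4 : η * ‖w‖ ≤ κ / 2 * ‖w‖ := mul_le_mul_of_nonneg_right hηκ (norm_nonneg w)
    have h5 : κ * ‖w‖ ≤ 2 * η * L := by nlinarith
    rw [show 2 * (η / κ) * L = 2 * η * L / κ by ring, le_div_iff₀ hκ]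
    linarith
  have hηκ' : η / κ ≤ 1 / 2 := by rw [div_le_iff₀ hκ]; linarith
  have hηκ0 : 0 < η / κ := by positivity
  have hwL' : ‖w‖ ≤ L := by nlinarith
  have hv2 : ‖v‖ ≤ 2 * L := by linarith
  set θ := (inner ℝ e b - inner ℝ e a) / L with hθ
  have hLθ : L * θ = inner ℝ e b - inner ℝ e a := by rw [hθ]; field_simp
  have hLv : L = inner ℝ e d - inner ℝ e a := by rw [hL, hv, inner_sub_right]
  have hθ0 : 0 < θ := div_pos (by linarith) hL0
  have hθ1 : θ < 1 := by rw [hθ, div_lt_one hL0]; linarith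
  have hθI : θ ∈ Icc (0 : ℝ) 1 := ⟨hθ0.le, hθ1.le⟩
  have hγ : ∀ x ∈ Icc (0 : ℝ) 1, a + x • v ∈ s := fun x hx => by
    have := hs ha hd (sub_nonneg.2 hx.2) hx.1 (by ring)
    convert! this using 1
    rw [hv, smul_sub, sub_smul, one_smul]; abel
  have hγ' : ∀ x : ℝ, HasDerivAt (fun x : ℝ => a + x • v) v x := fun x => by
    simpa using ((hasDerivAt_id x).smul_const v).const_add a
  have hψ1 : ∀ n : X, ∀ x ∈ Icc (0 : ℝ) 1, HasDerivAt (fun x : ℝ => inner ℝ n (Ψ (a + x • v)))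
      (inner ℝ n (D (a + x • v) v)) x := fun n x hx => by
    have h1 := (hD _ (hγ x hx)).comp_hasDerivAt x (hγ' x)
    exact (innerSL ℝ n).hasFDerivAt.comp_hasDerivAt x h1
  have hψ2 : ∀ n : X, ∀ x ∈ Icc (0 : ℝ) 1, HasDerivAt (fun x : ℝ => inner ℝ n (D (a + x • v) v))
      (inner ℝ n (D2 (a + x • v) v v)) x := fun n x hx => by
    have h0 : HasDerivAt (fun x : ℝ => D (a + x • v)) (D2 (a + x • v) v) x :=
      (hD2 _ (hγ x hx)).comp_hasDerivAt x (hγ' x)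
    have h1 : HasDerivAt (fun x : ℝ => D (a + x • v) v) (D2 (a + x • v) v v) x :=
      (ContinuousLinearMap.apply ℝ X v).hasFDerivAt.comp_hasDerivAt x h0
    exact (innerSL ℝ n).hasFDerivAt.comp_hasDerivAt x h1
  -- `m` is the point of the chord with the same `e`-coordinate as `b`. There the `e`-component of
  -- `Ψ` is at most a negative multiple of `L²θ(1-θ)`, and `‖Ψ m‖` is at most a multiple of the same
  -- quantity. Since `b - m` is orthogonal to `e`, the latter bounds `‖b - m‖`.
  set m := a + θ • v with hm
  have hms : m ∈ s := hγ θ hθI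
  have hQ : 0 < L ^ 2 * (θ * (1 - θ)) := by
    have : 0 < 1 - θ := by linarith
    positivity
  -- lower bound in the direction `e`
  have hlow : inner ℝ e (Ψ m) ≤ -((L ^ 2 * (τ / 2)) * (θ * (1 - θ)) / 2) := by
    refine le_of_second_deriv_ge (hψ1 e) (hψ2 e) (fun x hx => ?_) (by simp [hΨa]) ?_ hθI
    · have hxs := hγ x hx
      have := le_inner_bilin he hτ (hD2K _ hxs) hK0 (hD2T _ hxs) hL0 hη2 hwL hwL'
      rwa [← hvw] at this
    · simp [hv, hΨd]
  -- upper bound in all directions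
  have hup : ‖Ψ m‖ ≤ 2 * K * (L ^ 2 * (θ * (1 - θ))) := by
    have h1 : inner ℝ (Ψ m) (Ψ m) ≤ -((-(‖Ψ m‖ * (K * (2 * L) * (2 * L)))) * (θ * (1 - θ)) / 2) := by
      refine le_of_second_deriv_ge (hψ1 (Ψ m)) (hψ2 (Ψ m)) (fun x hx => ?_) (by simp [hΨa]) ?_ hθI
      · refine neg_le_of_abs_le ((abs_real_inner_le_norm _ _).trans ?_)
        refine mul_le_mul_of_nonneg_left ((hD2K _ (hγ x hx) v v).trans ?_) (norm_nonneg _)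
        gcongr
      · simp [hv, hΨd]
    rw [real_inner_self_eq_norm_sq] at h1
    rcases (norm_nonneg (Ψ m)).eq_or_lt with h | h
    · rw [← h]; positivity
    · refine le_of_mul_le_mul_left ?_ h
      linarith
  set w' := b - m with hw'
  have hew' : inner ℝ e w' = 0 := by
    rw [hw', hm, inner_sub_right, inner_add_right, inner_smul_right, ← hL, mul_comm, hLθ]; ring
  have h1 := hmv m hms b hb
  rw [hΨb, zero_sub, ← hw'] at h1
  have h2 : κ / 2 * ‖w'‖ ≤ ‖Ψ m‖ := by
    have h3 : ‖H w'‖ ≤ ‖Ψ m‖ + η * ‖w'‖ := by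
      calc ‖H w'‖ = ‖-(Ψ m) - (-(Ψ m) - H w')‖ := by congr 1; abel
        _ ≤ ‖-(Ψ m)‖ + ‖-(Ψ m) - H w'‖ := norm_sub_le _ _
        _ ≤ _ := by rw [norm_neg]; linarith
    have := hH w' hew'
    nlinarith [mul_le_mul_of_nonneg_right hηκ (norm_nonneg w')]
  -- The range of the symmetric map `H` is orthogonal to `e`, so only the linearization error
  -- contributes in the direction `e`. It carries the factor `η`, too small for the bound `hlow`.
  have h3 : |inner ℝ e (Ψ m)| ≤ η * ‖w'‖ := by
    have h4 : inner ℝ e (H w') = 0 := by rw [← hsymm, hHe, inner_zero_left]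
    have h5 : inner ℝ e (Ψ m) = -inner ℝ e (-(Ψ m) - H w') := by
      rw [inner_sub_right, inner_neg_right, h4]; ring
    rw [h5, abs_neg]
    refine (abs_real_inner_le_norm _ _).trans ?_
    rw [he, one_mul]; exact h1
  have h6 : ‖w'‖ ≤ 4 * K / κ * (L ^ 2 * (θ * (1 - θ))) := by
    rw [div_mul_eq_mul_div, le_div_iff₀ hκ]
    linarith
  have h7 := (abs_le.1 h3).1
  have h8 : η * ‖w'‖ ≤ η * (4 * K / κ) * (L ^ 2 * (θ * (1 - θ))) := by
    rw [mul_assoc]; exact mul_le_mul_of_nonneg_left h6 hη.le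
  have h9 := mul_lt_mul_of_pos_right hη3 hQ
  linarith

/-- Near a nondegenerate or fold type zero, a map and its small `C²` perturbations have at most two
zeros. -/
theorem exists_pos_at_most_two_zeros [FiniteDimensional ℝ X] {H : X →L[ℝ] X}
    {T : X →L[ℝ] X →L[ℝ] X} (hsymm : ∀ v w, inner ℝ (H v) w = inner ℝ v (H w))
    (hone : ∀ v w, H v = 0 → H w = 0 → v ≠ 0 → ∃ c : ℝ, w = c • v)
    (hcub : ∀ v, H v = 0 → v ≠ 0 → inner ℝ v (T v v) ≠ 0) :
    ∃ η > 0, ∀ (s : Set X) (Ψ : X → X) (D : X → X →L[ℝ] X) (D2 : X → X →L[ℝ] X →L[ℝ] X),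
      Convex ℝ s → (∀ x ∈ s, HasFDerivAt Ψ (D x) x) → (∀ x ∈ s, HasFDerivAt D (D2 x) x) →
      (∀ x ∈ s, ‖D x - H‖ ≤ η) → (∀ x ∈ s, ‖D2 x - T‖ ≤ η) →
      ∀ a ∈ s, ∀ b ∈ s, ∀ d ∈ s, Ψ a = 0 → Ψ b = 0 → Ψ d = 0 → a = b ∨ b = d ∨ a = d := by
  -- If `H` is injective, the mean value inequality makes `Ψ` injective on `s`, and two zeros
  -- already coincide.
  by_cases hinj : ∀ v, H v = 0 → v = 0
  · obtain ⟨κ, hκ, hH⟩ := ContinuousLinearMap.exists_pos_mul_norm_le hinj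
    refine ⟨κ / 2, by positivity, ?_⟩
    intro s Ψ D D2 hs hD _ hDH _ a ha b hb d _ hΨa hΨb _
    left
    have h1 := hs.norm_image_sub_le_of_norm_hasFDerivWithin_le'
      (fun z hz => (hD z hz).hasFDerivWithinAt) hDH ha hb
    rw [hΨa, hΨb, sub_zero, zero_sub, norm_neg] at h1
    have h2 := hH (b - a)
    have h3 : ‖b - a‖ = 0 := by nlinarith [norm_nonneg (b - a)]
    exact (sub_eq_zero.1 (norm_eq_zero.1 h3)).symm
  push Not at hinj
  obtain ⟨e₀, hHe₀, he₀⟩ := hinj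
  -- The cubic form is odd, so replacing `e` by `-e` makes it positive.
  obtain ⟨e, he, hHe, hτ0⟩ : ∃ e : X, ‖e‖ = 1 ∧ H e = 0 ∧ 0 < inner ℝ e (T e e) := by
    have hn : ‖e₀‖ ≠ 0 := norm_ne_zero_iff.2 he₀
    have h1 : ‖‖e₀‖⁻¹ • e₀‖ = 1 := by rw [norm_smul, norm_inv, norm_norm, inv_mul_cancel₀ hn]
    have h2 : H (‖e₀‖⁻¹ • e₀) = 0 := by rw [map_smul, hHe₀, smul_zero]
    have h3 := hcub _ h2 (fun h => by rw [h, norm_zero] at h1; exact zero_ne_one h1)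
    rcases lt_or_gt_of_ne h3 with h | h
    · refine ⟨-(‖e₀‖⁻¹ • e₀), by rw [norm_neg, h1], by rw [map_neg, h2, neg_zero], ?_⟩
      simp only [map_neg, neg_apply, neg_neg, inner_neg_left]
      linarith
    · exact ⟨_, h1, h2, h⟩
  have he0 : e ≠ 0 := fun h => by rw [h, norm_zero] at he; exact zero_ne_one he
  obtain ⟨κ, hκ, hH⟩ : ∃ κ > 0, ∀ w, inner ℝ e w = 0 → κ * ‖w‖ ≤ ‖H w‖ := by
    -- Adding the orthogonal projection onto `e` removes the kernel and does not change `H` on the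
    -- orthogonal complement of `e`.
    obtain ⟨κ, hκ, h⟩ := ContinuousLinearMap.exists_pos_mul_norm_le
      (H := H + (innerSL ℝ e).smulRight e) (by
        intro w hw
        simp only [add_apply, ContinuousLinearMap.smulRight_apply,
          innerSL_apply_apply] at hw
        have h1 : inner ℝ e w = 0 := by
          have := congrArg (inner ℝ e) hw
          rw [inner_add_right, ← hsymm, hHe, inner_zero_left, inner_smul_right,
            real_inner_self_eq_norm_sq, he, inner_zero_right] at this
          linarith
        rw [h1, zero_smul, add_zero] at hw
        obtain ⟨c, rfl⟩ := hone e w hHe hw he0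
        rw [inner_smul_right, real_inner_self_eq_norm_sq, he] at h1
        have : c = 0 := by linarith
        rw [this, zero_smul])
    refine ⟨κ, hκ, fun w hw => ?_⟩
    have := h w
    simpa [hw] using this
  set τ := inner ℝ e (T e e) with hτ
  set K := ‖T‖ + 1 with hK
  have hK0 : 0 < K := by positivity
  obtain ⟨η, hη, h1, h2, h3, h4⟩ : ∃ η > 0, η ≤ 1 ∧ η ≤ κ / 2 ∧ η + 6 * K * (η / κ) ≤ τ / 2 ∧
      η * (4 * K / κ) < τ / 4 := by
    have e1 : ∀ᶠ η : ℝ in nhds 0, η + 6 * K * (η / κ) < τ / 2 :=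
      ContinuousAt.eventually_lt (by fun_prop) continuousAt_const (by simpa using hτ0)
    have e2 : ∀ᶠ η : ℝ in nhds 0, η * (4 * K / κ) < τ / 4 :=
      ContinuousAt.eventually_lt (by fun_prop) continuousAt_const (by simpa using hτ0)
    have e3 : ∀ᶠ η : ℝ in nhds 0, η < 1 := Iio_mem_nhds one_pos
    have e4 : ∀ᶠ η : ℝ in nhds 0, η < κ / 2 := Iio_mem_nhds (by positivity)
    obtain ⟨η, ⟨h1, h2, h3, h4⟩, h5⟩ := (((e1.and (e2.and (e3.and e4))).filter_mono
      nhdsWithin_le_nhds).and (self_mem_nhdsWithin (a := (0 : ℝ)) (s := Ioi 0))).exists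
    exact ⟨η, h5, h3.le, h4.le, le_of_lt h1, h2⟩
  refine ⟨η, hη, ?_⟩
  intro s Ψ D D2 hs hD hD2 hDH hD2T a ha b hb d hd hΨa hΨb hΨd
  by_contra hcon
  push Not at hcon
  obtain ⟨hab, hbd, had⟩ := hcon
  have key : ∀ {a b d : X}, a ∈ s → b ∈ s → d ∈ s → Ψ a = 0 → Ψ b = 0 → Ψ d = 0 →
      inner ℝ e a < inner ℝ e b → inner ℝ e b < inner ℝ e d → False := fun ha hb hd h5 h6 h7 h8 h9 =>
    no_three_ordered_zeros hsymm he hHe hκ hH hτ le_rfl hη h1 h2 h3 h4 hs hD hD2 hDH hD2T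
      ha hb hd h5 h6 h7 h8 h9
  -- Two zeros with the same `e`-coordinate coincide, because `H` is bounded below on their
  -- difference. Three distinct zeros can therefore be ordered by this coordinate.
  have hne : ∀ {x y : X}, x ∈ s → y ∈ s → Ψ x = 0 → Ψ y = 0 → x ≠ y → inner ℝ e x ≠ inner ℝ e y := by
    intro x y hx hy hΨx hΨy hxy h
    have h5 := hs.norm_image_sub_le_of_norm_hasFDerivWithin_le'
      (fun z hz => (hD z hz).hasFDerivWithinAt) hDH hx hy
    rw [hΨx, hΨy, sub_zero, zero_sub, norm_neg] at h5
    have h6 := hH (y - x) (by rw [inner_sub_right, h, sub_self])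
    have h7 : 0 < ‖y - x‖ := norm_pos_iff.2 (sub_ne_zero.2 (Ne.symm hxy))
    nlinarith
  rcases lt_or_gt_of_ne (hne ha hb hΨa hΨb hab) with h5 | h5 <;>
  rcases lt_or_gt_of_ne (hne hb hd hΨb hΨd hbd) with h6 | h6 <;>
  rcases lt_or_gt_of_ne (hne ha hd hΨa hΨd had) with h7 | h7
  · exact key ha hb hd hΨa hΨb hΨd h5 h6
  · exact key ha hb hd hΨa hΨb hΨd h5 h6
  · exact key ha hd hb hΨa hΨd hΨb h7 h6
  · exact key hd ha hb hΨd hΨa hΨb h7 h5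
  · exact key hb ha hd hΨb hΨa hΨd h5 h7
  · exact key hb hd ha hΨb hΨd hΨa h6 h7
  · exact key hd hb ha hΨd hΨb hΨa h6 h5
  · exact key hd hb ha hΨd hΨb hΨa h6 h5

end ZeroCount

end

/-! ### Gradient, Hessian and third derivative along the leaves -/

section

section LeafGradient

variable {X Y : Type*} [NormedAddCommGroup X] [InnerProductSpace ℝ X] [FiniteDimensional ℝ X]
  [NormedAddCommGroup Y] [NormedSpace ℝ Y]

/-- The gradient of `u : X × Y → ℝ` in the direction of `X`. -/
def lgrad (u : X × Y → ℝ) (z : X × Y) : X :=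
  ∑ i, fderiv ℝ u z (stdOrthonormalBasis ℝ X i, 0) • stdOrthonormalBasis ℝ X i

/-- The Hessian of `u : X × Y → ℝ` in the direction of `X`. -/
def lhess (u : X × Y → ℝ) (z : X × Y) : X →L[ℝ] X :=
  (fderiv ℝ (lgrad u) z).comp (ContinuousLinearMap.inl ℝ X Y)

/-- The third derivative of `u : X × Y → ℝ` in a direction of `X`. -/
def lcub (u : X × Y → ℝ) (z : X × Y) (v : X) : ℝ :=
  inner ℝ v (fderiv ℝ (fderiv ℝ (lgrad u)) z (v, 0) (v, 0))

theorem lhess_apply (u : X × Y → ℝ) (z : X × Y) (v : X) :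
    lhess u z v = fderiv ℝ (lgrad u) z (v, 0) := by
  simp [lhess]

theorem inner_lgrad (u : X × Y → ℝ) (z : X × Y) (v : X) :
    inner ℝ (lgrad u z) v = fderiv ℝ u z (v, 0) := by
  conv_rhs => rw [← (stdOrthonormalBasis ℝ X).sum_repr' v]
  have : ((∑ i, inner ℝ (stdOrthonormalBasis ℝ X i) v • stdOrthonormalBasis ℝ X i, 0) : X × Y) =
      ∑ i, inner ℝ (stdOrthonormalBasis ℝ X i) v • ((stdOrthonormalBasis ℝ X i, 0) : X × Y) := by
    refine Prod.ext (by simp [Prod.fst_sum]) (by simp [Prod.snd_sum])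
  rw [this, map_sum, lgrad, sum_inner]
  refine Finset.sum_congr rfl fun i _ => ?_
  rw [map_smul, inner_smul_left, smul_eq_mul, mul_comm]
  simp

theorem ContDiffAt.lgrad {u : X × Y → ℝ} {z : X × Y} (h : ContDiffAt ℝ ∞ u z) :
    ContDiffAt ℝ ∞ (_root_.lgrad u) z := by
  have h1 : ContDiffAt ℝ ∞ (fderiv ℝ u) z := h.fderiv_right (by simp)
  unfold _root_.lgrad
  refine ContDiffAt.sum fun i _ => ?_
  have h2 : ContDiffAt ℝ ∞ (fun w => fderiv ℝ u w ((stdOrthonormalBasis ℝ X i, 0) : X × Y)) z :=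
    h1.clm_apply contDiffAt_const
  exact h2.smul contDiffAt_const

theorem lgrad_congr {u v : X × Y → ℝ} {z : X × Y} (h : u =ᶠ[nhds z] v) :
    lgrad u =ᶠ[nhds z] lgrad v := by
  filter_upwards [h.fderiv (𝕜 := ℝ)] with w hw
  simp only [lgrad, hw]

theorem inner_fderiv_lgrad {u : X × Y → ℝ} {z : X × Y} (h : ContDiffAt ℝ ∞ u z) (V : X × Y)
    (v : X) : inner ℝ (fderiv ℝ (lgrad u) z V) v = fderiv ℝ (fderiv ℝ u) z V (v, 0) := by
  have h1 : HasFDerivAt (lgrad u) (fderiv ℝ (lgrad u) z) z :=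
    (h.lgrad.differentiableAt (by simp)).hasFDerivAt
  have h2 : HasFDerivAt (fderiv ℝ u) (fderiv ℝ (fderiv ℝ u) z) z :=
    ((h.fderiv_right (m := ∞) (by simp)).differentiableAt (by simp)).hasFDerivAt
  have h3 : HasFDerivAt (fun w => inner ℝ v (lgrad u w))
      ((innerSL ℝ v).comp (fderiv ℝ (lgrad u) z)) z := (innerSL ℝ v).hasFDerivAt.comp z h1
  have h4 : HasFDerivAt (fun w => fderiv ℝ u w (v, 0))
      ((ContinuousLinearMap.apply ℝ ℝ ((v, 0) : X × Y)).comp (fderiv ℝ (fderiv ℝ u) z)) z :=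
    (ContinuousLinearMap.apply ℝ ℝ ((v, 0) : X × Y)).hasFDerivAt.comp z h2
  have h5 : (fun w => inner ℝ v (lgrad u w)) = fun w => fderiv ℝ u w (v, 0) := by
    funext w; rw [real_inner_comm, inner_lgrad]
  rw [h5] at h3
  have h6 := congrArg (fun L => L V) (h3.unique h4)
  rw [real_inner_comm]
  exact h6

theorem lhess_symm {u : X × Y → ℝ} {z : X × Y} (h : ContDiffAt ℝ ∞ u z) (v w : X) :
    inner ℝ (lhess u z v) w = inner ℝ v (lhess u z w) := by
  rw [real_inner_comm _ v, lhess_apply, lhess_apply, inner_fderiv_lgrad h, inner_fderiv_lgrad h]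
  exact (h.isSymmSndFDerivAt (by simp [minSmoothness_of_isRCLikeNormedField]; exact WithTop.coe_le_coe.2 (le_top : (2 : ℕ∞) ≤ ⊤))).eq _ _

theorem ContDiffAt.eventually_differentiableAt {E E' : Type*} [NormedAddCommGroup E]
    [NormedSpace ℝ E] [NormedAddCommGroup E'] [NormedSpace ℝ E'] {g : E → E'} {x : E}
    (hg : ContDiffAt ℝ ∞ g x) : ∀ᶠ y in nhds x, DifferentiableAt ℝ g y :=
  ((hg.of_le (m := 1) (by simp)).eventually (by simp)).mono fun _ hy =>
    hy.differentiableAt (by simp)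

/-- The third derivative along a curve that is tangent to the leaf and starts at a critical point
in a direction in the kernel of the Hessian. -/
theorem iteratedDeriv_three_comp {u : X × Y → ℝ} {α : ℝ → X × Y} (hu : ContDiffAt ℝ ∞ u (α 0))
    (hα : ContDiffAt ℝ ∞ α 0) (hα2 : ∀ᶠ s in nhds 0, (deriv α s).2 = 0)
    (hG : lgrad u (α 0) = 0) (hH : lhess u (α 0) (deriv α 0).1 = 0) :
    iteratedDeriv 3 (u ∘ α) 0 = lcub u (α 0) (deriv α 0).1 := by
  set β : ℝ → X := fun s => (deriv α s).1 with hβ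
  have hαc : ContinuousAt α 0 := hα.continuousAt
  have hdα : ContDiffAt ℝ ∞ (deriv α) 0 := by
    have h1 : ContDiffAt ℝ ∞ (fderiv ℝ α) 0 := hα.fderiv_right (by simp)
    have h2 : deriv α = fun s => fderiv ℝ α s 1 := by funext s; simp
    rw [h2]
    exact h1.clm_apply contDiffAt_const
  have hβs : ContDiffAt ℝ ∞ β 0 := hdα.fst
  have hdβ : ContDiffAt ℝ ∞ (deriv β) 0 := by
    have h1 : ContDiffAt ℝ ∞ (fderiv ℝ β) 0 := hβs.fderiv_right (by simp)
    have h2 : deriv β = fun s => fderiv ℝ β s 1 := by funext s; simp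
    rw [h2]
    exact h1.clm_apply contDiffAt_const
  have E1 : ∀ᶠ s in nhds (0 : ℝ), HasDerivAt α (β s, 0) s := by
    filter_upwards [hα.eventually_differentiableAt, hα2] with s hs hs2
    convert! hs.hasDerivAt using 1
    exact Prod.ext rfl hs2.symm
  have E2 : ∀ᶠ s in nhds (0 : ℝ), HasDerivAt β (deriv β s) s :=
    hβs.eventually_differentiableAt.mono fun s hs => hs.hasDerivAt
  have E3 := hαc.eventually hu.eventually_differentiableAt
  have E4 := hαc.eventually hu.lgrad.eventually_differentiableAt
  have hfG : ContDiffAt ℝ ∞ (fderiv ℝ (lgrad u)) (α 0) := hu.lgrad.fderiv_right (by simp)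
  have D1 : ∀ᶠ s in nhds (0 : ℝ), HasDerivAt (u ∘ α) (inner ℝ (lgrad u (α s)) (β s)) s := by
    filter_upwards [E1, E3] with s h1 h3
    rw [inner_lgrad]
    exact h3.hasFDerivAt.comp_hasDerivAt s h1
  have D2 : ∀ᶠ s in nhds (0 : ℝ), HasDerivAt (fun s => inner ℝ (lgrad u (α s)) (β s))
      (inner ℝ (lgrad u (α s)) (deriv β s) +
        inner ℝ (fderiv ℝ (lgrad u) (α s) (β s, 0)) (β s)) s := by
    filter_upwards [E1, E2, E4] with s h1 h2 h4
    exact (h4.hasFDerivAt.comp_hasDerivAt s h1).inner ℝ h2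
  have h10 := E1.self_of_nhds
  have h20 := E2.self_of_nhds
  have h40 : HasDerivAt (fun s => lgrad u (α s)) (fderiv ℝ (lgrad u) (α 0) (β 0, 0)) 0 :=
    E4.self_of_nhds.hasFDerivAt.comp_hasDerivAt 0 h10
  have h50 : HasDerivAt (fun s => fderiv ℝ (lgrad u) (α s))
      (fderiv ℝ (fderiv ℝ (lgrad u)) (α 0) (β 0, 0)) 0 :=
    (hfG.differentiableAt (by simp)).hasFDerivAt.comp_hasDerivAt 0 h10
  have h60 : HasDerivAt (fun s => ((β s, 0) : X × Y)) (deriv β 0, 0) 0 :=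
    h20.prodMk (hasDerivAt_const _ _)
  have h70 : HasDerivAt (deriv β) (deriv (deriv β) 0) 0 :=
    (hdβ.differentiableAt (by simp)).hasDerivAt
  have D3 := (h40.inner ℝ h70).add ((h50.clm_apply h60).inner ℝ h20)
  have e1 : deriv (u ∘ α) =ᶠ[nhds 0] fun s => inner ℝ (lgrad u (α s)) (β s) :=
    D1.mono fun s hs => hs.deriv
  have e2 : deriv (deriv (u ∘ α)) =ᶠ[nhds 0] fun s => inner ℝ (lgrad u (α s)) (deriv β s) +
        inner ℝ (fderiv ℝ (lgrad u) (α s) (β s, 0)) (β s) :=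
    e1.deriv.trans (D2.mono fun s hs => hs.deriv)
  have hit : iteratedDeriv 3 (u ∘ α) = deriv (deriv (deriv (u ∘ α))) := by
    simp [iteratedDeriv_succ, iteratedDeriv_zero]
  rw [hit, e2.deriv_eq]
  refine D3.deriv.trans ?_
  -- In the third derivative the gradient and the Hessian in the direction `β 0` vanish, and by
  -- symmetry so does the Hessian term pairing `β'` with `β 0`. Only the cubic term survives, which
  -- makes the acceleration of the curve irrelevant.
  have hH' : fderiv ℝ (lgrad u) (α 0) (β 0, 0) = 0 := by rw [← lhess_apply]; exact hH
  have hH2 : inner ℝ (fderiv ℝ (lgrad u) (α 0) (deriv β 0, 0)) (β 0) = 0 := by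
    rw [← lhess_apply, lhess_symm hu]
    change inner ℝ _ (lhess u (α 0) (deriv α 0).1) = 0
    rw [hH, inner_zero_right]
  rw [hG, hH', inner_zero_left, inner_zero_left, inner_add_left, hH2, lcub,
    real_inner_comm]
  ring

end LeafGradient

end

/-! ### Critical points and their Hessians in foliated charts -/

section

open Foliation

variable {p q : ℕ} {M : Type*} [TopologicalSpace M] [ChartedSpace (RSpace (p + q)) M]

namespace IsSmoothChart

variable {e e' : OpenPartialHomeomorph M (RSpace p × RSpace q)} {x : M}

theorem contMDiffAt (he : IsSmoothChart e) (hx : x ∈ e.source) :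
    ContMDiffAt (𝓡 (p + q)) 𝓘(ℝ, RSpace p × RSpace q) ∞ e x :=
  he.1.contMDiffAt (e.open_source.mem_nhds hx)

theorem contMDiffAt_symm (he : IsSmoothChart e) {z : RSpace p × RSpace q} (hz : z ∈ e.target) :
    ContMDiffAt 𝓘(ℝ, RSpace p × RSpace q) (𝓡 (p + q)) ∞ e.symm z :=
  he.2.contMDiffAt (e.open_target.mem_nhds hz)

theorem contDiffAt_comp_symm (he : IsSmoothChart e) {E : Type*} [NormedAddCommGroup E]
    [NormedSpace ℝ E] {f : M → E} {z : RSpace p × RSpace q} (hz : z ∈ e.target)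
    (hf : ContMDiffAt (𝓡 (p + q)) 𝓘(ℝ, E) ∞ f (e.symm z)) : ContDiffAt ℝ ∞ (f ∘ e.symm) z :=
  contMDiffAt_iff_contDiffAt.1 (ContMDiffAt.comp z hf (he.contMDiffAt_symm hz))

theorem contDiffAt_transition (he : IsSmoothChart e) (he' : IsSmoothChart e')
    (hx : x ∈ e.source) (hx' : x ∈ e'.source) : ContDiffAt ℝ ∞ (e' ∘ e.symm) (e x) :=
  he.contDiffAt_comp_symm (e.map_source hx)
    (by rw [e.left_inv hx]; exact he'.contMDiffAt hx')

theorem mdifferentiableAt (he : IsSmoothChart e) (hx : x ∈ e.source) :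
    MDifferentiableAt (𝓡 (p + q)) 𝓘(ℝ, RSpace p × RSpace q) e x :=
  (he.contMDiffAt hx).mdifferentiableAt (by simp)

theorem mfderiv_eq (he : IsSmoothChart e) (hx : x ∈ e.source) {E : Type*} [NormedAddCommGroup E]
    [NormedSpace ℝ E] {f : M → E} (hf : ContMDiffAt (𝓡 (p + q)) 𝓘(ℝ, E) ∞ f x)
    (v : TangentSpace (𝓡 (p + q)) x) :
    (mfderiv (𝓡 (p + q)) 𝓘(ℝ, E) f x v : E) = fderiv ℝ (f ∘ e.symm) (e x) (chartDeriv e x v) := by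
  have h1 : ContDiffAt ℝ ∞ (f ∘ e.symm) (e x) :=
    he.contDiffAt_comp_symm (e.map_source hx) (by rwa [e.left_inv hx])
  have h2 : f =ᶠ[nhds x] (f ∘ e.symm) ∘ e := by
    filter_upwards [e.open_source.mem_nhds hx] with y hy
    simp [e.left_inv hy]
  rw [h2.mfderiv_eq, mfderiv_comp x
    (h1.differentiableAt (by simp)).mdifferentiableAt (he.mdifferentiableAt hx)]
  rw [mfderiv_eq_fderiv]
  rfl

theorem chartDeriv_eq (he : IsSmoothChart e) (he' : IsSmoothChart e') (hx : x ∈ e.source)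
    (hx' : x ∈ e'.source) (v : TangentSpace (𝓡 (p + q)) x) :
    chartDeriv e' x v = fderiv ℝ (e' ∘ e.symm) (e x) (chartDeriv e x v) :=
  he.mfderiv_eq hx (he'.contMDiffAt hx') v

theorem chartDeriv_bijective (he : IsSmoothChart e) (hx : x ∈ e.source) :
    Function.Bijective (chartDeriv e x) := by
  have hd := he.mdifferentiableAt hx
  have hd' : MDifferentiableAt 𝓘(ℝ, RSpace p × RSpace q) (𝓡 (p + q)) e.symm (e x) :=
    (he.contMDiffAt_symm (e.map_source hx)).mdifferentiableAt (by simp)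
  have h1 : e.symm ∘ e =ᶠ[nhds x] id := by
    filter_upwards [e.open_source.mem_nhds hx] with y hy
    simp [e.left_inv hy]
  have h2 : e ∘ e.symm =ᶠ[nhds (e x)] id := by
    filter_upwards [e.open_target.mem_nhds (e.map_source hx)] with y hy
    simp [e.right_inv hy]
  have hdx : MDifferentiableAt (𝓡 (p + q)) 𝓘(ℝ, RSpace p × RSpace q) e (e.symm (e x)) := by
    rwa [e.left_inv hx]
  have h3 := h1.mfderiv_eq (I := 𝓡 (p + q)) (I' := 𝓡 (p + q))
  rw [mfderiv_comp x hd' hd, mfderiv_id] at h3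
  have h4 := h2.mfderiv_eq (I := 𝓘(ℝ, RSpace p × RSpace q)) (I' := 𝓘(ℝ, RSpace p × RSpace q))
  rw [mfderiv_comp (e x) hdx hd', mfderiv_id] at h4
  constructor
  · intro v w hvw
    have hv := congrArg (fun L => L v) h3
    have hw := congrArg (fun L => L w) h3
    simp only [ContinuousLinearMap.comp_apply] at hv hw
    have h5 : mfderiv (𝓡 (p + q)) 𝓘(ℝ, RSpace p × RSpace q) e x v =
      mfderiv (𝓡 (p + q)) 𝓘(ℝ, RSpace p × RSpace q) e x w := hvw
    rw [h5] at hv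
    exact hv.symm.trans hw
  · intro z
    have hz := congrArg (fun L => L z) h4
    rw [e.left_inv hx] at hz
    exact ⟨_, hz⟩

end IsSmoothChart

namespace Foliation

theorem chartAt_mem (F : Foliation p q M) (x : M) : F.chartAt x ∈ F.charts :=
  (F.covers x).choose_spec.1

theorem mem_chartAt_source (F : Foliation p q M) (x : M) : x ∈ (F.chartAt x).source :=
  (F.covers x).choose_spec.2

/-- The differential of a transition map preserves the leaf directions. -/
theorem _root_.FoliatedTransition.eventually_snd_fderiv {e e' : OpenPartialHomeomorph M (RSpace p × RSpace q)}
    (h : FoliatedTransition e e') (he : IsSmoothChart e) (he' : IsSmoothChart e') {x : M}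
    (hx : x ∈ e.source) (hx' : x ∈ e'.source) :
    ∀ᶠ z in nhds (e x), ∀ v : RSpace p, (fderiv ℝ (e' ∘ e.symm) z (v, 0)).2 = 0 := by
  obtain ⟨h₂, hh⟩ := h x ⟨hx, hx'⟩
  filter_upwards [hh.eventually_nhds,
    (he.contDiffAt_transition he' hx hx').eventually_differentiableAt] with z hz hd v
  have h1 : HasDerivAt (fun s : ℝ => z + s • ((v, 0) : RSpace p × RSpace q)) (v, 0) 0 := by
    simpa using ((hasDerivAt_id (0 : ℝ)).smul_const ((v, 0) : RSpace p × RSpace q)).const_add z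
  have hd' : HasFDerivAt (e' ∘ e.symm) (fderiv ℝ (e' ∘ e.symm) z)
      (z + (0 : ℝ) • ((v, 0) : RSpace p × RSpace q)) := by
    rw [zero_smul, add_zero]; exact hd.hasFDerivAt
  have h2 := (ContinuousLinearMap.snd ℝ (RSpace p) (RSpace q)).hasFDerivAt.comp_hasDerivAt (0 : ℝ)
    (hd'.comp_hasDerivAt (0 : ℝ) h1)
  have hc : Filter.Tendsto (fun s : ℝ => z + s • ((v, 0) : RSpace p × RSpace q)) (nhds 0) (nhds z) := by
    have := h1.continuousAt.tendsto
    simpa using this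
  have h3 : (fun s : ℝ => (((e' ∘ e.symm) ∘ fun s : ℝ => z + s • ((v, 0) : RSpace p × RSpace q)) s).2)
      =ᶠ[nhds 0] fun _ => h₂ z.2 := by
    filter_upwards [hc.eventually hz] with s hs
    simpa using hs
  exact h2.unique ((hasDerivAt_const _ _).congr_of_eventuallyEq h3)

section FoliatedChart

variable {F : Foliation p q M} {e : OpenPartialHomeomorph M (RSpace p × RSpace q)} {x : M}

/-- `tangent` intersects the conditions of all charts around `x`. Differentials of transition maps
preserve the leaf directions, so a single chart decides. -/
theorem IsFoliatedChart.mem_tangent_iff (he : F.IsFoliatedChart e) (hx : x ∈ e.source)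
    (v : TangentSpace (𝓡 (p + q)) x) : v ∈ F.tangent x ↔ (chartDeriv e x v).2 = 0 := by
  have key : ∀ {e e' : OpenPartialHomeomorph M (RSpace p × RSpace q)}, IsSmoothChart e →
      IsSmoothChart e' → FoliatedTransition e e' → x ∈ e.source → x ∈ e'.source →
      (chartDeriv e x v).2 = 0 → (chartDeriv e' x v).2 = 0 := by
    intro e e' he he' h hx hx' hv
    have h1 := (h.eventually_snd_fderiv he he' hx hx').self_of_nhds (chartDeriv e x v).1
    have h2 : ((chartDeriv e x v).1, (0 : RSpace q)) = chartDeriv e x v := Prod.ext rfl hv.symm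
    rw [he.chartDeriv_eq he' hx hx', ← h2]
    exact h1
  simp only [tangent, Submodule.mem_iInf, mem_ofPred, and_imp, LinearMap.mem_ker]
  constructor
  · intro h
    have h1 := F.chartAt_mem x
    exact key (F.smooth _ h1) he.1 (he.2 _ h1).2 (F.mem_chartAt_source x) hx
      (h _ h1 (F.mem_chartAt_source x))
  · intro h e' he' hx'
    exact key he.1 (F.smooth _ he') (he.2 _ he').1 hx hx' h

theorem IsFoliatedChart.chartDeriv_tangent (he : F.IsFoliatedChart e) (hx : x ∈ e.source)
    (v : F.tangent x) : chartDeriv e x v = ((chartDeriv e x v).1, 0) :=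
  Prod.ext rfl ((he.mem_tangent_iff hx v).1 v.2)

theorem IsFoliatedChart.exists_tangent (he : F.IsFoliatedChart e) (hx : x ∈ e.source)
    (w : RSpace p) : ∃ v : F.tangent x, chartDeriv e x v = (w, 0) := by
  obtain ⟨v, hv⟩ := (he.1.chartDeriv_bijective hx).2 (w, 0)
  exact ⟨⟨v, (he.mem_tangent_iff hx v).2 (by rw [hv])⟩, hv⟩

theorem IsFoliatedChart.fst_chartDeriv_eq_zero (he : F.IsFoliatedChart e) (hx : x ∈ e.source)
    {v : F.tangent x} : (chartDeriv e x v).1 = 0 ↔ v = 0 := by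
  constructor
  · intro h
    have h1 : chartDeriv e x v = chartDeriv e x 0 := by
      rw [he.chartDeriv_tangent hx, h, map_zero]; rfl
    exact Subtype.ext ((he.1.chartDeriv_bijective hx).1 h1)
  · rintro rfl
    have : chartDeriv e x ((0 : F.tangent x) : TangentSpace (𝓡 (p + q)) x) = 0 := map_zero _
    rw [this]; rfl

variable {f : M → ℝ}

theorem IsFoliatedChart.mem_crit_iff (he : F.IsFoliatedChart e) (hx : x ∈ e.source)
    (hf : ContMDiffAt (𝓡 (p + q)) 𝓘(ℝ, ℝ) ∞ f x) :
    x ∈ F.crit f ↔ lgrad (f ∘ e.symm) (e x) = 0 := by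
  constructor
  · intro h
    rw [← inner_self_eq_zero (𝕜 := ℝ), inner_lgrad]
    obtain ⟨v, hv⟩ := he.exists_tangent hx (lgrad (f ∘ e.symm) (e x))
    rw [← hv, ← he.1.mfderiv_eq hx hf]
    exact h v v.2
  · intro h v hv
    rw [he.1.mfderiv_eq hx hf, he.chartDeriv_tangent hx ⟨v, hv⟩, ← inner_lgrad, h, inner_zero_left]
    rfl

/-- `hess` is computed in the chosen chart `chartAt x`. With `τ` the transition to `e`, the leafwise
derivative in that chart is `⟨G ∘ τ, Dτ (w, 0)⟩`, and differentiating it produces second derivatives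
of `τ` only paired with `G`, which is zero at a critical point. -/
theorem IsFoliatedChart.hess_apply (he : F.IsFoliatedChart e) (hx : x ∈ e.source)
    (hf : ContMDiffAt (𝓡 (p + q)) 𝓘(ℝ, ℝ) ∞ f x) (hc : x ∈ F.crit f)
    (V : TangentSpace (𝓡 (p + q)) x) (v : F.tangent x) :
    F.hess f x V v = inner ℝ (fderiv ℝ (lgrad (f ∘ e.symm)) (e x) (chartDeriv e x V))
      (chartDeriv e x v).1 := by
  set e₀ := F.chartAt x with he₀
  have hm := F.chartAt_mem x
  have hx₀ := F.mem_chartAt_source x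
  have he₀s := F.smooth _ hm
  rw [← he₀] at hm hx₀ he₀s
  set τ := e ∘ e₀.symm with hτ
  have hτs : ContDiffAt ℝ ∞ τ (e₀ x) := he₀s.contDiffAt_transition he.1 hx₀ hx
  have hτx : τ (e₀ x) = e x := by simp [hτ, e₀.left_inv hx₀]
  have hu : ContDiffAt ℝ ∞ (f ∘ e.symm) (e x) :=
    he.1.contDiffAt_comp_symm (e.map_source hx) (by rwa [e.left_inv hx])
  have hu₀ : ContDiffAt ℝ ∞ (f ∘ e₀.symm) (e₀ x) :=
    he₀s.contDiffAt_comp_symm (e₀.map_source hx₀) (by rwa [e₀.left_inv hx₀])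
  have hcomp : f ∘ e₀.symm =ᶠ[nhds (e₀ x)] (f ∘ e.symm) ∘ τ := by
    have h1 : ContinuousAt e₀.symm (e₀ x) := e₀.continuousAt_symm (e₀.map_source hx₀)
    have h2 : e.source ∈ nhds (e₀.symm (e₀ x)) := by
      rw [e₀.left_inv hx₀]; exact e.open_source.mem_nhds hx
    filter_upwards [h1.eventually h2] with z hz
    simp [hτ, e.left_inv hz]
  have hsnd := (he.2 _ hm).2.eventually_snd_fderiv he₀s he.1 hx₀ hx
  set w := (chartDeriv e₀ x v).1 with hw
  have hvw : chartDeriv e₀ x v = (w, 0) :=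
    (isFoliatedChart_of_mem hm).chartDeriv_tangent hx₀ v
  change fderiv ℝ (fderiv ℝ (f ∘ e₀.symm)) (e₀ x) (chartDeriv e₀ x V) (chartDeriv e₀ x v) = _
  rw [hvw]
  have hfd : (fun z => fderiv ℝ (f ∘ e₀.symm) z (w, 0)) =ᶠ[nhds (e₀ x)]
      fun z => inner ℝ (lgrad (f ∘ e.symm) (τ z)) (fderiv ℝ τ z (w, 0)).1 := by
    have hd : ∀ᶠ z in nhds (e₀ x), DifferentiableAt ℝ (f ∘ e.symm) (τ z) := by
      refine hτs.continuousAt.eventually ?_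
      rw [hτx]; exact hu.eventually_differentiableAt
    filter_upwards [hcomp.eventuallyEq_nhds, hsnd, hτs.eventually_differentiableAt, hd]
      with z h1 h2 h3 h4
    rw [h1.fderiv_eq, fderiv_comp z h4 h3, inner_lgrad]
    have h5 : fderiv ℝ τ z (w, 0) = ((fderiv ℝ τ z (w, 0)).1, 0) := Prod.ext rfl (h2 w)
    conv_lhs => rw [ContinuousLinearMap.comp_apply, h5]
  have hL : HasFDerivAt (fun z => fderiv ℝ (f ∘ e₀.symm) z (w, 0))
      ((ContinuousLinearMap.apply ℝ ℝ ((w, 0) : RSpace p × RSpace q)).comp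
        (fderiv ℝ (fderiv ℝ (f ∘ e₀.symm)) (e₀ x))) (e₀ x) :=
    (ContinuousLinearMap.apply ℝ ℝ ((w, 0) : RSpace p × RSpace q)).hasFDerivAt.comp _
      ((hu₀.fderiv_right (m := ∞) (by simp)).differentiableAt (by simp)).hasFDerivAt
  have hG : HasFDerivAt (fun z => lgrad (f ∘ e.symm) (τ z))
      ((fderiv ℝ (lgrad (f ∘ e.symm)) (e x)).comp (fderiv ℝ τ (e₀ x))) (e₀ x) := by
    have h1 : HasFDerivAt (lgrad (f ∘ e.symm)) (fderiv ℝ (lgrad (f ∘ e.symm)) (e x)) (τ (e₀ x)) := by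
      rw [hτx]
      exact (hu.lgrad.differentiableAt (by simp)).hasFDerivAt
    exact h1.comp (e₀ x) (hτs.differentiableAt (by simp)).hasFDerivAt
  have hβ : HasFDerivAt (fun z => (fderiv ℝ τ z (w, 0)).1)
      (fderiv ℝ (fun z => (fderiv ℝ τ z (w, 0)).1) (e₀ x)) (e₀ x) := by
    have h1 : ContDiffAt ℝ ∞ (fderiv ℝ τ) (e₀ x) := hτs.fderiv_right (by simp)
    have h2 : ContDiffAt ℝ ∞ (fun z => fderiv ℝ τ z ((w, 0) : RSpace p × RSpace q)) (e₀ x) :=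
      h1.clm_apply contDiffAt_const
    exact (h2.fst.differentiableAt (by simp)).hasFDerivAt
  have hR := (hG.inner ℝ hβ).congr_of_eventuallyEq hfd
  have h6 := congrArg (fun L => L (chartDeriv e₀ x V)) (hL.unique hR)
  have hG0 : lgrad (f ∘ e.symm) (τ (e₀ x)) = 0 := by rw [hτx]; exact (he.mem_crit_iff hx hf).1 hc
  have hV : fderiv ℝ τ (e₀ x) (chartDeriv e₀ x V) = chartDeriv e x V :=
    (he₀s.chartDeriv_eq he.1 hx₀ hx V).symm
  have hv : fderiv ℝ τ (e₀ x) (w, 0) = chartDeriv e x v := by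
    rw [← hvw]; exact (he₀s.chartDeriv_eq he.1 hx₀ hx v).symm
  refine Eq.trans h6 ?_
  simp only [ContinuousLinearMap.comp_apply, fderivInnerCLM_apply,
    ContinuousLinearMap.prod_apply, hG0, inner_zero_left, zero_add, hV, hv]

theorem IsFoliatedChart.leafHess_apply (he : F.IsFoliatedChart e) (hx : x ∈ e.source)
    (hf : ContMDiffAt (𝓡 (p + q)) 𝓘(ℝ, ℝ) ∞ f x) (hc : x ∈ F.crit f) (v w : F.tangent x) :
    F.leafHess f x v w = inner ℝ (lhess (f ∘ e.symm) (e x) (chartDeriv e x v).1)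
      (chartDeriv e x w).1 := by
  rw [lhess_apply, ← he.chartDeriv_tangent hx v]
  exact he.hess_apply hx hf hc v w

/-- The straight segment in `chartAt x` becomes in `e` a curve `α` tangent to the leaf.
`iteratedDeriv_three_comp` depends only on its initial velocity once this lies in the kernel. -/
theorem IsFoliatedChart.cubic_eq (he : F.IsFoliatedChart e) (hx : x ∈ e.source)
    (hf : ContMDiffAt (𝓡 (p + q)) 𝓘(ℝ, ℝ) ∞ f x) (hc : x ∈ F.crit f) (v : F.tangent x)
    (hv : lhess (f ∘ e.symm) (e x) (chartDeriv e x v).1 = 0) :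
    F.cubic f x v = lcub (f ∘ e.symm) (e x) (chartDeriv e x v).1 := by
  set e₀ := F.chartAt x with he₀
  have hm := F.chartAt_mem x
  have hx₀ := F.mem_chartAt_source x
  have he₀s := F.smooth _ hm
  rw [← he₀] at hm hx₀ he₀s
  set τ := e ∘ e₀.symm with hτ
  have hτs : ContDiffAt ℝ ∞ τ (e₀ x) := he₀s.contDiffAt_transition he.1 hx₀ hx
  have hτx : τ (e₀ x) = e x := by simp [hτ, e₀.left_inv hx₀]
  have hu : ContDiffAt ℝ ∞ (f ∘ e.symm) (e x) :=
    he.1.contDiffAt_comp_symm (e.map_source hx) (by rwa [e.left_inv hx])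
  have hsnd := (he.2 _ hm).2.eventually_snd_fderiv he₀s he.1 hx₀ hx
  set w := (chartDeriv e₀ x v).1 with hw
  have hvw : chartDeriv e₀ x v = (w, 0) :=
    (isFoliatedChart_of_mem hm).chartDeriv_tangent hx₀ v
  let γ : ℝ → RSpace p × RSpace q := fun s => e₀ x + s • chartDeriv e₀ x v
  have hγ0 : γ 0 = e₀ x := by simp [γ]
  have hγd : ∀ s, HasDerivAt γ (w, 0) s := fun s => by
    have := ((hasDerivAt_id s).smul_const (chartDeriv e₀ x v)).const_add (e₀ x)
    rw [one_smul, hvw] at this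
    simp only [γ, hvw]
    exact this
  have hγs : ContDiff ℝ ∞ γ := contDiff_const.add (contDiff_id.smul contDiff_const)
  have hγc : Filter.Tendsto γ (nhds 0) (nhds (e₀ x)) := hγ0 ▸ hγs.continuous.tendsto 0
  let α : ℝ → RSpace p × RSpace q := τ ∘ γ
  have hα0 : α 0 = e x := by simp only [α, Function.comp_apply, hγ0, hτx]
  have hαd : ∀ᶠ s in nhds 0, deriv α s = fderiv ℝ τ (γ s) (w, 0) := by
    filter_upwards [hγc.eventually hτs.eventually_differentiableAt] with s hs
    exact (hs.hasFDerivAt.comp_hasDerivAt s (hγd s)).deriv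
  have hα' : deriv α 0 = chartDeriv e x v := by
    rw [hαd.self_of_nhds, hγ0, ← hvw]
    exact (he₀s.chartDeriv_eq he.1 hx₀ hx v).symm
  have hfα : (fun s : ℝ => f (e₀.symm (e₀ x + s • chartDeriv e₀ x v))) =ᶠ[nhds 0]
      (f ∘ e.symm) ∘ α := by
    have h1 : ContinuousAt e₀.symm (e₀ x) := e₀.continuousAt_symm (e₀.map_source hx₀)
    have h2 : e.source ∈ nhds (e₀.symm (e₀ x)) := by
      rw [e₀.left_inv hx₀]; exact e.open_source.mem_nhds hx
    filter_upwards [hγc.eventually (h1.eventually h2)] with s hs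
    have := e.left_inv hs
    simp only [α, γ, hτ, Function.comp_apply] at this ⊢
    rw [this]
  have hcub : F.cubic f x v = iteratedDeriv 3 ((f ∘ e.symm) ∘ α) 0 :=
    hfα.iteratedDeriv_eq 3
  rw [hcub, iteratedDeriv_three_comp (by rwa [hα0]) ?_ ?_ ?_ ?_, hα0, hα']
  · refine ContDiffAt.comp (0 : ℝ) ?_ hγs.contDiffAt
    rwa [hγ0]
  · filter_upwards [hαd, hγc.eventually hsnd] with s h1 h2
    rw [h1]; exact h2 w
  · rw [hα0]; exact (he.mem_crit_iff hx hf).1 hc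
  · rw [hα0, hα']; exact hv

end FoliatedChart

end Foliation

end

/-! ### Versality, an open condition for Morse or birth-death type -/

section

section Versal

variable {X Y : Type*} [NormedAddCommGroup X] [InnerProductSpace ℝ X]
  [NormedAddCommGroup Y] [NormedSpace ℝ Y]

/-- A condition on the first two derivatives of a leafwise gradient: it says that a critical point
is Morse or of birth-death type. -/
def IsVersal (A : X × Y →L[ℝ] X) (T : X × Y →L[ℝ] X × Y →L[ℝ] X) : Prop :=
  ∀ v : X, v ≠ 0 → (A (v, 0) ≠ 0 ∨ inner ℝ v (T (v, 0) (v, 0)) ≠ 0) ∧ ∃ W, inner ℝ (A W) v ≠ 0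

/-- By homogeneity it suffices to treat the compact unit sphere, where pointwise stability becomes
uniform. -/
theorem eventually_forall_ne_zero_of_sphere [FiniteDimensional ℝ X] {B : Type*}
    [TopologicalSpace B] {b₀ : B} {P : B → X → Prop}
    (hP : ∀ v, v ≠ 0 → ∀ᶠ z : B × X in nhds (b₀, v), P z.1 z.2)
    (hs : ∀ b (c : ℝ) v, c ≠ 0 → P b v → P b (c • v)) :
    ∀ᶠ b in nhds b₀, ∀ v, v ≠ 0 → P b v := by
  have h := (isCompact_sphere (0 : X) 1).eventually_forall_of_forall_eventually (x₀ := b₀) (P := P)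
    (fun v hv => hP v (by rintro rfl; simp at hv))
  filter_upwards [h] with b hb v hv
  have h1 : ‖v‖ ≠ 0 := norm_ne_zero_iff.2 hv
  have h2 := hs b ‖v‖ _ h1 (hb (‖v‖⁻¹ • v) (by simp [norm_smul, h1]))
  rwa [smul_smul, mul_inv_cancel₀ h1, one_smul] at h2

theorem eventually_forall_apply_ne_zero [FiniteDimensional ℝ X] {A₀ : X × Y →L[ℝ] X}
    (h : ∀ v, v ≠ 0 → A₀ (v, 0) ≠ 0) :
    ∀ᶠ A : X × Y →L[ℝ] X in nhds A₀, ∀ v, v ≠ 0 → A (v, 0) ≠ 0 := by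
  refine eventually_forall_ne_zero_of_sphere (fun v hv => ?_) fun A c v hc hv => ?_
  · have hc : Continuous fun z : (X × Y →L[ℝ] X) × X => z.1 (z.2, 0) := by fun_prop
    exact hc.continuousAt.eventually_ne (h v hv)
  · have : ((c • v, 0) : X × Y) = c • (v, 0) := by simp
    rw [this, map_smul]
    exact smul_ne_zero hc hv

/-- Birth-death type contains the closed condition that the Hessian has a kernel. Stated for each
direction as a choice between nonvanishing Hessian and nonvanishing cubic form, Morse and
birth-death together become open. -/
theorem IsVersal.eventually [FiniteDimensional ℝ X] {A₀ : X × Y →L[ℝ] X}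
    {T₀ : X × Y →L[ℝ] X × Y →L[ℝ] X} (h : IsVersal A₀ T₀) :
    ∀ᶠ z : (X × Y →L[ℝ] X) × (X × Y →L[ℝ] X × Y →L[ℝ] X) in nhds (A₀, T₀),
      IsVersal z.1 z.2 := by
  refine eventually_forall_ne_zero_of_sphere (fun v hv => ?_) fun A c v hc hv => ?_
  · refine Filter.Eventually.and ?_ ?_
    · rcases (h v hv).1 with h1 | h1
      · have hc : Continuous fun z : ((X × Y →L[ℝ] X) × (X × Y →L[ℝ] X × Y →L[ℝ] X)) × X =>
            z.1.1 (z.2, 0) := by fun_prop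
        exact (hc.continuousAt.eventually_ne h1).mono fun _ h => Or.inl h
      · have hc : Continuous fun z : ((X × Y →L[ℝ] X) × (X × Y →L[ℝ] X × Y →L[ℝ] X)) × X =>
            inner ℝ z.2 (z.1.2 (z.2, 0) (z.2, 0)) := by fun_prop
        exact (hc.continuousAt.eventually_ne h1).mono fun _ h => Or.inr h
    · obtain ⟨W, hW⟩ := (h v hv).2
      have hc : Continuous fun z : ((X × Y →L[ℝ] X) × (X × Y →L[ℝ] X × Y →L[ℝ] X)) × X =>
          inner ℝ (z.1.1 W) z.2 := by fun_prop
      exact (hc.continuousAt.eventually_ne hW).mono fun _ h => ⟨W, h⟩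
  · have : ((c • v, 0) : X × Y) = c • (v, 0) := by simp
    refine ⟨hv.1.imp (fun h1 => ?_) (fun h1 => ?_), hv.2.imp fun W hW => ?_⟩
    · rw [this, map_smul]
      exact smul_ne_zero hc h1
    · rw [this, map_smul, map_smul, smul_apply, inner_smul_left, inner_smul_right,
        inner_smul_right]
      simp [hc, h1]
    · rw [inner_smul_right]
      exact mul_ne_zero hc hW

/-- At a versal critical point the kernel of the Hessian is at most one-dimensional: an odd
function on a plane has a zero. -/
theorem IsVersal.kernel_le_one {A : X × Y →L[ℝ] X} {T : X × Y →L[ℝ] X × Y →L[ℝ] X}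
    (h : IsVersal A T) {v w : X} (hv : A (v, 0) = 0) (hw : A (w, 0) = 0) (hv0 : v ≠ 0) :
    ∃ c : ℝ, w = c • v := by
  let γ : ℝ → X := fun θ => Real.cos θ • v + Real.sin θ • w
  have hγ : Continuous γ := by fun_prop
  have hA : ∀ θ, A (γ θ, 0) = 0 := fun θ => by
    have : ((γ θ, 0) : X × Y) = Real.cos θ • (v, 0) + Real.sin θ • (w, 0) := by
      simp [γ]
    rw [this, map_add, map_smul, map_smul, hv, hw, smul_zero, smul_zero, add_zero]
  let φ : ℝ → ℝ := fun θ => inner ℝ (γ θ) (T (γ θ, 0) (γ θ, 0))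
  have hφ : Continuous φ := by fun_prop
  have h0 : γ 0 = v := by simp [γ]
  have hπ : γ Real.pi = -v := by simp [γ]
  have hn : ((-v, 0) : X × Y) = -(v, 0) := by simp
  have hφπ : φ Real.pi = -φ 0 := by
    simp only [φ, h0, hπ, hn, map_neg, neg_apply, neg_neg, inner_neg_left]
  obtain ⟨θ, -, hθ⟩ : ∃ θ ∈ uIcc 0 Real.pi, φ θ = 0 := by
    refine intermediate_value_uIcc hφ.continuousOn ?_
    rw [hφπ, mem_uIcc]
    rcases le_total 0 (φ 0) with h | h
    · exact Or.inr ⟨by linarith, h⟩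
    · exact Or.inl ⟨h, by linarith⟩
  have hγ0 : γ θ = 0 := by
    by_contra hne
    rcases (h _ hne).1 with h1 | h1
    · exact h1 (hA θ)
    · exact h1 hθ
  have hs : Real.sin θ ≠ 0 := by
    intro hs
    have hc : Real.cos θ ≠ 0 := fun hc => by
      have := Real.sin_sq_add_cos_sq θ
      rw [hs, hc] at this
      norm_num at this
    simp only [γ, hs, zero_smul, add_zero] at hγ0
    exact (smul_ne_zero hc hv0) hγ0
  refine ⟨-(Real.sin θ)⁻¹ * Real.cos θ, ?_⟩
  have h1 : Real.sin θ • w = -(Real.cos θ • v) := (neg_eq_of_add_eq_zero_right hγ0).symm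
  calc w = (Real.sin θ)⁻¹ • (Real.sin θ • w) := by rw [smul_smul, inv_mul_cancel₀ hs, one_smul]
    _ = _ := by rw [h1, smul_neg, smul_smul, neg_mul, neg_smul]

end Versal

namespace Foliation

variable {p q : ℕ} {M : Type*} [TopologicalSpace M] [ChartedSpace (RSpace (p + q)) M]
  {F : Foliation p q M} {e : OpenPartialHomeomorph M (RSpace p × RSpace q)} {x : M} {f : M → ℝ}

theorem IsFoliatedChart.leafHess_eq_zero_iff (he : F.IsFoliatedChart e) (hx : x ∈ e.source)
    (hf : ContMDiffAt (𝓡 (p + q)) 𝓘(ℝ, ℝ) ∞ f x) (hc : x ∈ F.crit f) (v : F.tangent x) :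
    F.leafHess f x v = 0 ↔ lhess (f ∘ e.symm) (e x) (chartDeriv e x v).1 = 0 := by
  constructor
  · intro h
    rw [← inner_self_eq_zero (𝕜 := ℝ)]
    obtain ⟨w, hw⟩ := he.exists_tangent hx (lhess (f ∘ e.symm) (e x) (chartDeriv e x v).1)
    have := he.leafHess_apply hx hf hc v w
    rw [h, hw] at this
    exact this.symm
  · intro h
    ext w
    rw [he.leafHess_apply hx hf hc, h, inner_zero_left]
    rfl

theorem IsFoliatedChart.isMorsePoint_iff (he : F.IsFoliatedChart e) (hx : x ∈ e.source)
    (hf : ContMDiffAt (𝓡 (p + q)) 𝓘(ℝ, ℝ) ∞ f x) (hc : x ∈ F.crit f) :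
    F.IsMorsePoint f x ↔ ∀ v, v ≠ 0 → lhess (f ∘ e.symm) (e x) v ≠ 0 := by
  have hu : ContDiffAt ℝ ∞ (f ∘ e.symm) (e x) :=
    he.1.contDiffAt_comp_symm (e.map_source hx) (by rwa [e.left_inv hx])
  constructor
  · rintro ⟨-, h⟩ w hw hw0
    obtain ⟨v, hv⟩ := he.exists_tangent hx w
    have h1 : F.leafHess f x v = 0 := by
      rw [he.leafHess_eq_zero_iff hx hf hc, hv]
      exact hw0
    have h2 : v = 0 := h.1 v fun y => by rw [h1]; rfl
    exact hw (by rw [← (he.fst_chartDeriv_eq_zero hx).2 h2, hv])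
  · intro h
    have key : ∀ v, F.leafHess f x v = 0 → v = 0 := fun v hv => by
      rw [he.leafHess_eq_zero_iff hx hf hc] at hv
      rw [← he.fst_chartDeriv_eq_zero hx]
      by_contra hne
      exact h _ hne hv
    refine ⟨hc, ?_, ?_⟩
    · intro v hv
      exact key v (LinearMap.ext hv)
    · intro v hv
      refine key v (LinearMap.ext fun w => ?_)
      have h1 := hv w
      rw [he.leafHess_apply hx hf hc, lhess_symm hu, real_inner_comm,
        ← he.leafHess_apply hx hf hc] at h1
      exact h1

/-- The second half of `IsVersal` is injectivity of the transpose of `hess`, equivalent to its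
surjectivity; at a Morse point it holds automatically. Versality does not mention the dimension of
the kernel: it is bounded by `kernel_le_one`. -/
theorem IsFoliatedChart.morse_or_birthDeath_iff (he : F.IsFoliatedChart e) (hx : x ∈ e.source)
    (hf : ContMDiffAt (𝓡 (p + q)) 𝓘(ℝ, ℝ) ∞ f x) (hc : x ∈ F.crit f) :
    F.IsMorsePoint f x ∨ F.IsBirthDeath f x ↔ IsVersal (fderiv ℝ (lgrad (f ∘ e.symm)) (e x))
      (fderiv ℝ (fderiv ℝ (lgrad (f ∘ e.symm))) (e x)) := by
  have hA := fun v => lhess_apply (f ∘ e.symm) (e x) v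
  constructor
  · rintro (h | ⟨-, h1, h2, h3⟩) v hv
    · have hM := (he.isMorsePoint_iff hx hf hc).1 h
      have hu : ContDiffAt ℝ ∞ (f ∘ e.symm) (e x) :=
        he.1.contDiffAt_comp_symm (e.map_source hx) (by rwa [e.left_inv hx])
      refine ⟨Or.inl (by rw [← hA]; exact hM v hv), ?_⟩
      by_contra! hno
      apply hM v hv
      rw [← inner_self_eq_zero (𝕜 := ℝ), lhess_symm hu, real_inner_comm, hA]
      exact hno _
    · obtain ⟨w, hw⟩ := he.exists_tangent hx v
      have hw0 : w ≠ 0 := fun h0 => hv (by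
        rw [← (he.fst_chartDeriv_eq_zero hx).2 h0, hw])
      refine ⟨?_, ?_⟩
      · by_cases hk : F.leafHess f x w = 0
        · right
          have h4 := h2 w hk hw0
          rw [he.leafHess_eq_zero_iff hx hf hc] at hk
          rw [he.cubic_eq hx hf hc w hk, hw] at h4
          exact h4
        · left
          rw [he.leafHess_eq_zero_iff hx hf hc, hw, hA] at hk
          exact hk
      · by_contra! hno
        have h4 := LinearMap.flip_injective_iff₂.2 h3
        apply hw0
        apply h4
        rw [map_zero]
        ext V
        have := he.hess_apply hx hf hc V w
        rw [hw, hno] at this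
        exact this
  · intro h
    by_cases hM : F.IsMorsePoint f x
    · exact Or.inl hM
    right
    have hM' := hM
    rw [he.isMorsePoint_iff hx hf hc] at hM
    push Not at hM
    obtain ⟨v, hv, hv0⟩ := hM
    obtain ⟨v', hv'⟩ := he.exists_tangent hx v
    have hv'0 : v' ≠ 0 := fun h0 => hv (by
      rw [← (he.fst_chartDeriv_eq_zero hx).2 h0, hv'])
    have hkv' : F.leafHess f x v' = 0 := by
      rw [he.leafHess_eq_zero_iff hx hf hc, hv']; exact hv0
    refine ⟨hc, ?_, ?_, ?_⟩
    · rw [finrank_eq_one_iff']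
      refine ⟨⟨v', hkv'⟩, fun h0 => hv'0 (congrArg Subtype.val h0), ?_⟩
      rintro ⟨w', hw'⟩
      have hw'' : F.leafHess f x w' = 0 := hw'
      rw [he.leafHess_eq_zero_iff hx hf hc, hA] at hw''
      obtain ⟨c, hc'⟩ := h.kernel_le_one (by rw [← hA]; exact hv0) hw'' hv
      refine ⟨c, Subtype.ext ?_⟩
      have h5 : (chartDeriv e x ((c • v' - w' : F.tangent x) : TangentSpace (𝓡 (p + q)) x)).1 = 0 := by
        rw [Submodule.coe_sub, Submodule.coe_smul, map_sub, map_smul, hv', Prod.fst_sub, hc']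
        simp
      exact sub_eq_zero.1 ((he.fst_chartDeriv_eq_zero hx).1 h5)
    · intro w hw hw0
      have hw' : F.leafHess f x w = 0 := hw
      rw [he.leafHess_eq_zero_iff hx hf hc] at hw'
      rw [he.cubic_eq hx hf hc w hw']
      have h6 : (chartDeriv e x w).1 ≠ 0 := fun h0 => hw0 ((he.fst_chartDeriv_eq_zero hx).1 h0)
      rcases (h _ h6).1 with h7 | h7
      · exact absurd (by rw [← hA]; exact hw') h7
      · exact h7
    · rw [← LinearMap.flip_injective_iff₂, injective_iff_map_eq_zero]
      intro w hw
      by_contra hw0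
      have h6 : (chartDeriv e x w).1 ≠ 0 := fun h0 => hw0 ((he.fst_chartDeriv_eq_zero hx).1 h0)
      obtain ⟨W, hW⟩ := (h _ h6).2
      obtain ⟨V, rfl⟩ := (he.1.chartDeriv_bijective hx).2 W
      apply hW
      rw [← he.hess_apply hx hf hc]
      exact congrArg (fun L => L V) hw

/-- Regular points of the critical set of a nice function are Morse. -/
theorem isMorsePoint_of_mem_regCrit (hx : x ∈ F.regCrit f)
    (h : F.IsMorsePoint f x ∨ F.IsBirthDeath f x) : F.IsMorsePoint f x := by
  rcases h with h | ⟨-, h1, -, h3⟩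
  · exact h
  exfalso
  -- Transversality writes each tangent vector as an element of the kernel of `hess` plus a leaf
  -- vector, so `hess` is already onto on leaf vectors. Equality of dimensions then excludes a
  -- one-dimensional kernel.
  have hsurj : Function.Surjective (F.leafHess f x) := by
    intro φ
    obtain ⟨V, hV⟩ := h3 φ
    have hVt : V ∈ LinearMap.ker (F.hess f x) ⊔ F.tangent x := by rw [hx.2]; trivial
    obtain ⟨a, ha, b, hb, hab⟩ := Submodule.mem_sup.1 hVt
    refine ⟨⟨b, hb⟩, ?_⟩
    rw [← hV, ← hab, map_add, LinearMap.mem_ker.1 ha, zero_add]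
    rfl
  have h4 := LinearMap.finrank_range_add_finrank_ker (F.leafHess f x)
  rw [LinearMap.range_eq_top.2 hsurj, finrank_top, h1] at h4
  have h5 : Module.finrank ℝ (F.tangent x →ₗ[ℝ] ℝ) = Module.finrank ℝ (F.tangent x) :=
    Subspace.dual_finrank_eq
  omega

end Foliation

end

/-! ### Finite-dimensional families of functions and stability -/

section

section LinearFamily

/-- A linear differential operator is jointly continuous on an affine finite-dimensional family. -/
theorem continuousOn_linear_family {V E W : Type*} [NormedAddCommGroup V] [NormedSpace ℝ V]
    [FiniteDimensional ℝ V] [TopologicalSpace E] [AddCommGroup W] [Module ℝ W]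
    [TopologicalSpace W] [ContinuousAdd W] [ContinuousSMul ℝ W]
    {T : Set E} {S : Submodule ℝ (E → ℝ)} (D : (E → ℝ) → E → W)
    (hadd : ∀ u ∈ S, ∀ v ∈ S, ∀ z ∈ T, D (u + v) z = D u z + D v z)
    (hsmul : ∀ (c : ℝ), ∀ u ∈ S, ∀ z ∈ T, D (c • u) z = c • D u z)
    (hcont : ∀ u ∈ S, ContinuousOn (D u) T) {u : E → ℝ} (hu : u ∈ S) (Λ : V →ₗ[ℝ] (E → ℝ))
    (hΛ : ∀ c, Λ c ∈ S) :
    ContinuousOn (fun w : V × E => D (u + Λ w.1) w.2) (univ ×ˢ T) := by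
  let b := Module.finBasis ℝ V
  -- In a basis of `V` the operator becomes a finite sum of fixed continuous functions with
  -- coefficients linear in the parameter, whence joint continuity.
  have key : ∀ s : Finset (Fin (Module.finrank ℝ V)), ∀ c, ∀ z ∈ T,
      D (u + ∑ j ∈ s, b.repr c j • Λ (b j)) z = D u z + ∑ j ∈ s, b.repr c j • D (Λ (b j)) z := by
    intro s c z hz
    induction s using Finset.cons_induction with
    | empty => simp
    | cons a s ha ih =>
      rw [Finset.sum_cons, Finset.sum_cons, add_comm (b.repr c a • Λ (b a)), ← add_assoc,
        hadd _ (S.add_mem hu (S.sum_mem fun j _ => S.smul_mem _ (hΛ _))) _ (S.smul_mem _ (hΛ _)) z hz,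
        ih, hsmul _ _ (hΛ _) z hz]
      abel
  have hc : ContinuousOn (fun w : V × E => D u w.2 + ∑ j, b.repr w.1 j • D (Λ (b j)) w.2)
      (univ ×ˢ T) := by
    have hsnd : MapsTo (Prod.snd : V × E → E) (univ ×ˢ T) T := fun w hw => hw.2
    refine ((hcont u hu).comp continuousOn_snd hsnd).add (continuousOn_finsetSum _ fun j _ => ?_)
    have h1 : Continuous fun w : V × E => b.repr w.1 j := by
      have : Continuous fun c : V => b.coord j c := (b.coord j).continuous_of_finiteDimensional
      exact this.comp continuous_fst
    exact h1.continuousOn.smul ((hcont _ (hΛ _)).comp continuousOn_snd hsnd)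
  refine hc.congr fun w hw => ?_
  dsimp only
  rw [← key Finset.univ w.1 w.2 hw.2]
  congr 2
  conv_lhs => rw [← b.sum_repr w.1, map_sum]
  simp only [map_smul]

variable {X Y : Type*} [NormedAddCommGroup X] [InnerProductSpace ℝ X] [FiniteDimensional ℝ X]
  [NormedAddCommGroup Y] [NormedSpace ℝ Y]

/-- The functions that are smooth at all points of a set. -/
def smoothAt {E : Type*} [NormedAddCommGroup E] [NormedSpace ℝ E] (T : Set E) :
    Submodule ℝ (E → ℝ) where
  carrier := {u | ∀ z ∈ T, ContDiffAt ℝ ∞ u z}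
  add_mem' hu hv z hz := (hu z hz).add (hv z hz)
  zero_mem' _ _ := contDiffAt_const
  smul_mem' _ _ hu z hz := contDiffAt_const.smul (hu z hz)

theorem lgrad_add {u v : X × Y → ℝ} {z : X × Y} (hu : DifferentiableAt ℝ u z)
    (hv : DifferentiableAt ℝ v z) : lgrad (u + v) z = lgrad u z + lgrad v z := by
  simp only [lgrad, fderiv_add hu hv, add_apply, add_smul, Finset.sum_add_distrib]

theorem lgrad_smul {u : X × Y → ℝ} {z : X × Y} (hu : DifferentiableAt ℝ u z) (c : ℝ) :
    lgrad (c • u) z = c • lgrad u z := by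
  simp only [lgrad, fderiv_const_smul hu, smul_apply, smul_assoc, Finset.smul_sum]

variable {T : Set (X × Y)} {u v : X × Y → ℝ} {z : X × Y}

theorem lgrad_add_eventuallyEq (hu : ContDiffAt ℝ ∞ u z) (hv : ContDiffAt ℝ ∞ v z) :
    lgrad (u + v) =ᶠ[nhds z] lgrad u + lgrad v := by
  filter_upwards [hu.eventually_differentiableAt, hv.eventually_differentiableAt] with w h1 h2
  exact lgrad_add h1 h2

theorem lgrad_smul_eventuallyEq (hu : ContDiffAt ℝ ∞ u z) (c : ℝ) :
    lgrad (c • u) =ᶠ[nhds z] c • lgrad u := by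
  filter_upwards [hu.eventually_differentiableAt] with w h1
  exact lgrad_smul h1 c

theorem fderiv_lgrad_add_eventuallyEq (hu : ContDiffAt ℝ ∞ u z) (hv : ContDiffAt ℝ ∞ v z) :
    fderiv ℝ (lgrad (u + v)) =ᶠ[nhds z] fderiv ℝ (lgrad u) + fderiv ℝ (lgrad v) := by
  filter_upwards [(lgrad_add_eventuallyEq hu hv).eventuallyEq_nhds,
    hu.lgrad.eventually_differentiableAt, hv.lgrad.eventually_differentiableAt] with w h h1 h2
  rw [h.fderiv_eq, fderiv_add h1 h2]
  rfl

theorem fderiv_lgrad_smul_eventuallyEq (hu : ContDiffAt ℝ ∞ u z) (c : ℝ) :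
    fderiv ℝ (lgrad (c • u)) =ᶠ[nhds z] c • fderiv ℝ (lgrad u) := by
  filter_upwards [(lgrad_smul_eventuallyEq hu c).eventuallyEq_nhds,
    hu.lgrad.eventually_differentiableAt] with w h h1
  rw [h.fderiv_eq, fderiv_const_smul h1]
  rfl

variable {V : Type*} [NormedAddCommGroup V] [NormedSpace ℝ V] [FiniteDimensional ℝ V]

theorem continuousOn_lgrad_family (hu : u ∈ smoothAt T) (Λ : V →ₗ[ℝ] (X × Y → ℝ))
    (hΛ : ∀ c, Λ c ∈ smoothAt T) :
    ContinuousOn (fun w : V × (X × Y) => lgrad (u + Λ w.1) w.2) (univ ×ˢ T) :=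
  continuousOn_linear_family (S := smoothAt T) lgrad
    (fun _ h1 _ h2 z hz => (lgrad_add_eventuallyEq (h1 z hz) (h2 z hz)).self_of_nhds)
    (fun c _ h1 z hz => (lgrad_smul_eventuallyEq (h1 z hz) c).self_of_nhds)
    (fun _ h1 z hz => (h1 z hz).lgrad.continuousAt.continuousWithinAt) hu Λ hΛ

theorem continuousOn_fderiv_lgrad_family (hu : u ∈ smoothAt T) (Λ : V →ₗ[ℝ] (X × Y → ℝ))
    (hΛ : ∀ c, Λ c ∈ smoothAt T) :
    ContinuousOn (fun w : V × (X × Y) => fderiv ℝ (lgrad (u + Λ w.1)) w.2) (univ ×ˢ T) := by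
  refine continuousOn_linear_family (S := smoothAt T) (fun u => fderiv ℝ (lgrad u))
    (fun _ h1 _ h2 z hz => (fderiv_lgrad_add_eventuallyEq (h1 z hz) (h2 z hz)).self_of_nhds)
    (fun c _ h1 z hz => (fderiv_lgrad_smul_eventuallyEq (h1 z hz) c).self_of_nhds)
    (fun u h1 z hz => ?_) hu Λ hΛ
  have : ContDiffAt ℝ ∞ (fderiv ℝ (lgrad u)) z := (h1 z hz).lgrad.fderiv_right (by simp)
  exact this.continuousAt.continuousWithinAt

theorem continuousOn_fderiv_fderiv_lgrad_family (hu : u ∈ smoothAt T)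
    (Λ : V →ₗ[ℝ] (X × Y → ℝ)) (hΛ : ∀ c, Λ c ∈ smoothAt T) :
    ContinuousOn (fun w : V × (X × Y) => fderiv ℝ (fderiv ℝ (lgrad (u + Λ w.1))) w.2)
      (univ ×ˢ T) := by
  have hs : ∀ {u : X × Y → ℝ} {z}, ContDiffAt ℝ ∞ u z → ContDiffAt ℝ ∞ (fderiv ℝ (lgrad u)) z :=
    fun h => h.lgrad.fderiv_right (by simp)
  refine continuousOn_linear_family (S := smoothAt T) (W := X × Y →L[ℝ] (X × Y →L[ℝ] X))
    (fun u => fderiv ℝ (fderiv ℝ (lgrad u)))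
    (fun u h1 v h2 z hz => ?_) (fun c u h1 z hz => ?_) (fun u h1 z hz => ?_) hu Λ hΛ
  · rw [(fderiv_lgrad_add_eventuallyEq (h1 z hz) (h2 z hz)).fderiv_eq,
      fderiv_add ((hs (h1 z hz)).differentiableAt (by simp))
        ((hs (h2 z hz)).differentiableAt (by simp))]
  · rw [(fderiv_lgrad_smul_eventuallyEq (h1 z hz) c).fderiv_eq,
      fderiv_const_smul ((hs (h1 z hz)).differentiableAt (by simp))]
  · have h2 := (hs (h1 z hz)).fderiv_right (m := ∞) (by simp)
    exact h2.continuousAt.continuousWithinAt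

end LinearFamily

namespace Foliation

variable {p q : ℕ} {M : Type*} [TopologicalSpace M] [ChartedSpace (RSpace (p + q)) M]
  {F : Foliation p q M} {e : OpenPartialHomeomorph M (RSpace p × RSpace q)} {x : M} {f : M → ℝ}

theorem IsFoliatedChart.comp_symm_mem_smoothAt (he : F.IsFoliatedChart e)
    (hf : ContMDiff (𝓡 (p + q)) 𝓘(ℝ, ℝ) ∞ f) : f ∘ e.symm ∈ smoothAt e.target :=
  fun _ hz => he.1.contDiffAt_comp_symm hz hf.contMDiffAt

/-- A linear family of functions, read in a chart. -/
def chartFamily {V : Type*} [AddCommGroup V] [Module ℝ V] (Λ : V →ₗ[ℝ] (M → ℝ))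
    (e : OpenPartialHomeomorph M (RSpace p × RSpace q)) :
    V →ₗ[ℝ] (RSpace p × RSpace q → ℝ) :=
  LinearMap.funLeft ℝ ℝ e.symm ∘ₗ Λ

variable {V : Type*} [NormedAddCommGroup V] [NormedSpace ℝ V] [FiniteDimensional ℝ V]
  {Λ : V →ₗ[ℝ] (M → ℝ)}

theorem IsFoliatedChart.continuousAt_lgrad_family (he : F.IsFoliatedChart e)
    (hf : ContMDiff (𝓡 (p + q)) 𝓘(ℝ, ℝ) ∞ f)
    (hΛ : ∀ c, ContMDiff (𝓡 (p + q)) 𝓘(ℝ, ℝ) ∞ (Λ c)) (c : V) {z : RSpace p × RSpace q}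
    (hz : z ∈ e.target) :
    ContinuousAt (fun w : V × (RSpace p × RSpace q) => lgrad ((f + Λ w.1) ∘ e.symm) w.2) (c, z) :=
  (continuousOn_lgrad_family (he.comp_symm_mem_smoothAt hf) (chartFamily Λ e)
    fun c => he.comp_symm_mem_smoothAt (hΛ c)).continuousAt
    ((isOpen_univ.prod e.open_target).mem_nhds ⟨mem_univ _, hz⟩)

theorem IsFoliatedChart.continuousAt_fderiv_lgrad_family (he : F.IsFoliatedChart e)
    (hf : ContMDiff (𝓡 (p + q)) 𝓘(ℝ, ℝ) ∞ f)
    (hΛ : ∀ c, ContMDiff (𝓡 (p + q)) 𝓘(ℝ, ℝ) ∞ (Λ c)) (c : V) {z : RSpace p × RSpace q}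
    (hz : z ∈ e.target) :
    ContinuousAt (fun w : V × (RSpace p × RSpace q) =>
      fderiv ℝ (lgrad ((f + Λ w.1) ∘ e.symm)) w.2) (c, z) :=
  (continuousOn_fderiv_lgrad_family (he.comp_symm_mem_smoothAt hf) (chartFamily Λ e)
    fun c => he.comp_symm_mem_smoothAt (hΛ c)).continuousAt
    ((isOpen_univ.prod e.open_target).mem_nhds ⟨mem_univ _, hz⟩)

theorem IsFoliatedChart.continuousAt_fderiv_fderiv_lgrad_family (he : F.IsFoliatedChart e)
    (hf : ContMDiff (𝓡 (p + q)) 𝓘(ℝ, ℝ) ∞ f)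
    (hΛ : ∀ c, ContMDiff (𝓡 (p + q)) 𝓘(ℝ, ℝ) ∞ (Λ c)) (c : V) {z : RSpace p × RSpace q}
    (hz : z ∈ e.target) :
    ContinuousAt (fun w : V × (RSpace p × RSpace q) =>
      fderiv ℝ (fderiv ℝ (lgrad ((f + Λ w.1) ∘ e.symm))) w.2) (c, z) :=
  (continuousOn_fderiv_fderiv_lgrad_family (he.comp_symm_mem_smoothAt hf) (chartFamily Λ e)
    fun c => he.comp_symm_mem_smoothAt (hΛ c)).continuousAt
    ((isOpen_univ.prod e.open_target).mem_nhds ⟨mem_univ _, hz⟩)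

theorem tendsto_chart (V : Type*) [TopologicalSpace V] (hx : x ∈ e.source) (c : V) :
    Filter.Tendsto (fun w : V × M => (w.1, e w.2)) (nhds (c, x)) (nhds (c, e x)) :=
  (continuousAt_fst.prodMk (ContinuousAt.comp (f := fun w : V × M => w.2) (g := e)
    (e.continuousAt hx) continuousAt_snd))

/-- Not being critical, and being critical of Morse type, is stable. -/
theorem eventually_isMorsePoint (F : Foliation p q M) (hf : ContMDiff (𝓡 (p + q)) 𝓘(ℝ, ℝ) ∞ f)
    (hΛ : ∀ c, ContMDiff (𝓡 (p + q)) 𝓘(ℝ, ℝ) ∞ (Λ c)) {c : V}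
    (h : x ∈ F.crit (f + Λ c) → F.IsMorsePoint (f + Λ c) x) :
    ∀ᶠ w : V × M in nhds (c, x), w.2 ∈ F.crit (f + Λ w.1) → F.IsMorsePoint (f + Λ w.1) w.2 := by
  have hs : ∀ c, ContMDiff (𝓡 (p + q)) 𝓘(ℝ, ℝ) ∞ (f + Λ c) := fun c => hf.add (hΛ c)
  set e := F.chartAt x
  have he : F.IsFoliatedChart e := isFoliatedChart_of_mem (F.chartAt_mem x)
  have hx : x ∈ e.source := F.mem_chartAt_source x
  have ht := tendsto_chart V hx c
  have hsrc : ∀ᶠ w : V × M in nhds (c, x), w.2 ∈ e.source :=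
    continuousAt_snd.eventually (e.open_source.mem_nhds hx)
  by_cases hc : x ∈ F.crit (f + Λ c)
  · have h1 := (he.isMorsePoint_iff hx (hs c).contMDiffAt hc).1 (h hc)
    simp only [lhess_apply] at h1
    have h2 := eventually_forall_apply_ne_zero h1
    have h3 := ht.eventually ((he.continuousAt_fderiv_lgrad_family hf hΛ c
      (e.map_source hx)).eventually h2)
    filter_upwards [h3, hsrc] with w hw1 hw2 hw3
    rw [he.isMorsePoint_iff hw2 (hs w.1).contMDiffAt hw3]
    simpa only [lhess_apply] using hw1
  · rw [he.mem_crit_iff hx (hs c).contMDiffAt] at hc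
    have h3 := ht.eventually ((he.continuousAt_lgrad_family hf hΛ c
      (e.map_source hx)).eventually_ne hc)
    filter_upwards [h3, hsrc] with w hw1 hw2 hw3
    rw [he.mem_crit_iff hw2 (hs w.1).contMDiffAt] at hw3
    exact absurd hw3 hw1

/-- Not being critical, and being critical of Morse or of birth-death type, is stable. -/
theorem eventually_morse_or_birthDeath (F : Foliation p q M)
    (hf : ContMDiff (𝓡 (p + q)) 𝓘(ℝ, ℝ) ∞ f)
    (hΛ : ∀ c, ContMDiff (𝓡 (p + q)) 𝓘(ℝ, ℝ) ∞ (Λ c)) {c : V}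
    (h : x ∈ F.crit (f + Λ c) → F.IsMorsePoint (f + Λ c) x ∨ F.IsBirthDeath (f + Λ c) x) :
    ∀ᶠ w : V × M in nhds (c, x), w.2 ∈ F.crit (f + Λ w.1) →
      F.IsMorsePoint (f + Λ w.1) w.2 ∨ F.IsBirthDeath (f + Λ w.1) w.2 := by
  have hs : ∀ c, ContMDiff (𝓡 (p + q)) 𝓘(ℝ, ℝ) ∞ (f + Λ c) := fun c => hf.add (hΛ c)
  set e := F.chartAt x
  have he : F.IsFoliatedChart e := isFoliatedChart_of_mem (F.chartAt_mem x)
  have hx : x ∈ e.source := F.mem_chartAt_source x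
  have ht := tendsto_chart V hx c
  have hsrc : ∀ᶠ w : V × M in nhds (c, x), w.2 ∈ e.source :=
    continuousAt_snd.eventually (e.open_source.mem_nhds hx)
  by_cases hc : x ∈ F.crit (f + Λ c)
  · have h1 := (he.morse_or_birthDeath_iff hx (hs c).contMDiffAt hc).1 (h hc)
    have h2 := h1.eventually
    have h3 := ht.eventually (((he.continuousAt_fderiv_lgrad_family hf hΛ c
      (e.map_source hx)).prodMk (he.continuousAt_fderiv_fderiv_lgrad_family hf hΛ c
      (e.map_source hx))).eventually h2)
    filter_upwards [h3, hsrc] with w hw1 hw2 hw3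
    rw [he.morse_or_birthDeath_iff hw2 (hs w.1).contMDiffAt hw3]
    exact hw1
  · rw [he.mem_crit_iff hx (hs c).contMDiffAt] at hc
    have h3 := ht.eventually ((he.continuousAt_lgrad_family hf hΛ c
      (e.map_source hx)).eventually_ne hc)
    filter_upwards [h3, hsrc] with w hw1 hw2 hw3
    rw [he.mem_crit_iff hw2 (hs w.1).contMDiffAt] at hw3
    exact absurd hw3 hw1

theorem isClosed_crit (F : Foliation p q M) (hf : ContMDiff (𝓡 (p + q)) 𝓘(ℝ, ℝ) ∞ f) :
    IsClosed (F.crit f) := by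
  rw [← isOpen_compl_iff, isOpen_iff_mem_nhds]
  intro x hc
  set e := F.chartAt x
  have he : F.IsFoliatedChart e := isFoliatedChart_of_mem (F.chartAt_mem x)
  have hx : x ∈ e.source := F.mem_chartAt_source x
  rw [mem_compl_iff, he.mem_crit_iff hx hf.contMDiffAt] at hc
  have hs : ContDiffAt ℝ ∞ (f ∘ e.symm) (e x) :=
    he.comp_symm_mem_smoothAt hf _ (e.map_source hx)
  filter_upwards [(e.continuousAt hx).eventually (hs.lgrad.continuousAt.eventually_ne hc),
    e.open_source.mem_nhds hx] with y h1 h2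
  rw [mem_compl_iff, he.mem_crit_iff h2 hf.contMDiffAt]
  exact h1

theorem isClosed_crit_diff_morse (F : Foliation p q M)
    (hf : ContMDiff (𝓡 (p + q)) 𝓘(ℝ, ℝ) ∞ f) :
    IsClosed {x | x ∈ F.crit f ∧ ¬ F.IsMorsePoint f x} := by
  rw [← isOpen_compl_iff, isOpen_iff_mem_nhds]
  intro x hx
  have h0 : f + (0 : ℝ →ₗ[ℝ] (M → ℝ)) 0 = f := by simp
  -- With the zero family, stability in parameter and point reduces to stability in the point.
  have h := F.eventually_isMorsePoint (x := x) (V := ℝ) (Λ := 0) (c := 0) hf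
    (fun c => contMDiff_const) (by
      rw [h0]
      intro h1
      by_contra h2
      exact hx ⟨h1, h2⟩)
  have h2 := (continuousAt_const.prodMk continuousAt_id : ContinuousAt (fun y : M => ((0 : ℝ), y)) x).eventually h
  filter_upwards [h2] with y hy hy2
  simp only [LinearMap.zero_apply, add_zero] at hy
  exact hy2.2 (hy hy2.1)

end Foliation

end

/-! ### At most two critical points on each plaque -/

section

section

variable {X Y : Type*} [NormedAddCommGroup X] [InnerProductSpace ℝ X]
  [NormedAddCommGroup Y] [NormedSpace ℝ Y]

/-- Restriction of a bilinear map to the first factor. -/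
def bilinRestrict : (X × Y →L[ℝ] X × Y →L[ℝ] X) →L[ℝ] (X →L[ℝ] X →L[ℝ] X) :=
  (ContinuousLinearMap.postcomp X
    (ContinuousLinearMap.precomp X (ContinuousLinearMap.inl ℝ X Y))).comp
    (ContinuousLinearMap.precomp _ (ContinuousLinearMap.inl ℝ X Y))

theorem continuous_norm_sub_bilin (T₀ : X →L[ℝ] X →L[ℝ] X) :
    Continuous fun T : X →L[ℝ] X →L[ℝ] X => ‖T - T₀‖ :=
  (@continuous_norm (X →L[ℝ] X →L[ℝ] X) _).comp (continuous_id.sub continuous_const)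

theorem bilinRestrict_apply (T : X × Y →L[ℝ] X × Y →L[ℝ] X) (v w : X) :
    bilinRestrict T v w = T (v, 0) (w, 0) := by
  simp [bilinRestrict]

variable [FiniteDimensional ℝ X] {u : X × Y → ℝ} {x : X} {t : Y}

theorem hasFDerivAt_lgrad_leaf (h : ContDiffAt ℝ ∞ u (x, t)) :
    HasFDerivAt (fun y => lgrad u (y, t)) (lhess u (x, t)) x :=
  HasFDerivAt.comp (f := fun y => (y, t)) x (h.lgrad.differentiableAt (by simp)).hasFDerivAt
    (hasFDerivAt_prodMk_left (𝕜 := ℝ) x t)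

theorem hasFDerivAt_lhess_leaf (h : ContDiffAt ℝ ∞ u (x, t)) :
    HasFDerivAt (fun y => lhess u (y, t)) (bilinRestrict (fderiv ℝ (fderiv ℝ (lgrad u)) (x, t))) x := by
  have h1 : ContDiffAt ℝ ∞ (fderiv ℝ (lgrad u)) (x, t) := h.lgrad.fderiv_right (by simp)
  have h2 := HasFDerivAt.comp (f := fun y => (y, t)) x (h1.differentiableAt (by simp)).hasFDerivAt
    (hasFDerivAt_prodMk_left (𝕜 := ℝ) x t)
  exact (ContinuousLinearMap.precomp X (ContinuousLinearMap.inl ℝ X Y)).hasFDerivAt.comp x h2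

end

namespace Foliation

variable {p q : ℕ} {M : Type*} [TopologicalSpace M] [ChartedSpace (RSpace (p + q)) M]
  {F : Foliation p q M} {e : OpenPartialHomeomorph M (RSpace p × RSpace q)} {x : M} {f : M → ℝ}

/-- The closed box in the coordinate space. -/
def Box.closedBall (k : F.Box) : Set (RSpace p × RSpace q) :=
  Metric.closedBall k.a k.r ×ˢ Metric.closedBall k.b k.r

theorem Box.isCompact_closedBall (k : F.Box) : IsCompact k.closedBall :=
  (ProperSpace.isCompact_closedBall _ _).prod (ProperSpace.isCompact_closedBall _ _)

theorem Box.ball_subset_closedBall (k : F.Box) : k.ball ⊆ k.closedBall :=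
  prod_mono Metric.ball_subset_closedBall Metric.ball_subset_closedBall

theorem exists_box_forall (he : e ∈ F.charts) (hx : x ∈ e.source)
    {P : RSpace p × RSpace q → Prop} (hP : ∀ᶠ z in nhds (e x), P z) :
    ∃ k : F.Box, k.chart = e ∧ x ∈ k.dom ∧ ∀ z ∈ k.closedBall, P z := by
  obtain ⟨R, hR, hsub⟩ := Metric.nhds_basis_closedBall.eventually_iff.1 hP
  obtain ⟨k, hk, ha, hb, hr, hxk⟩ := exists_box F he hx hR
  refine ⟨k, hk, hxk, fun z hz => hsub ?_⟩
  have : k.closedBall = Metric.closedBall (k.a, k.b) k.r := closedBall_prod_same _ _ _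
  rw [this, ha, hb] at hz
  exact Metric.closedBall_subset_closedBall hr hz

theorem IsFoliatedChart.continuousAt_lhess_family {V : Type*} [NormedAddCommGroup V]
    [NormedSpace ℝ V] [FiniteDimensional ℝ V] {Λ : V →ₗ[ℝ] (M → ℝ)} (he : F.IsFoliatedChart e)
    (hf : ContMDiff (𝓡 (p + q)) 𝓘(ℝ, ℝ) ∞ f)
    (hΛ : ∀ c, ContMDiff (𝓡 (p + q)) 𝓘(ℝ, ℝ) ∞ (Λ c)) (c : V) {z : RSpace p × RSpace q}
    (hz : z ∈ e.target) :
    ContinuousAt (fun w : V × (RSpace p × RSpace q) => lhess ((f + Λ w.1) ∘ e.symm) w.2) (c, z) :=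
  (ContinuousLinearMap.precomp (RSpace p)
    (ContinuousLinearMap.inl ℝ (RSpace p) (RSpace q))).continuous.continuousAt.comp
    (he.continuousAt_fderiv_lgrad_family hf hΛ c hz)

theorem IsFoliatedChart.continuousAt_bilinRestrict_family {V : Type*} [NormedAddCommGroup V]
    [NormedSpace ℝ V] [FiniteDimensional ℝ V] {Λ : V →ₗ[ℝ] (M → ℝ)} (he : F.IsFoliatedChart e)
    (hf : ContMDiff (𝓡 (p + q)) 𝓘(ℝ, ℝ) ∞ f)
    (hΛ : ∀ c, ContMDiff (𝓡 (p + q)) 𝓘(ℝ, ℝ) ∞ (Λ c)) (c : V) {z : RSpace p × RSpace q}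
    (hz : z ∈ e.target) :
    ContinuousAt (fun w : V × (RSpace p × RSpace q) =>
      bilinRestrict (fderiv ℝ (fderiv ℝ (lgrad ((f + Λ w.1) ∘ e.symm))) w.2)) (c, z) :=
  bilinRestrict.continuous.continuousAt.comp
    (he.continuousAt_fderiv_fderiv_lgrad_family hf hΛ c hz)

/-- A function has at most two critical points on each plaque of the box. -/
def Box.AtMostTwo (k : F.Box) (f : M → ℝ) : Prop :=
  ∀ a ∈ F.crit f ∩ k.dom, ∀ b ∈ F.crit f ∩ k.dom, ∀ d ∈ F.crit f ∩ k.dom,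
    k.tr a = k.tr b → k.tr b = k.tr d → a = b ∨ b = d ∨ a = d

/-- Near a point that is not a degenerate critical point, except for birth-death points, a function
and its small perturbations have at most two critical points on each plaque. -/
theorem exists_box_atMostTwo (F : Foliation p q M) (hf : ContMDiff (𝓡 (p + q)) 𝓘(ℝ, ℝ) ∞ f)
    (h : x ∈ F.crit f → F.IsMorsePoint f x ∨ F.IsBirthDeath f x) :
    ∃ k : F.Box, x ∈ k.dom ∧ ∀ (V : Type) [NormedAddCommGroup V] [NormedSpace ℝ V]
      [FiniteDimensional ℝ V] (Λ : V →ₗ[ℝ] (M → ℝ)),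
      (∀ c, ContMDiff (𝓡 (p + q)) 𝓘(ℝ, ℝ) ∞ (Λ c)) → ∀ᶠ c in nhds 0, k.AtMostTwo (f + Λ c) := by
  have hm := F.chartAt_mem x
  have he : F.IsFoliatedChart (F.chartAt x) := isFoliatedChart_of_mem hm
  have hx : x ∈ (F.chartAt x).source := F.mem_chartAt_source x
  set e := F.chartAt x
  have hu : ContDiffAt ℝ ∞ (f ∘ e.symm) (e x) := he.comp_symm_mem_smoothAt hf _ (e.map_source hx)
  by_cases hc : x ∈ F.crit f
  · have hv := (he.morse_or_birthDeath_iff hx hf.contMDiffAt hc).1 (h hc)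
    obtain ⟨η, hη, key⟩ := exists_pos_at_most_two_zeros (H := lhess (f ∘ e.symm) (e x))
      (T := bilinRestrict (fderiv ℝ (fderiv ℝ (lgrad (f ∘ e.symm))) (e x))) (lhess_symm hu)
      (fun v w h1 h2 h3 => hv.kernel_le_one (by rw [← lhess_apply]; exact h1)
        (by rw [← lhess_apply]; exact h2) h3)
      (fun v h1 h2 => by
        rw [bilinRestrict_apply]
        exact (hv v h2).1.resolve_left fun h3 => h3 (by rw [← lhess_apply]; exact h1))
    have h0 : ∀ᶠ z in nhds (e x), ‖lhess (f ∘ e.symm) z - lhess (f ∘ e.symm) (e x)‖ < η ∧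
        ‖bilinRestrict (fderiv ℝ (fderiv ℝ (lgrad (f ∘ e.symm))) z) -
          bilinRestrict (fderiv ℝ (fderiv ℝ (lgrad (f ∘ e.symm))) (e x))‖ < η := by
      have e1 := he.continuousAt_lhess_family (V := ℝ) (Λ := 0) hf (fun _ => contMDiff_const) 0
        (e.map_source hx)
      have e2 := he.continuousAt_bilinRestrict_family (V := ℝ) (Λ := 0) hf
        (fun _ => contMDiff_const) 0 (e.map_source hx)
      simp only [LinearMap.zero_apply, add_zero] at e1 e2
      have hp : ContinuousAt (fun z => ((0 : ℝ), z)) (e x) := by fun_prop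
      have e1' := ((e1.comp_of_eq hp rfl).sub
        (continuousAt_const (y := lhess (f ∘ e.symm) (e x)))).norm
      have e2' := (continuous_norm_sub_bilin
        (bilinRestrict (fderiv ℝ (fderiv ℝ (lgrad (f ∘ e.symm))) (e x)))).continuousAt.comp
        (e2.comp_of_eq hp rfl)
      refine (e1'.eventually_lt continuousAt_const ?_).and (e2'.eventually_lt continuousAt_const ?_)
      · simpa using hη
      · simp only [Function.comp_apply, sub_self]
        exact (norm_zero (E := RSpace p →L[ℝ] RSpace p →L[ℝ] RSpace p)).trans_lt hη
    obtain ⟨k, hk, hxk, hkP⟩ := exists_box_forall hm hx h0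
    -- The box is fixed before the parameter space: the latter will be `Fin n → RSpace p` with `n`
    -- the number of boxes. Compactness of the closed box carries the closeness `η` from `f` over to
    -- all small perturbations.
    refine ⟨k, hxk, fun V _ _ _ Λ hΛ => ?_⟩
    have hs : ∀ c, ContMDiff (𝓡 (p + q)) 𝓘(ℝ, ℝ) ∞ (f + Λ c) := fun c => hf.add (hΛ c)
    have hT : k.closedBall ⊆ e.target := hk ▸ k.sub
    have hev : ∀ᶠ c in nhds (0 : V), ∀ z ∈ k.closedBall,
        ‖lhess ((f + Λ c) ∘ e.symm) z - lhess (f ∘ e.symm) (e x)‖ < η ∧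
        ‖bilinRestrict (fderiv ℝ (fderiv ℝ (lgrad ((f + Λ c) ∘ e.symm))) z) -
          bilinRestrict (fderiv ℝ (fderiv ℝ (lgrad (f ∘ e.symm))) (e x))‖ < η := by
      refine k.isCompact_closedBall.eventually_forall_of_forall_eventually fun z hz => ?_
      have e1 := ((he.continuousAt_lhess_family hf hΛ 0 (hT hz)).sub
        (continuousAt_const (y := lhess (f ∘ e.symm) (e x)))).norm
      have e2 := (continuous_norm_sub_bilin
        (bilinRestrict (fderiv ℝ (fderiv ℝ (lgrad (f ∘ e.symm))) (e x)))).continuousAt.comp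
        (he.continuousAt_bilinRestrict_family hf hΛ 0 (hT hz))
      have e3 := hkP z hz
      refine (e1.eventually_lt continuousAt_const ?_).and (e2.eventually_lt continuousAt_const ?_)
      · simpa using e3.1
      · simpa using e3.2
    filter_upwards [hev] with c hcl a ha b hb d hd hab hbd
    have hball : ∀ y ∈ Metric.ball k.a k.r, (y, k.tr a) ∈ k.closedBall := fun y hy =>
      k.ball_subset_closedBall ⟨hy, ha.2.2.2⟩
    have hsm : ∀ y ∈ Metric.ball k.a k.r, ContDiffAt ℝ ∞ ((f + Λ c) ∘ e.symm) (y, k.tr a) :=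
      fun y hy => he.comp_symm_mem_smoothAt (hs c) _ (hT (hball y hy))
    have hz : ∀ y ∈ F.crit (f + Λ c) ∩ k.dom, k.tr a = k.tr y →
        lgrad ((f + Λ c) ∘ e.symm) ((e y).1, k.tr a) = 0 := by
      intro y hy hay
      have h1 : y ∈ e.source := hk ▸ hy.2.1
      rw [hay, ← (he.mem_crit_iff h1 (hs c).contMDiffAt).1 hy.1, Box.tr, hk]
    have hmem : ∀ y ∈ k.dom, (e y).1 ∈ Metric.ball k.a k.r := fun y hy => hk ▸ hy.2.1
    have hinj : ∀ y ∈ k.dom, ∀ y' ∈ k.dom, k.tr y = k.tr y' → (e y).1 = (e y').1 → y = y' := by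
      intro y hy y' hy' h1 h2
      refine k.injOn_chart hy hy' (Prod.ext ?_ h1)
      rw [hk]; exact h2
    have := key (Metric.ball k.a k.r) (fun y => lgrad ((f + Λ c) ∘ e.symm) (y, k.tr a))
      (fun y => lhess ((f + Λ c) ∘ e.symm) (y, k.tr a))
      (fun y => bilinRestrict (fderiv ℝ (fderiv ℝ (lgrad ((f + Λ c) ∘ e.symm))) (y, k.tr a)))
      (convex_ball _ _) (fun y hy => hasFDerivAt_lgrad_leaf (hsm y hy))
      (fun y hy => hasFDerivAt_lhess_leaf (hsm y hy)) (fun y hy => (hcl _ (hball y hy)).1.le)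
      (fun y hy => (hcl _ (hball y hy)).2.le) _ (hmem a ha.2) _ (hmem b hb.2) _ (hmem d hd.2)
      (hz a ha rfl) (hz b hb hab) (hz d hd (hab.trans hbd))
    exact this.imp (hinj a ha.2 b hb.2 hab)
      (Or.imp (hinj b hb.2 d hd.2 hbd) (hinj a ha.2 d hd.2 (hab.trans hbd)))
  · rw [he.mem_crit_iff hx hf.contMDiffAt] at hc
    obtain ⟨k, hk, hxk, hkP⟩ := exists_box_forall hm hx (hu.lgrad.continuousAt.eventually_ne hc)
    refine ⟨k, hxk, fun V _ _ _ Λ hΛ => ?_⟩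
    have hs : ∀ c, ContMDiff (𝓡 (p + q)) 𝓘(ℝ, ℝ) ∞ (f + Λ c) := fun c => hf.add (hΛ c)
    have hT : k.closedBall ⊆ e.target := hk ▸ k.sub
    have hev : ∀ᶠ c in nhds (0 : V), ∀ z ∈ k.closedBall, lgrad ((f + Λ c) ∘ e.symm) z ≠ 0 := by
      refine k.isCompact_closedBall.eventually_forall_of_forall_eventually fun z hz => ?_
      refine (he.continuousAt_lgrad_family hf hΛ 0 (hT hz)).eventually_ne ?_
      simpa using hkP z hz
    filter_upwards [hev] with c hcl a ha
    have h1 : a ∈ e.source := hk ▸ ha.2.1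
    have h2 : e a ∈ k.closedBall := hk ▸ k.ball_subset_closedBall ha.2.2
    exact absurd ((he.mem_crit_iff h1 (hs c).contMDiffAt).1 ha.1) (hcl _ h2)

end Foliation

end

/-! ### Determinants and smallest singular values -/

section

theorem LinearMap.exists_norm_eq_singularValues {E : Type*} [NormedAddCommGroup E]
    [InnerProductSpace ℝ E] [FiniteDimensional ℝ E] (T : E →ₗ[ℝ] E) {n : ℕ}
    (hn : n < Module.finrank ℝ E) :
    ∃ v, v ≠ 0 ∧ inner ℝ (T v) (T v) = T.singularValues n ^ 2 * inner ℝ v v := by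
  obtain ⟨v, hv⟩ := (T.hasEigenvalue_adjoint_comp_self_sq_singularValues hn).exists_hasEigenvector
  refine ⟨v, hv.2, ?_⟩
  have h1 : LinearMap.adjoint T (T v) = (T.singularValues n ^ 2) • v := hv.apply_eq_smul
  rw [← LinearMap.adjoint_inner_left, h1, inner_smul_left]
  rfl

/-- A linear map with large determinant is bounded below. -/
theorem eventually_abs_det_mul_norm_le {n : ℕ} (L₀ : RSpace n →L[ℝ] RSpace n) :
    ∃ C > 0, ∀ᶠ L in nhds L₀, ∀ v, |L.det| * ‖v‖ ≤ C * ‖L v‖ := by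
  let b := (EuclideanSpace.basisFun (Fin n) ℝ).toBasis
  -- The adjugate satisfies `adj L ∘ L = det L • id` also for singular `L` and depends continuously
  -- on `L`, so its norm is locally bounded.
  let adj : (RSpace n →L[ℝ] RSpace n) → (RSpace n →L[ℝ] RSpace n) := fun L =>
    LinearMap.toContinuousLinearMap (Matrix.toLin b b (LinearMap.toMatrix b b L).adjugate)
  have hadj : Continuous adj := by
    let φ : Matrix (Fin n) (Fin n) ℝ →ₗ[ℝ] (RSpace n →L[ℝ] RSpace n) :=
      LinearMap.toContinuousLinearMap.toLinearMap ∘ₗ (Matrix.toLin b b).toLinearMap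
    let ψ : (RSpace n →L[ℝ] RSpace n) →ₗ[ℝ] Matrix (Fin n) (Fin n) ℝ :=
      (LinearMap.toMatrix b b).toLinearMap ∘ₗ LinearMap.toContinuousLinearMap.symm.toLinearMap
    have hφ : Continuous φ := φ.continuous_of_finiteDimensional
    have hψ : Continuous ψ := ψ.continuous_of_finiteDimensional
    exact hφ.comp hψ.matrix_adjugate
  have hmul : ∀ L v, adj L (L v) = L.det • v := by
    intro L v
    have h1 : Matrix.toLin b b (LinearMap.toMatrix b b L).adjugate ∘ₗ (L : RSpace n →ₗ[ℝ] RSpace n) =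
        L.det • LinearMap.id := by
      conv_lhs => rw [← Matrix.toLin_toMatrix b b (L : RSpace n →ₗ[ℝ] RSpace n)]
      rw [LinearMap.toMatrix_toLin, ← Matrix.toLin_mul, Matrix.adjugate_mul, map_smul,
        Matrix.toLin_one, LinearMap.det_toMatrix]
    exact congrArg (fun A => A v) h1
  refine ⟨‖adj L₀‖ + 1, by positivity, ?_⟩
  filter_upwards [hadj.norm.continuousAt.eventually_lt continuousAt_const
    (lt_add_one ‖adj L₀‖)] with L hL v
  calc |L.det| * ‖v‖ = ‖adj L (L v)‖ := by rw [hmul, norm_smul, Real.norm_eq_abs]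
    _ ≤ ‖adj L‖ * ‖L v‖ := (adj L).le_opNorm _
    _ ≤ _ := by gcongr

namespace Foliation

variable {p q : ℕ} {M : Type*} [TopologicalSpace M] [ChartedSpace (RSpace (p + q)) M]
  {F : Foliation p q M} {e : OpenPartialHomeomorph M (RSpace p × RSpace q)} {x : M} {f : M → ℝ}

theorem finrank_tangent (F : Foliation p q M) (x : M) : Module.finrank ℝ (F.tangent x) = p := by
  have he := isFoliatedChart_of_mem (F.chartAt_mem x)
  have hx := F.mem_chartAt_source x
  set e := F.chartAt x
  let φ : F.tangent x →ₗ[ℝ] RSpace p :=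
    LinearMap.fst ℝ _ _ ∘ₗ chartDeriv e x ∘ₗ (F.tangent x).subtype
  have hφ : Function.Bijective φ := by
    constructor
    · rw [injective_iff_map_eq_zero]
      intro v hv
      exact (he.fst_chartDeriv_eq_zero hx).1 hv
    · intro w
      obtain ⟨v, hv⟩ := he.exists_tangent hx w
      exact ⟨v, congrArg Prod.fst hv⟩
  rw [(LinearEquiv.ofBijective φ hφ).finrank_eq, finrank_euclideanSpace_fin]

variable [IsManifold (𝓡 (p + q)) ∞ M]

namespace EuclideanMetric

theorem form_hessEnd (g : F.EuclideanMetric) (f : M → ℝ) (x : M) (v w : F.tangent x) :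
    g.form x (g.hessEnd f x v) w = F.leafHess f x v w :=
  LinearMap.BilinForm.apply_toDual_symm_apply (hB := g.nondegenerate x) _ _

theorem exists_form_hessEnd_eq (g : F.EuclideanMetric) (f : M → ℝ) (x : M) {k : ℕ} (hk : k - 1 < p) :
    ∃ v, v ≠ 0 ∧ g.form x (g.hessEnd f x v) (g.hessEnd f x v) =
      g.singularValue f k x ^ 2 * g.form x v v := by
  let _ : NormedAddCommGroup (F.tangent x) := (g.core x).toNormedAddCommGroup
  let _ : InnerProductSpace ℝ (F.tangent x) := InnerProductSpace.ofCore (g.core x).toCore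
  exact (g.hessEnd f x).exists_norm_eq_singularValues (n := k - 1) (by rwa [finrank_tangent])

theorem singularValue_nonneg (g : F.EuclideanMetric) (f : M → ℝ) (x : M) (k : ℕ) :
    0 ≤ g.singularValue f k x := by
  let _ : NormedAddCommGroup (F.tangent x) := (g.core x).toNormedAddCommGroup
  let _ : InnerProductSpace ℝ (F.tangent x) := InnerProductSpace.ofCore (g.core x).toCore
  exact (g.hessEnd f x).singularValues_nonneg _

/-- Let `v` realize the singular value, let `a` be its coordinates, `b` the chart Hessian applied to
`a`, and `w` the leaf vector with coordinates `b`. Then `g(Av, w) = ‖b‖²` and `g(Av, Av) = σ² g(v,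
v)`, so Cauchy–Schwarz for `g` gives `‖b‖ ≤ C σ ‖a‖`, to be compared with `κ ‖a‖ ≤ ‖b‖`. -/
theorem le_mul_singularValue (g : F.EuclideanMetric) (he : F.IsFoliatedChart e) (hx : x ∈ e.source)
    (hf : ContMDiffAt (𝓡 (p + q)) 𝓘(ℝ, ℝ) ∞ f x) (hc : x ∈ F.crit f) {C κ : ℝ} (hC : 0 ≤ C)
    (hg : ∀ v : F.tangent x, g.form x v v ≤ C * ‖(chartDeriv e x v).1‖ ^ 2) (hκ : 0 < κ)
    (hL : ∀ v, κ * ‖v‖ ≤ ‖lhess (f ∘ e.symm) (e x) v‖) {k : ℕ} (hk : k - 1 < p) :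
    κ ≤ C * g.singularValue f k x := by
  obtain ⟨v, hv, hσ⟩ := g.exists_form_hessEnd_eq f x hk
  set σ := g.singularValue f k x
  have hσ0 : 0 ≤ σ := g.singularValue_nonneg f x k
  set a := (chartDeriv e x v).1
  have ha : 0 < ‖a‖ := norm_pos_iff.2 fun h => hv ((he.fst_chartDeriv_eq_zero hx).1 h)
  obtain ⟨w, hw⟩ := he.exists_tangent hx (lhess (f ∘ e.symm) (e x) a)
  set b := lhess (f ∘ e.symm) (e x) a
  have hb : 0 < ‖b‖ := (mul_pos hκ ha).trans_le (hL a)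
  have hw1 : (chartDeriv e x w).1 = b := by rw [hw]
  have h1 : g.form x (g.hessEnd f x v) w = ‖b‖ ^ 2 := by
    rw [g.form_hessEnd, he.leafHess_apply hx hf hc, hw1, real_inner_self_eq_norm_sq]
  have hpos : ∀ v, 0 ≤ g.form x v v := fun v => by
    by_cases h : v = 0
    · simp [h]
    · exact (g.pos x v h).le
  have hcs := LinearMap.BilinForm.apply_sq_le_of_symm (g.form x) hpos
    ⟨fun v w => g.symm x v w⟩ (g.hessEnd f x v) w
  rw [h1, hσ] at hcs
  have h2 := hg v
  have h3 := hg w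
  rw [hw1] at h3
  have h4 : (‖b‖ ^ 2) ^ 2 ≤ (C * σ * ‖a‖ * ‖b‖) ^ 2 := by
    calc (‖b‖ ^ 2) ^ 2 ≤ σ ^ 2 * g.form x v v * g.form x w w := hcs
      _ ≤ σ ^ 2 * (C * ‖a‖ ^ 2) * (C * ‖b‖ ^ 2) := by
        have := hpos w
        gcongr
      _ = _ := by ring
  have h5 : ‖b‖ ^ 2 ≤ C * σ * ‖a‖ * ‖b‖ := le_of_sq_le_sq h4 (by positivity)
  have h6 : ‖b‖ ≤ C * σ * ‖a‖ := by
    rw [pow_two] at h5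
    exact le_of_mul_le_mul_right h5 hb
  exact le_of_mul_le_mul_right ((hL a).trans h6) ha

end EuclideanMetric

/-- The section of the tangent bundle of the leaves with constant coordinates. -/
def IsFoliatedChart.constSection (he : F.IsFoliatedChart e) (w : RSpace p) (x : M) : F.tangent x :=
  open Classical in if hx : x ∈ e.source then (he.exists_tangent hx w).choose else 0

theorem IsFoliatedChart.chartDeriv_constSection (he : F.IsFoliatedChart e) (w : RSpace p)
    (hx : x ∈ e.source) : chartDeriv e x (he.constSection w x) = (w, 0) := by
  rw [constSection, dif_pos hx]
  exact (he.exists_tangent hx w).choose_spec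

theorem _root_.IsSmoothChart.chartDeriv_mfderiv_symm (he : IsSmoothChart e) {x : M} (hx : x ∈ e.source)
    (w : RSpace p × RSpace q) :
    chartDeriv e x (mfderiv 𝓘(ℝ, RSpace p × RSpace q) (𝓡 (p + q)) e.symm (e x) w :
      RSpace (p + q)) = w := by
  have hd' : MDifferentiableAt 𝓘(ℝ, RSpace p × RSpace q) (𝓡 (p + q)) e.symm (e x) :=
    (he.contMDiffAt_symm (e.map_source hx)).mdifferentiableAt (by simp)
  have h2 : e ∘ e.symm =ᶠ[nhds (e x)] id := by
    filter_upwards [e.open_target.mem_nhds (e.map_source hx)] with y hy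
    simp [e.right_inv hy]
  have hdx : MDifferentiableAt (𝓡 (p + q)) 𝓘(ℝ, RSpace p × RSpace q) e (e.symm (e x)) := by
    rw [e.left_inv hx]; exact he.mdifferentiableAt hx
  have h4 := h2.mfderiv_eq (I := 𝓘(ℝ, RSpace p × RSpace q)) (I' := 𝓘(ℝ, RSpace p × RSpace q))
  rw [mfderiv_comp (e x) hdx hd', mfderiv_id] at h4
  have hz := congrArg (fun L => L w) h4
  rw [e.left_inv hx] at hz
  exact hz

/-- Smoothness of the metric can be tested only on smooth sections. This one is the image of a
constant vector field under the inverse chart. -/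
theorem IsFoliatedChart.contMDiffOn_constSection (he : F.IsFoliatedChart e) (w : RSpace p) :
    ContMDiffOn (𝓡 (p + q)) (𝓡 (p + q)).tangent ∞
      (fun x => (⟨x, (he.constSection w x : TangentSpace (𝓡 (p + q)) x)⟩ :
        TangentBundle (𝓡 (p + q)) M)) e.source := by
  have h1 : ContMDiff 𝓘(ℝ, RSpace p × RSpace q) 𝓘(ℝ, RSpace p × RSpace q).tangent ∞
      (fun z : RSpace p × RSpace q => (⟨z, ((w, 0) : RSpace p × RSpace q)⟩ :
        TangentBundle 𝓘(ℝ, RSpace p × RSpace q) (RSpace p × RSpace q))) := fun z =>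
    contMDiffAt_vectorSpace_iff_contDiffAt.2 contDiffAt_const
  have h2 := he.1.2.contMDiffOn_tangentMapWithin (m := ∞) (by simp) e.open_target.uniqueMDiffOn
  have h3 := h2.comp (h1.comp_contMDiffOn he.1.1) (fun x hx => e.map_source hx)
  refine h3.congr fun x hx => ?_
  refine Bundle.TotalSpace.ext (e.left_inv hx).symm ?_
  have h4 : mfderiv 𝓘(ℝ, RSpace p × RSpace q) (𝓡 (p + q)) e.symm (e x)
      ((w, 0) : RSpace p × RSpace q) =
      ((he.constSection w x : TangentSpace (𝓡 (p + q)) x) : RSpace (p + q)) := by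
    refine (he.1.chartDeriv_bijective hx).1 ?_
    rw [he.chartDeriv_constSection w hx]
    exact he.1.chartDeriv_mfderiv_symm hx (w, 0)
  have h5 : mfderivWithin 𝓘(ℝ, RSpace p × RSpace q) (𝓡 (p + q)) e.symm e.target (e x) =
      mfderiv 𝓘(ℝ, RSpace p × RSpace q) (𝓡 (p + q)) e.symm (e x) :=
    mfderivWithin_of_isOpen e.open_target (e.map_source hx)
  refine heq_of_eq ?_
  change _ = mfderivWithin 𝓘(ℝ, RSpace p × RSpace q) (𝓡 (p + q)) e.symm e.target (e x)
    ((w, 0) : RSpace p × RSpace q)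
  rw [h5]
  exact h4.symm

/-- In a chart a Euclidean metric is locally bounded by a multiple of the standard one. -/
theorem EuclideanMetric.eventually_form_le (g : F.EuclideanMetric) (he : F.IsFoliatedChart e)
    (hx : x ∈ e.source) : ∃ C > 0, ∀ᶠ y in nhds x, ∀ v : F.tangent y,
      g.form y v v ≤ C * ‖(chartDeriv e y v).1‖ ^ 2 := by
  let b := EuclideanSpace.basisFun (Fin p) ℝ
  let s : Fin p → ∀ y, F.tangent y := fun i => he.constSection (b i)
  have hc : ∀ i j, ContinuousAt (fun y => g.form y (s i y) (s j y)) x := fun i j =>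
    ((g.smooth e.source e.open_source (s i) (s j) (he.contMDiffOn_constSection _)
      (he.contMDiffOn_constSection _)).contMDiffAt (e.open_source.mem_nhds hx)).continuousAt
  have hc2 : ContinuousAt (fun y => ∑ i, ∑ j, |g.form y (s i y) (s j y)|) x := by
    refine tendsto_finsetSum _ fun i _ => tendsto_finsetSum _ fun j _ => (hc i j).abs
  refine ⟨(∑ i, ∑ j, |g.form x (s i x) (s j x)|) + 1, by positivity, ?_⟩
  filter_upwards [hc2.eventually_lt continuousAt_const (lt_add_one _),
    e.open_source.mem_nhds hx] with y hy hys v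
  set a := (chartDeriv e y v).1
  have hv : v = ∑ i, a i • s i y := by
    have h1 : (chartDeriv e y ((v - ∑ i, a i • s i y : F.tangent y) :
        TangentSpace (𝓡 (p + q)) y)).1 = 0 := by
      have h2 : ∀ i, (chartDeriv e y (s i y)).1 = b i := fun i => by
        rw [he.chartDeriv_constSection _ hys]
      rw [Submodule.coe_sub, Submodule.coe_sum, map_sub, map_sum, Prod.fst_sub, Prod.fst_sum]
      simp only [Submodule.coe_smul, map_smul, Prod.smul_fst, h2]
      rw [sub_eq_zero]
      exact (b.sum_repr a).symm
    exact sub_eq_zero.1 ((he.fst_chartDeriv_eq_zero hys).1 h1)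
  have hai : ∀ i, |a i| ≤ ‖a‖ := fun i => by
    rw [← Real.norm_eq_abs]; exact PiLp.norm_apply_le a i
  calc g.form y v v = ∑ i, ∑ j, a i * a j * g.form y (s i y) (s j y) := by
        conv_lhs => rw [hv]
        simp only [map_sum, LinearMap.sum_apply, map_smul, LinearMap.smul_apply, smul_eq_mul,
          Finset.mul_sum]
        rw [Finset.sum_comm]
        refine Finset.sum_congr rfl fun i _ => Finset.sum_congr rfl fun j _ => by ring
    _ ≤ ∑ i, ∑ j, ‖a‖ ^ 2 * |g.form y (s i y) (s j y)| := by
        refine Finset.sum_le_sum fun i _ => Finset.sum_le_sum fun j _ => ?_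
        refine (le_abs_self _).trans ?_
        rw [abs_mul, abs_mul, pow_two]
        gcongr
        · exact hai i
        · exact hai j
    _ = (∑ i, ∑ j, |g.form y (s i y) (s j y)|) * ‖a‖ ^ 2 := by
        simp only [← Finset.mul_sum]
        ring
    _ ≤ _ := by gcongr

end Foliation

end

/-! ### Generic parameters: Sard's theorem and the area formula -/

section

/-- Such a set is discrete, hence countable by the Lindelöf property; this will be applied to
nondegenerate zeros. -/
theorem Set.countable_of_forall_eventually_notMem {X : Type*} [TopologicalSpace X]
    [SecondCountableTopology X] {E : Set X} (h : ∀ x ∈ E, ∀ᶠ y in nhdsWithin x {x}ᶜ, y ∉ E) :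
    E.Countable := by
  have hd : DiscreteTopology E := by
    rw [discreteTopology_subtype_iff]
    intro x hx
    rw [← disjoint_iff, Filter.disjoint_principal_right]
    exact h x hx
  exact countable_of_Lindelof_of_discrete

/-- A family of maps, parametrized by a vector space, in which certain translations of the
parameter change the maps by a constant. -/
structure IsTranslationFamily {X Y V : Type*} [NormedAddCommGroup X] [NormedSpace ℝ X]
    [TopologicalSpace Y] [NormedAddCommGroup V] [NormedSpace ℝ V] (Q : Set (X × Y))
    (L : X →ₗ[ℝ] V) (G : V → X × Y → X) (D : V → X × Y → X →L[ℝ] X) : Prop where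
  isCompact : IsCompact Q
  continuousOn : ContinuousOn (fun w : (X × Y) × V => G w.2 w.1) (Q ×ˢ univ)
  continuousOn_deriv : ContinuousOn (fun w : (X × Y) × V => D w.2 w.1) (Q ×ˢ univ)
  hasFDerivAt : ∀ c x t, (x, t) ∈ Q → HasFDerivAt (fun y => G c (y, t)) (D c (x, t)) x
  add : ∀ c a, ∀ z ∈ Q, G (c + L a) z = G c z - a
  add_deriv : ∀ c a, ∀ z ∈ Q, D (c + L a) z = D c z

namespace IsTranslationFamily

variable {X Y V : Type*} [NormedAddCommGroup X] [NormedSpace ℝ X] [FiniteDimensional ℝ X]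
  [MeasurableSpace X] [BorelSpace X] [TopologicalSpace Y] [PolishSpace Y] [MeasurableSpace Y]
  [BorelSpace Y] [NormedAddCommGroup V] [NormedSpace ℝ V] [FiniteDimensional ℝ V]
  [MeasurableSpace V] [BorelSpace V] {Q : Set (X × Y)} {L : X →ₗ[ℝ] V} {G : V → X × Y → X}
  {D : V → X × Y → X →L[ℝ] X}

theorem isClosed_zeros (h : IsTranslationFamily Q L G D) :
    IsClosed {w : (X × Y) × V | w.1 ∈ Q ∧ G w.2 w.1 = 0} := by
  have h1 := h.continuousOn.preimage_isClosed_of_isClosed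
    (h.isCompact.isClosed.prod isClosed_univ) (isClosed_singleton (x := (0 : X)))
  convert! h1 using 1
  ext w
  simp

theorem isClosed_det_zeros (h : IsTranslationFamily Q L G D) :
    IsClosed {w : (X × Y) × V | w.1 ∈ Q ∧ G w.2 w.1 = 0 ∧ (D w.2 w.1).det = 0} := by
  have hd : ContinuousOn (fun w : (X × Y) × V => (D w.2 w.1).det) (Q ×ˢ univ) :=
    ContinuousLinearMap.continuous_det.comp_continuousOn h.continuousOn_deriv
  have h1 := (h.continuousOn.prodMk hd).preimage_isClosed_of_isClosed
    (h.isCompact.isClosed.prod isClosed_univ) (isClosed_singleton (x := ((0 : X), (0 : ℝ))))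
  convert! h1 using 1
  ext w
  simp [Prod.ext_iff]

/-- For almost every parameter the projection of the set of degenerate zeros is negligible. -/
theorem ae_measure_eq_zero (h : IsTranslationFamily Q L G D) (μ : Measure Y) [IsFiniteMeasure μ]
    (ν : Measure V) [ν.IsAddHaarMeasure] :
    ∀ᵐ c ∂ν, μ {t | ∃ x, (x, t) ∈ Q ∧ G c (x, t) = 0 ∧ (D c (x, t)).det = 0} = 0 := by
  set Z := {w : (X × Y) × V | w.1 ∈ Q ∧ G w.2 w.1 = 0 ∧ (D w.2 w.1).det = 0} with hZ
  set π : (X × Y) × V → Y × V := fun w => (w.1.2, w.2)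
  have hπ : Continuous π := by fun_prop
  -- `Z` is a countable union of compact sets, so its projection is Borel and not merely analytic.
  have hY : MeasurableSet (π '' Z) := by
    have h1 : Z = ⋃ n : ℕ, Z ∩ (Q ×ˢ Metric.closedBall 0 n) := by
      ext w
      simp only [mem_iUnion, mem_inter_iff]
      constructor
      · intro hw
        obtain ⟨n, hn⟩ := exists_nat_ge ‖w.2‖
        exact ⟨n, hw, hw.1, by simpa using hn⟩
      · rintro ⟨n, hw, -⟩
        exact hw
    rw [h1, image_iUnion]
    refine MeasurableSet.iUnion fun n => IsCompact.measurableSet ?_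
    exact ((h.isCompact.prod (isCompact_closedBall _ _)).inter_left h.isClosed_det_zeros).image hπ
  have hA : MeasurableSet {c : V | μ {t | (t, c) ∈ π '' Z} = 0} :=
    measurable_measure_prodMk_right hY (measurableSet_singleton 0)
  -- It suffices to prove the claim almost everywhere on each translate `c + L a`, and Fubini allows
  -- fixing `t` first.
  have key : ∀ c : V, ∀ᵐ a ∂(Measure.addHaar : Measure X), c + L a ∈ {c : V | μ {t | (t, c) ∈ π '' Z} = 0} := by
    intro c
    have hm : Measurable fun w : X × Y => (w.2, c + L w.1) := by
      have := L.continuous_of_finiteDimensional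
      exact (by fun_prop : Continuous fun w : X × Y => (w.2, c + L w.1)).measurable
    have h1 : ∀ᵐ a ∂(Measure.addHaar : Measure X), ∀ᵐ t ∂μ, (t, c + L a) ∉ π '' Z := by
      rw [Measure.ae_ae_comm (p := fun a t => (t, c + L a) ∉ π '' Z) (hm hY.compl)]
      refine Filter.Eventually.of_forall fun t => ?_
      -- For fixed `t` the bad values of `a` are critical values of `G c (·, t)`, since `G (c + L a)
      -- = G c - a`. Sard's theorem for maps between spaces of equal dimension applies.
      have h2 : (Measure.addHaar : Measure X) ((fun x => G c (x, t)) ''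
          {x | (x, t) ∈ Q ∧ (D c (x, t)).det = 0}) = 0 :=
        addHaar_image_eq_zero_of_det_fderivWithin_eq_zero _
          (fun x hx => (h.hasFDerivAt c x t hx.1).hasFDerivWithinAt) (fun x hx => hx.2)
      refine measure_mono_null ?_ h2
      rintro a ha
      simp only [mem_compl_iff, mem_ofPred, not_not] at ha
      obtain ⟨⟨⟨x, t'⟩, c'⟩, ⟨hx1, hx2, hx3⟩, hx4⟩ := ha
      simp only [π, Prod.mk.injEq] at hx4
      obtain ⟨rfl, rfl⟩ := hx4
      simp only [h.add c a _ hx1, h.add_deriv c a _ hx1] at hx2 hx3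
      exact ⟨x, ⟨hx1, hx3⟩, sub_eq_zero.1 hx2⟩
    filter_upwards [h1] with a ha
    rw [ae_iff] at ha
    simpa using ha
  filter_upwards [ae_mem_of_ae_add_linearMap_mem L Measure.addHaar ν hA key] with c hc
  refine measure_mono_null ?_ hc
  rintro t ⟨x, hx⟩
  exact ⟨((x, t), c), hx, rfl⟩

/-- For almost every parameter the sum of the inverses of the Jacobians over the zeros is
integrable in the remaining variable. -/
theorem ae_exists_lintegral_lt_top (h : IsTranslationFamily Q L G D) (μ : Measure Y)
    [IsFiniteMeasure μ] (ν : Measure V) [ν.IsAddHaarMeasure] :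
    ∀ᵐ c ∂ν, ∃ (E : ℕ → Set (X × Y)) (g : ℕ → Y → ℝ≥0∞), (∀ n, MeasurableSet (E n)) ∧
      (∀ n, InjOn Prod.snd (E n)) ∧ (∀ n, Measurable (g n)) ∧
      (⋃ n, E n) = {z | z ∈ Q ∧ G c z = 0 ∧ (D c z).det ≠ 0} ∧
      (∀ n, ∀ z ∈ E n, g n z.2 = (ENNReal.ofReal |(D c z).det|)⁻¹) ∧
      ∑' n, ∫⁻ t, g n t ∂μ < ⊤ := by
  set S := {w : (X × Y) × V | w.1 ∈ Q ∧ G w.2 w.1 = 0 ∧ (D w.2 w.1).det ≠ 0} with hS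
  set π : (X × Y) × V → Y × V := fun w => (w.1.2, w.2)
  have hπ : Continuous π := by fun_prop
  have hSm : MeasurableSet S := by
    have h1 := h.isClosed_zeros.measurableSet.diff h.isClosed_det_zeros.measurableSet
    convert! h1 using 1
    ext w
    simp only [hS, mem_ofPred, mem_sdiff]
    tauto
  -- Nondegenerate zeros are isolated, so there are countably many for each `(t, c)`, and
  -- Lusin–Novikov cuts `S` into Borel sheets on which the zero is determined by `(t, c)`.
  have hcount : ∀ y, (S ∩ π ⁻¹' {y}).Countable := by
    rintro ⟨t, c⟩
    have h1 : {x | (x, t) ∈ Q ∧ G c (x, t) = 0 ∧ (D c (x, t)).det ≠ 0}.Countable := by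
      refine countable_of_forall_eventually_notMem fun x hx => ?_
      have h2 := (h.hasFDerivAt c x t hx.1).eventually_ne (c := 0)
        ⟨_, ((D c (x, t)).toContinuousLinearEquivOfDetNeZero hx.2.2).antilipschitz⟩
      exact h2.mono fun y hy hy2 => hy hy2.2.1
    refine (h1.image fun x => ((x, t), c)).mono ?_
    rintro ⟨⟨x, t'⟩, c'⟩ ⟨hx, hy⟩
    simp only [π, mem_preimage, mem_singleton_iff, Prod.mk.injEq] at hy
    obtain ⟨rfl, rfl⟩ := hy
    exact ⟨x, hx, rfl⟩
  obtain ⟨R, hR, hRi, hRd, hRS⟩ := hSm.exists_iUnion_injOn (π := π)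
    (hπ.measurable.comp measurable_subtype_coe) hcount
  have hRsub : ∀ n, R n ⊆ S := fun n => hRS ▸ subset_iUnion R n
  have hemb : ∀ n, MeasurableEmbedding (fun w : R n => π w) := fun n => by
    have := (hR n).standardBorel
    exact (hπ.measurable.comp measurable_subtype_coe).measurableEmbedding (hRi n).injective
  let φ : ∀ n, R n → ℝ≥0∞ := fun n w => (ENNReal.ofReal |(D w.1.2 w.1.1).det|)⁻¹
  have hφ : ∀ n, Measurable (φ n) := fun n => by
    have hd : ContinuousOn (fun w : (X × Y) × V => (D w.2 w.1).det) (R n) :=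
      ContinuousLinearMap.continuous_det.comp_continuousOn
        (h.continuousOn_deriv.mono fun w hw => ⟨(hRsub n hw).1, mem_univ _⟩)
    have h1 := (continuousOn_iff_continuous_domRestrict.1 hd).measurable
    exact h1.abs.ennreal_ofReal.inv
  -- The weight `1 / |det|` of the zero on the `n`-th sheet, as a function of `(t, c)`, with value 0
  -- where the sheet has no zero.
  let g : ℕ → Y × V → ℝ≥0∞ := fun n => Function.extend (fun w : R n => π w) (φ n) 0
  have hg : ∀ n, Measurable (g n) := fun n => (hemb n).measurable_extend (hφ n) measurable_zero
  have hgR : ∀ n, ∀ w ∈ R n, g n (π w) = (ENNReal.ofReal |(D w.2 w.1).det|)⁻¹ := fun n w hw =>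
    (hemb n).injective.extend_apply (φ n) 0 ⟨w, hw⟩
  have hg0 : ∀ n y, y ∉ π '' R n → g n y = 0 := fun n y hy => by
    refine Function.extend_apply' _ _ _ ?_
    rintro ⟨w, hw⟩
    exact hy ⟨w, w.2, hw⟩
  have hA : MeasurableSet {c : V | ∑' n, ∫⁻ t, g n (t, c) ∂μ < ⊤} := by
    have h1 : Measurable fun c => ∑' n, ∫⁻ t, g n (t, c) ∂μ :=
      Measurable.tsum fun n => (hg n).lintegral_prod_left'
    exact h1 measurableSet_Iio
  set lX : Measure X := Measure.addHaar
  have key : ∀ c : V, ∀ᵐ a ∂lX, c + L a ∈ {c : V | ∑' n, ∫⁻ t, g n (t, c) ∂μ < ⊤} := by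
    intro c
    have hL := L.continuous_of_finiteDimensional
    have hm : Measurable fun w : X × Y => (w.2, c + L w.1) :=
      (by fun_prop : Continuous fun w : X × Y => (w.2, c + L w.1)).measurable
    have hm1 : ∀ n, Measurable fun w : X × Y => g n (w.2, c + L w.1) := fun n => (hg n).comp hm
    have hin : ∀ t, ∑' n, ∫⁻ a, g n (t, c + L a) ∂lX ≤ lX (Prod.fst '' Q) := by
      intro t
      -- A point `x` of the slice is a zero for the single translate `a = G c (x, t)`; `T n`
      -- collects those whose zero belongs to the `n`-th sheet. These sets are disjoint, and `G c
      -- (·, t)` is injective on each.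
      let T : ℕ → Set X := fun n =>
        {x | (x, t) ∈ Q} ∩ (fun x => ((x, t), c + L (G c (x, t)))) ⁻¹' R n
      have hslice : IsClosed {x | (x, t) ∈ Q} :=
        h.isCompact.isClosed.preimage (by fun_prop : Continuous fun x : X => (x, t))
      have hcG : ContinuousOn (fun x => G c (x, t)) {x | (x, t) ∈ Q} :=
        h.continuousOn.comp (f := fun x => ((x, t), c)) (by fun_prop) fun x hx => ⟨hx, mem_univ _⟩
      have hT : ∀ n, MeasurableSet (T n) := fun n => by
        refine ContinuousOn.measurableSet_inter_preimage ?_ hslice.measurableSet (hR n)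
        exact (by fun_prop : Continuous fun x : X => (x, t)).continuousOn.prodMk
          (continuousOn_const.add (hL.comp_continuousOn hcG))
      have hTd : Pairwise (fun m n => Disjoint (T m) (T n)) := fun m n hmn =>
        ((hRd hmn).preimage _).mono inter_subset_right inter_subset_right
      have hTi : ∀ n, InjOn (fun x => G c (x, t)) (T n) := by
        intro n x hx y hy hxy
        have hxy' : G c (x, t) = G c (y, t) := hxy
        have := hRi n hx.2 hy.2 (by simp only [π, hxy'])
        exact congrArg (fun w => w.1.1) this
      -- After the change of variables `a = G c (x, t)` the Jacobian cancels the weight, which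
      -- leaves the volume of `T n`.
      have hint : ∀ n, ∫⁻ a, g n (t, c + L a) ∂lX = lX (T n) := by
        intro n
        have h1 : ∀ a, a ∉ (fun x => G c (x, t)) '' T n → g n (t, c + L a) = 0 := by
          intro a ha
          refine hg0 n _ fun hy => ha ?_
          obtain ⟨⟨⟨x, t'⟩, c'⟩, hx, hy⟩ := hy
          simp only [π, Prod.mk.injEq] at hy
          obtain ⟨rfl, rfl⟩ := hy
          have hxS := hRsub n hx
          have hG := hxS.2.1
          simp only [h.add c a _ hxS.1] at hG
          have hG' := sub_eq_zero.1 hG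
          refine ⟨x, ⟨hxS.1, ?_⟩, hG'⟩
          rw [mem_preimage, hG']
          exact hx
        have h2 : MeasurableSet ((fun x => G c (x, t)) '' T n) :=
          measurable_image_of_fderivWithin (hT n)
            (fun x hx => (h.hasFDerivAt c x t hx.1).hasFDerivWithinAt) (hTi n)
        rw [← lintegral_add_compl _ h2,
          setLIntegral_congr_fun h2.compl (g := fun _ => 0) (fun a ha => h1 a ha), lintegral_zero,
          add_zero, lintegral_image_eq_lintegral_abs_det_fderiv_mul lX (hT n)
            (fun x hx => (h.hasFDerivAt c x t hx.1).hasFDerivWithinAt) (hTi n),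
          setLIntegral_congr_fun (hT n) (g := fun _ => 1), setLIntegral_one]
        intro x hx
        have h3 := hgR n _ hx.2
        have h4 := (hRsub n hx.2).2.2
        simp only [π, h.add_deriv c _ _ hx.1] at h3 h4
        dsimp only
        rw [h3]
        refine ENNReal.mul_inv_cancel ?_ ENNReal.ofReal_ne_top
        simpa using h4
      calc ∑' n, ∫⁻ a, g n (t, c + L a) ∂lX = ∑' n, lX (T n) := by simp only [hint]
        _ = lX (⋃ n, T n) := (measure_iUnion hTd hT).symm
        _ ≤ _ := by
          refine measure_mono (iUnion_subset fun n x hx => ⟨(x, t), hx.1, rfl⟩)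
    have hfin : ∫⁻ a, ∑' n, ∫⁻ t, g n (t, c + L a) ∂μ ∂lX < ⊤ := by
      calc ∫⁻ a, ∑' n, ∫⁻ t, g n (t, c + L a) ∂μ ∂lX
          = ∫⁻ a, ∫⁻ t, ∑' n, g n (t, c + L a) ∂μ ∂lX := by
            refine lintegral_congr fun a => ?_
            exact (lintegral_tsum fun n => ((hm1 n).comp measurable_prodMk_left).aemeasurable).symm
        _ = ∫⁻ t, ∫⁻ a, ∑' n, g n (t, c + L a) ∂lX ∂μ := by
            refine lintegral_lintegral_swap ?_
            exact (Measurable.tsum hm1).aemeasurable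
        _ = ∫⁻ t, ∑' n, ∫⁻ a, g n (t, c + L a) ∂lX ∂μ := by
            refine lintegral_congr fun t => ?_
            exact lintegral_tsum fun n => ((hm1 n).comp measurable_prodMk_right).aemeasurable
        _ ≤ ∫⁻ _, lX (Prod.fst '' Q) ∂μ := lintegral_mono hin
        _ < ⊤ := by
            rw [lintegral_const]
            exact ENNReal.mul_lt_top (h.isCompact.image continuous_fst).measure_lt_top
              (measure_lt_top _ _)
    have hmeas : Measurable fun a => ∑' n, ∫⁻ t, g n (t, c + L a) ∂μ :=
      Measurable.tsum fun n => (hm1 n).lintegral_prod_right'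
    exact ae_lt_top hmeas hfin.ne
  filter_upwards [ae_mem_of_ae_add_linearMap_mem L lX ν hA key] with c hc
  have hsec : Measurable fun z : X × Y => (z, c) := measurable_prodMk_right
  refine ⟨fun n => (fun z => (z, c)) ⁻¹' R n, fun n t => g n (t, c), fun n => hsec (hR n), ?_,
    fun n => (hg n).comp measurable_prodMk_right, ?_, ?_, hc⟩
  · intro n z hz z' hz' hzz
    exact congrArg Prod.fst (hRi n hz hz' (by simp only [π, hzz]))
  · rw [← preimage_iUnion, hRS]
    rfl
  · intro n z hz
    exact hgR n _ hz

end IsTranslationFamily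

end

/-! ### Finiteness, integrability and null saturations -/

section

theorem ContinuousLinearMap.det_ne_zero_iff {X : Type*} [NormedAddCommGroup X] [NormedSpace ℝ X]
    [FiniteDimensional ℝ X] (L : X →L[ℝ] X) : L.det ≠ 0 ↔ ∀ v, v ≠ 0 → L v ≠ 0 := by
  have h : L.det ≠ 0 ↔ LinearMap.ker (L : X →ₗ[ℝ] X) = ⊥ := by
    rw [ContinuousLinearMap.det, ← isUnit_iff_ne_zero, ← LinearMap.isUnit_iff_isUnit_det,
      LinearMap.isUnit_iff_ker_eq_bot]
  rw [h, LinearMap.ker_eq_bot']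
  exact forall_congr' fun v => ⟨fun h1 h2 h3 => h2 (h1 h3), fun h1 h2 => by
    by_contra h3; exact h1 h3 h2⟩

namespace Foliation

variable {p q : ℕ} {M : Type*} [TopologicalSpace M] [ChartedSpace (RSpace (p + q)) M]
  {F : Foliation p q M} {e : OpenPartialHomeomorph M (RSpace p × RSpace q)} {x : M} {h : M → ℝ}

theorem IsFoliatedChart.isMorsePoint_iff_det (he : F.IsFoliatedChart e) (hx : x ∈ e.source)
    (hh : ContMDiffAt (𝓡 (p + q)) 𝓘(ℝ, ℝ) ∞ h x) (hc : x ∈ F.crit h) :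
    F.IsMorsePoint h x ↔ (lhess (h ∘ e.symm) (e x)).det ≠ 0 := by
  rw [he.isMorsePoint_iff hx hh hc, ContinuousLinearMap.det_ne_zero_iff]

theorem IsFoliatedChart.continuousAt_lhess (he : F.IsFoliatedChart e)
    (hh : ContMDiff (𝓡 (p + q)) 𝓘(ℝ, ℝ) ∞ h) (hx : x ∈ e.source) :
    ContinuousAt (fun y => lhess (h ∘ e.symm) (e y)) x := by
  have h1 : ContDiffAt ℝ ∞ (h ∘ e.symm) (e x) :=
    he.comp_symm_mem_smoothAt hh _ (e.map_source hx)
  have h2 : ContDiffAt ℝ ∞ (fderiv ℝ (lgrad (h ∘ e.symm))) (e x) := h1.lgrad.fderiv_right (by simp)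
  exact (ContinuousLinearMap.precomp (RSpace p)
    (ContinuousLinearMap.inl ℝ (RSpace p) (RSpace q))).continuous.continuousAt.comp
    (h2.continuousAt.comp (e.continuousAt hx))

/-- The determinant of the Hessian in a chart is locally bounded by a multiple of the smallest
singular value. -/
theorem EuclideanMetric.eventually_abs_det_le [IsManifold (𝓡 (p + q)) ∞ M] (hp : 1 ≤ p)
    (g : F.EuclideanMetric) (he : F.IsFoliatedChart e)
    (hh : ContMDiff (𝓡 (p + q)) 𝓘(ℝ, ℝ) ∞ h) (hx : x ∈ e.source) :
    ∃ C > 0, ∀ᶠ y in nhds x, y ∈ F.crit h →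
      |(lhess (h ∘ e.symm) (e y)).det| ≤ C * g.singularValue h p y := by
  obtain ⟨C₁, hC₁, h1⟩ := g.eventually_form_le he hx
  obtain ⟨C₂, hC₂, h2⟩ := eventually_abs_det_mul_norm_le (lhess (h ∘ e.symm) (e x))
  refine ⟨C₁ * C₂, by positivity, ?_⟩
  filter_upwards [h1, (he.continuousAt_lhess hh hx).eventually h2, e.open_source.mem_nhds hx]
    with y hy1 hy2 hy3 hc
  set d := |(lhess (h ∘ e.symm) (e y)).det| with hd
  have hσ := g.singularValue_nonneg h y p
  rcases (abs_nonneg (lhess (h ∘ e.symm) (e y)).det).eq_or_lt with h0 | h0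
  · rw [hd, ← h0]
    positivity
  · have h3 := g.le_mul_singularValue he hy3 hh.contMDiffAt hc hC₁.le hy1 (κ := d / C₂)
      (by positivity) (fun v => by
        have := hy2 v
        rw [div_mul_eq_mul_div, div_le_iff₀ hC₂]
        linarith) (k := p) (by omega)
    rw [div_le_iff₀ hC₂] at h3
    linarith

theorem inv_le_of_abs_le {C d σ : ℝ} (hC : 0 < C) (hd : d ≠ 0) (h : |d| ≤ C * σ) :
    (ENNReal.ofReal σ)⁻¹ ≤ ENNReal.ofReal C * (ENNReal.ofReal |d|)⁻¹ := by
  have hd' : 0 < |d| := abs_pos.2 hd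
  have hσ : 0 < σ := by
    by_contra hσ
    push Not at hσ
    nlinarith
  rw [← ENNReal.ofReal_inv_of_pos hσ, ← ENNReal.ofReal_inv_of_pos hd', ← ENNReal.ofReal_mul hC.le]
  refine ENNReal.ofReal_le_ofReal ?_
  rw [inv_eq_one_div, div_le_iff₀ hσ, mul_assoc, mul_comm, mul_assoc, ← div_eq_inv_mul,
    le_div_iff₀ hd', one_mul]
  linarith

variable [MeasurableSpace M] [BorelSpace M] [PolishSpace M] (ν : F.TransverseMeasure)

/-- The version over `W` bounds how many critical points a perturbation supported over `W` can
create or destroy. -/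
theorem Box.AtMostTwo.measure_le {k : F.Box} (hk : k.AtMostTwo h) (hc : IsClosed (F.crit h))
    {W : Set (RSpace q)} (hW : MeasurableSet W) :
    ν.toMeasure (F.crit h ∩ (k.dom ∩ k.tr ⁻¹' W)) ≤ 2 * k.μ ν W := by
  have hm : MeasurableSet (F.crit h ∩ (k.dom ∩ k.tr ⁻¹' W)) :=
    hc.measurableSet.inter (k.measurableSet_inter_tr k.measurableSet_dom subset_rfl hW)
  refine k.measure_le_two_mul ν hm (fun y hy => hy.2.1) (fun x hx y hy z hz h1 h2 =>
    hk x ⟨hx.1, hx.2.1⟩ y ⟨hy.1, hy.2.1⟩ z ⟨hz.1, hz.2.1⟩ h1 h2) hW ?_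
  rintro _ ⟨y, hy, rfl⟩
  exact hy.2.2

theorem exists_box_measure_crit_lt_top (hh : ContMDiff (𝓡 (p + q)) 𝓘(ℝ, ℝ) ∞ h)
    (hx : x ∈ F.crit h → F.IsMorsePoint h x ∨ F.IsBirthDeath h x) :
    ∃ k : F.Box, x ∈ k.dom ∧ ν.toMeasure (F.crit h ∩ k.dom) < ⊤ := by
  obtain ⟨k, hxk, hk⟩ := F.exists_box_atMostTwo hh hx
  have h1 := (hk ℝ 0 fun _ => contMDiff_const).self_of_nhds
  simp only [LinearMap.zero_apply, add_zero] at h1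
  refine ⟨k, hxk, ?_⟩
  have h2 := h1.measure_le ν (F.isClosed_crit hh) MeasurableSet.univ
  rw [preimage_univ, inter_univ] at h2
  exact h2.trans_lt (ENNReal.mul_lt_top (by simp) (measure_lt_top _ _))

/-- In a small box the critical set has measure at most twice the finite mass of the transverse
measure; compactness does the rest. -/
theorem measure_crit_lt_top [CompactSpace M] (hh : ContMDiff (𝓡 (p + q)) 𝓘(ℝ, ℝ) ∞ h)
    (hn : ∀ x ∈ F.crit h, F.IsMorsePoint h x ∨ F.IsBirthDeath h x) :
    ν.toMeasure (F.crit h) < ⊤ := by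
  rw [← Measure.restrict_apply_univ]
  refine isCompact_univ.measure_lt_top_of_nhdsWithin fun x _ => ?_
  obtain ⟨k, hxk, hk⟩ := exists_box_measure_crit_lt_top ν hh (hn x)
  refine ⟨k.dom, mem_nhdsWithin_of_mem_nhds (k.isOpen_dom.mem_nhds hxk), ?_⟩
  rwa [Measure.restrict_apply k.measurableSet_dom, inter_comm]

variable [IsManifold (𝓡 (p + q)) ∞ M]

/-- Near points that are Morse or not critical, the inverse of the smallest singular value is
integrable. -/
theorem exists_nhds_lintegral_lt_top_of_morse (hp : 1 ≤ p) (g : F.EuclideanMetric)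
    (hh : ContMDiff (𝓡 (p + q)) 𝓘(ℝ, ℝ) ∞ h) (hx : x ∈ F.crit h → F.IsMorsePoint h x) :
    ∃ N ∈ nhds x, ∫⁻ y in F.regCrit h ∩ N, (ENNReal.ofReal (g.singularValue h p y))⁻¹
      ∂ν.toMeasure < ⊤ := by
  by_cases hc : x ∈ F.crit h
  · have hM := hx hc
    have he : F.IsFoliatedChart (F.chartAt x) := isFoliatedChart_of_mem (F.chartAt_mem x)
    have hxe := F.mem_chartAt_source x
    set e := F.chartAt x
    obtain ⟨C, hC, h1⟩ := g.eventually_abs_det_le hp he hh hxe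
    have h2 : 0 < |(lhess (h ∘ e.symm) (e x)).det| :=
      abs_pos.2 ((he.isMorsePoint_iff_det hxe hh.contMDiffAt hc).1 hM)
    set d := |(lhess (h ∘ e.symm) (e x)).det|
    have h3 : ContinuousAt (fun y => |(lhess (h ∘ e.symm) (e y)).det|) x :=
      (ContinuousLinearMap.continuous_det.continuousAt.comp (he.continuousAt_lhess hh hxe)).abs
    obtain ⟨k, hxk, hk⟩ := exists_box_measure_crit_lt_top ν hh fun hc => Or.inl (hx hc)
    obtain ⟨N, hN, hNo, hxN⟩ := eventually_nhds_iff.1 ((h1.and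
      (continuousAt_const.eventually_lt h3 (half_lt_self h2))).and (k.isOpen_dom.mem_nhds hxk))
    refine ⟨N, hNo.mem_nhds hxN, ?_⟩
    have hmeas : MeasurableSet (F.crit h ∩ N) :=
      (F.isClosed_crit hh).measurableSet.inter hNo.measurableSet
    calc ∫⁻ y in F.regCrit h ∩ N, (ENNReal.ofReal (g.singularValue h p y))⁻¹ ∂ν.toMeasure
        ≤ ∫⁻ y in F.crit h ∩ N, (ENNReal.ofReal (g.singularValue h p y))⁻¹ ∂ν.toMeasure :=
          lintegral_mono_set (inter_subset_inter_left _ (sep_subset _ _))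
      _ ≤ ∫⁻ _ in F.crit h ∩ N, ENNReal.ofReal C * (ENNReal.ofReal (d / 2))⁻¹ ∂ν.toMeasure := by
          refine setLIntegral_mono' hmeas fun y hy => ?_
          have h4 := hN y hy.2
          refine (inv_le_of_abs_le hC (d := (lhess (h ∘ e.symm) (e y)).det) ?_ (h4.1.1 hy.1)).trans ?_
          · rw [← abs_pos]
            linarith [h4.1.2]
          · gcongr
            exact h4.1.2.le
      _ < ⊤ := by
          rw [setLIntegral_const]
          refine ENNReal.mul_lt_top (ENNReal.mul_lt_top ENNReal.ofReal_lt_top ?_) ?_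
          · rw [ENNReal.inv_lt_top, ENNReal.ofReal_pos]
            positivity
          · exact (measure_mono (inter_subset_inter_right _ fun y hy => (hN y hy).2)).trans_lt hk
  · refine ⟨(F.crit h)ᶜ, (F.isClosed_crit hh).isOpen_compl.mem_nhds hc, ?_⟩
    have : F.regCrit h ∩ (F.crit h)ᶜ = ∅ := by
      ext y
      simp only [mem_inter_iff, mem_compl_iff, mem_empty_iff_false, iff_false, not_and, not_not]
      exact fun hy => hy.1
    rw [this]
    simp

/-- A bound for the sum of the inverse Hessian determinants over the critical points gives the
integrability of the inverse of the smallest singular value. -/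
theorem Box.exists_nhds_lintegral_lt_top (hp : 1 ≤ p) (g : F.EuclideanMetric) (k : F.Box)
    (hh : ContMDiff (𝓡 (p + q)) 𝓘(ℝ, ℝ) ∞ h)
    (hn : ∀ x ∈ F.crit h, F.IsMorsePoint h x ∨ F.IsBirthDeath h x) {K : Set M} (hK : K ⊆ k.dom)
    {E : ℕ → Set (RSpace p × RSpace q)} {G : ℕ → RSpace q → ℝ≥0∞} (hE : ∀ n, MeasurableSet (E n))
    (hEi : ∀ n, InjOn Prod.snd (E n)) (hG : ∀ n, Measurable (G n))
    (hEU : (⋃ n, E n) = {z | z ∈ k.chart '' K ∧ lgrad (h ∘ k.chart.symm) z = 0 ∧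
      (lhess (h ∘ k.chart.symm) z).det ≠ 0})
    (hGE : ∀ n, ∀ z ∈ E n, G n z.2 = (ENNReal.ofReal |(lhess (h ∘ k.chart.symm) z).det|)⁻¹)
    (hfin : ∑' n, ∫⁻ t, G n t ∂(k.μ ν) < ⊤) (hx : x ∈ interior K) :
    ∃ N ∈ nhds x, ∫⁻ y in F.regCrit h ∩ N, (ENNReal.ofReal (g.singularValue h p y))⁻¹
      ∂ν.toMeasure < ⊤ := by
  have he := isFoliatedChart_of_mem k.mem
  have hsrc : K ⊆ k.chart.source := fun y hy => (hK hy).1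
  obtain ⟨C, hC, h1⟩ := g.eventually_abs_det_le hp he hh (hsrc (interior_subset hx))
  obtain ⟨N, hN, hNo, hxN⟩ := eventually_nhds_iff.1 (h1.and (isOpen_interior.mem_nhds hx))
  refine ⟨N, hNo.mem_nhds hxN, ?_⟩
  let A : ℕ → Set M := fun n => k.dom ∩ k.chart ⁻¹' E n
  have hA : ∀ n, MeasurableSet (A n) := fun n =>
    k.continuousOn_chart.measurableSet_inter_preimage k.measurableSet_dom (hE n)
  have hAi : ∀ n, InjOn k.tr (A n) := fun n y hy z hz hyz =>
    k.injOn_chart hy.1 hz.1 (hEi n hy.2 hz.2 hyz)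
  -- Regular critical points are Morse, so each of those near `x` lies on one of the sheets of
  -- nondegenerate zeros.
  have hsub : F.regCrit h ∩ N ⊆ ⋃ n, A n ∩ N := by
    rintro y ⟨hy, hyN⟩
    have hyK := interior_subset (hN y hyN).2
    have hM := isMorsePoint_of_mem_regCrit hy (hn y hy.1)
    have h2 : k.chart y ∈ ⋃ n, E n := by
      rw [hEU]
      exact ⟨⟨y, hyK, rfl⟩, (he.mem_crit_iff (hsrc hyK) hh.contMDiffAt).1 hy.1,
        (he.isMorsePoint_iff_det (hsrc hyK) hh.contMDiffAt hy.1).1 hM⟩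
    obtain ⟨n, hn⟩ := mem_iUnion.1 h2
    exact mem_iUnion.2 ⟨n, ⟨hK hyK, hn⟩, hyN⟩
  calc ∫⁻ y in F.regCrit h ∩ N, (ENNReal.ofReal (g.singularValue h p y))⁻¹ ∂ν.toMeasure
      ≤ ∫⁻ y in ⋃ n, A n ∩ N, (ENNReal.ofReal (g.singularValue h p y))⁻¹ ∂ν.toMeasure :=
        lintegral_mono_set hsub
    _ ≤ ∑' n, ∫⁻ y in A n ∩ N, (ENNReal.ofReal (g.singularValue h p y))⁻¹ ∂ν.toMeasure :=
        lintegral_iUnion_le _ _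
    _ ≤ ∑' n, ENNReal.ofReal C * ∫⁻ t, G n t ∂(k.μ ν) := by
        refine ENNReal.tsum_le_tsum fun n => ?_
        calc ∫⁻ y in A n ∩ N, (ENNReal.ofReal (g.singularValue h p y))⁻¹ ∂ν.toMeasure
            ≤ ∫⁻ y in A n ∩ N, ENNReal.ofReal C * G n (k.tr y) ∂ν.toMeasure := by
              refine setLIntegral_mono' ((hA n).inter hNo.measurableSet) fun y hy => ?_
              have h3 : k.chart y ∈ ⋃ n, E n := mem_iUnion.2 ⟨n, hy.1.2⟩
              rw [hEU] at h3
              have hc : y ∈ F.crit h := (he.mem_crit_iff hy.1.1.1 hh.contMDiffAt).2 h3.2.1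
              rw [Box.tr, hGE n _ hy.1.2]
              exact inv_le_of_abs_le hC h3.2.2 ((hN y hy.2).1 hc)
          _ ≤ ∫⁻ y in A n, ENNReal.ofReal C * G n (k.tr y) ∂ν.toMeasure :=
              lintegral_mono_set inter_subset_left
          _ = ENNReal.ofReal C * ∫⁻ y in A n, G n (k.tr y) ∂ν.toMeasure :=
              lintegral_const_mul' _ _ ENNReal.ofReal_ne_top
          _ = ENNReal.ofReal C * ∫⁻ t in k.tr '' A n, G n t ∂(k.μ ν) := by
              rw [k.lintegral_eq ν (hA n) inter_subset_left (hAi n) (hG n)]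
          _ ≤ _ := by
              exact mul_le_mul' le_rfl (setLIntegral_le_lintegral _ _)
    _ < ⊤ := by
        rw [ENNReal.tsum_mul_left]
        exact ENNReal.mul_lt_top ENNReal.ofReal_lt_top hfin

theorem setLIntegral_lt_top_of_locally [CompactSpace M] (φ : M → ℝ≥0∞) (S : Set M)
    (hφ : ∀ x, ∃ N ∈ nhds x, ∫⁻ y in S ∩ N, φ y ∂ν.toMeasure < ⊤) :
    ∫⁻ y in S, φ y ∂ν.toMeasure < ⊤ := by
  have h1 := isCompact_univ.induction_on (p := fun N => ∫⁻ y in S ∩ N, φ y ∂ν.toMeasure < ⊤)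
    (by simp) (fun s t hst ht => (lintegral_mono_set (inter_subset_inter_right _ hst)).trans_lt ht)
    (fun s t hs ht => by
      rw [inter_union_distrib_left]
      exact (lintegral_union_le _ _ _).trans_lt (ENNReal.add_lt_top.2 ⟨hs, ht⟩))
    (fun x _ => by
      obtain ⟨N, hN, h⟩ := hφ x
      exact ⟨N, mem_nhdsWithin_of_mem_nhds hN, h⟩)
  rwa [inter_univ] at h1

/-- A set that is covered by sets in boxes with negligible projections has a negligible
saturation. -/
theorem measure_saturation_eq_zero_of_cover {ι : Type*} [Countable ι] (k : ι → F.Box)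
    {A : Set M} {K : ι → Set M} (hK : ∀ i, K i ⊆ (k i).dom) (hA : A ⊆ ⋃ i, K i)
    (h0 : ∀ i, (k i).μ ν ((k i).tr '' (A ∩ K i)) = 0) : ν.toMeasure (F.saturation A) = 0 := by
  refine measure_saturation_eq_zero ν fun l => ?_
  refine measure_mono_null (t := ⋃ i, l.tr '' (((k i).dom ∩ l.dom) ∩ (k i).tr ⁻¹'
    ((k i).tr '' (A ∩ K i)))) ?_ (measure_iUnion_null fun i =>
      (isPlaqueIdeal_null ν).transfer (h0 i))
  rintro _ ⟨y, ⟨hyA, hyl⟩, rfl⟩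
  obtain ⟨i, hi⟩ := mem_iUnion.1 (hA hyA)
  exact mem_iUnion.2 ⟨i, y, ⟨⟨hK i hi, hyl⟩, y, ⟨hyA, hi⟩, rfl⟩, rfl⟩

end Foliation

end

/-! ### The perturbation and its support -/

section

section

variable {X Y : Type*} [NormedAddCommGroup X] [InnerProductSpace ℝ X] [FiniteDimensional ℝ X]
  [NormedAddCommGroup Y] [NormedSpace ℝ Y]

theorem lgrad_inner_fst (a : X) (z : X × Y) : lgrad (fun z : X × Y => inner ℝ a z.1) z = a := by
  refine ext_inner_right ℝ fun v => ?_
  rw [inner_lgrad]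
  have h : HasFDerivAt (fun z : X × Y => inner ℝ a z.1)
      ((innerSL ℝ a).comp (ContinuousLinearMap.fst ℝ X Y)) z :=
    ((innerSL ℝ a).comp (ContinuousLinearMap.fst ℝ X Y)).hasFDerivAt
  rw [h.fderiv]
  simp

/-- Subtracting a linear function translates the leafwise gradient. -/
theorem lgrad_of_eventuallyEq_sub {u u' : X × Y → ℝ} {z : X × Y} {a : X}
    (hu : ContDiffAt ℝ ∞ u z) (h : u' =ᶠ[nhds z] u - fun z => inner ℝ a z.1) :
    lgrad u' z = lgrad u z - a ∧ lhess u' z = lhess u z := by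
  have hl : ContDiff ℝ ∞ fun z : X × Y => (inner ℝ (-a) z.1 : ℝ) :=
    ((innerSL ℝ (-a)).comp (ContinuousLinearMap.fst ℝ X Y)).contDiff
  have h' : u' =ᶠ[nhds z] u + fun z => inner ℝ (-a) z.1 := by
    refine h.trans (Filter.Eventually.of_forall fun w => ?_)
    simp [sub_eq_add_neg]
  have h1 : lgrad u' =ᶠ[nhds z] fun w => lgrad u w - a := by
    refine (lgrad_congr h').trans ((lgrad_add_eventuallyEq hu hl.contDiffAt).trans ?_)
    refine Filter.Eventually.of_forall fun w => ?_
    rw [Pi.add_apply, lgrad_inner_fst]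
    exact (sub_eq_add_neg _ _).symm
  refine ⟨h1.self_of_nhds, ?_⟩
  rw [lhess, lhess, h1.fderiv_eq, fderiv_sub_const]

end

namespace Foliation

variable {p q : ℕ} {M : Type*} [TopologicalSpace M] [ChartedSpace (RSpace (p + q)) M]
  {F : Foliation p q M} {x : M} {f h : M → ℝ}

theorem crit_congr (F : Foliation p q M) (hfh : f =ᶠ[nhds x] h) : x ∈ F.crit f ↔ x ∈ F.crit h := by
  simp only [crit, mem_ofPred, hfh.mfderiv_eq]
  exact Iff.rfl

theorem leafHess_congr (F : Foliation p q M) (hfh : f =ᶠ[nhds x] h) :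
    F.leafHess f x = F.leafHess h x := by
  have hx := F.mem_chartAt_source x
  have h1 : Filter.Tendsto (F.chartAt x).symm (nhds (F.chartAt x x)) (nhds x) := by
    have := (F.chartAt x).continuousAt_symm ((F.chartAt x).map_source hx)
    rwa [ContinuousAt, (F.chartAt x).left_inv hx] at this
  have h2 : f ∘ (F.chartAt x).symm =ᶠ[nhds (F.chartAt x x)] h ∘ (F.chartAt x).symm :=
    hfh.comp_tendsto h1
  simp only [leafHess, hess, (h2.fderiv (𝕜 := ℝ)).fderiv_eq]

theorem morseCrit_congr (F : Foliation p q M) (hfh : f =ᶠ[nhds x] h) (i : ℕ) :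
    x ∈ F.morseCrit f i ↔ x ∈ F.morseCrit h i := by
  simp only [morseCrit, IsMorsePoint, mem_ofPred, F.crit_congr hfh, F.leafHess_congr hfh]

/-- The linear family of perturbations given by cut-off functions in boxes. -/
def perturbation {n : ℕ} (k : Fin n → F.Box) (χ : Fin n → M → ℝ) :
    (Fin n → RSpace p) →ₗ[ℝ] (M → ℝ) where
  toFun c x := ∑ i, χ i x * inner ℝ (c i) ((k i).chart x).1
  map_add' c d := by
    funext x
    simp only [Pi.add_apply, inner_add_left, mul_add, Finset.sum_add_distrib]
  map_smul' r c := by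
    funext x
    simp only [Pi.smul_apply, inner_smul_left, smul_eq_mul, Finset.mul_sum, RingHom.id_apply]
    refine Finset.sum_congr rfl fun i _ => ?_
    simp only [conj_trivial]
    ring

section Perturbation

variable {n : ℕ} {k : Fin n → F.Box} {χ : Fin n → M → ℝ}

theorem perturbation_apply (c : Fin n → RSpace p) (x : M) :
    perturbation k χ c x = ∑ i, χ i x * inner ℝ (c i) ((k i).chart x).1 := rfl

theorem perturbation_single (i : Fin n) (a : RSpace p) (x : M) :
    perturbation k χ (Pi.single i a) x = χ i x * inner ℝ a ((k i).chart x).1 := by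
  rw [perturbation_apply, Finset.sum_eq_single i]
  · rw [Pi.single_eq_same]
  · intro j _ hj
    rw [Pi.single_eq_of_ne hj, inner_zero_left, mul_zero]
  · simp

theorem contMDiff_perturbation (hχ : ∀ i, ContMDiff (𝓡 (p + q)) 𝓘(ℝ, ℝ) ∞ (χ i))
    (h0 : ∀ i, ∀ x ∉ (k i).dom, ∀ᶠ y in nhds x, χ i y = 0) (c : Fin n → RSpace p) :
    ContMDiff (𝓡 (p + q)) 𝓘(ℝ, ℝ) ∞ (perturbation k χ c) := by
  have h1 : ∀ i, ContMDiff (𝓡 (p + q)) 𝓘(ℝ, ℝ) ∞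
      fun x => χ i x * inner ℝ (c i) ((k i).chart x).1 := by
    intro i x
    by_cases hx : x ∈ (k i).dom
    · have h2 : ContDiff ℝ ∞ fun z : RSpace p × RSpace q => (inner ℝ (c i) z.1 : ℝ) :=
        ((innerSL ℝ (c i)).comp (ContinuousLinearMap.fst ℝ (RSpace p) (RSpace q))).contDiff
      have h3 := h2.contMDiff.contMDiffAt.comp x
        ((F.smooth _ (k i).mem).contMDiffAt hx.1)
      exact (hχ i x).mul h3
    · refine (contMDiffAt_const (c := (0 : ℝ))).congr_of_eventuallyEq ?_
      filter_upwards [h0 i x hx] with y hy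
      rw [hy, zero_mul]
  have h2 := contMDiff_finsetSum (t := Finset.univ) fun i _ => h1 i
  exact h2

/-- Near `K` the cut-off is 1, so changing the `i`-th parameter alters the function by a linear
function of the leaf coordinate, and the gradient by a constant. The minus sign in `L` matches the
convention `G (c + L a) = G c - a`. -/
theorem isTranslationFamily_perturbation (hf : ContMDiff (𝓡 (p + q)) 𝓘(ℝ, ℝ) ∞ f)
    (hΛ : ∀ c, ContMDiff (𝓡 (p + q)) 𝓘(ℝ, ℝ) ∞ (perturbation k χ c)) (i : Fin n) {K : Set M}
    (hK : IsCompact K) (hKs : K ⊆ (k i).dom) (h1 : ∀ x ∈ K, ∀ᶠ y in nhds x, χ i y = 1) :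
    IsTranslationFamily ((k i).chart '' K)
      (-LinearMap.single ℝ (fun _ : Fin n => RSpace p) i)
      (fun c => lgrad ((f + perturbation k χ c) ∘ (k i).chart.symm))
      (fun c => lhess ((f + perturbation k χ c) ∘ (k i).chart.symm)) := by
  have he := isFoliatedChart_of_mem (k i).mem
  have hs : ∀ c, ContMDiff (𝓡 (p + q)) 𝓘(ℝ, ℝ) ∞ (f + perturbation k χ c) := fun c =>
    hf.add (hΛ c)
  have hsrc : K ⊆ (k i).chart.source := hKs.trans inter_subset_left
  have htgt : ∀ z ∈ (k i).chart '' K, z ∈ (k i).chart.target := by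
    rintro _ ⟨y, hy, rfl⟩
    exact (k i).chart.map_source (hsrc hy)
  have hswap : ∀ w : (RSpace p × RSpace q) × (Fin n → RSpace p),
      ContinuousAt (fun w : (RSpace p × RSpace q) × (Fin n → RSpace p) => (w.2, w.1)) w :=
    fun w => by fun_prop
  have htrans : ∀ (c : Fin n → RSpace p) (a : RSpace p), ∀ z ∈ (k i).chart '' K,
      (f + perturbation k χ (c + (-LinearMap.single ℝ (fun _ : Fin n => RSpace p) i) a)) ∘
        (k i).chart.symm =ᶠ[nhds z] (f + perturbation k χ c) ∘ (k i).chart.symm -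
          fun z => inner ℝ a z.1 := by
    rintro c a _ ⟨y, hy, rfl⟩
    have h2 : Filter.Tendsto (k i).chart.symm (nhds ((k i).chart y)) (nhds y) := by
      have := (k i).chart.continuousAt_symm ((k i).chart.map_source (hsrc hy))
      rwa [ContinuousAt, (k i).chart.left_inv (hsrc hy)] at this
    filter_upwards [h2.eventually (h1 y hy), (k i).chart.open_target.mem_nhds
      ((k i).chart.map_source (hsrc hy))] with z hz hzt
    simp only [Function.comp_apply, Pi.add_apply, Pi.sub_apply, map_add, LinearMap.neg_apply,
      map_neg, Pi.neg_apply, LinearMap.single_apply, perturbation_single, hz, one_mul,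
      (k i).chart.right_inv hzt]
    ring
  refine ⟨hK.image_of_continuousOn ((k i).chart.continuousOn.mono hsrc), ?_, ?_, ?_, ?_, ?_⟩
  · rintro w ⟨hw, -⟩
    exact ((he.continuousAt_lgrad_family hf hΛ w.2 (htgt _ hw)).comp_of_eq (hswap w)
      rfl).continuousWithinAt
  · rintro w ⟨hw, -⟩
    exact ((he.continuousAt_lhess_family hf hΛ w.2 (htgt _ hw)).comp_of_eq (hswap w)
      rfl).continuousWithinAt
  · intro c y t hy
    exact hasFDerivAt_lgrad_leaf (he.comp_symm_mem_smoothAt (hs c) _ (htgt _ hy))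
  · intro c a z hz
    exact (lgrad_of_eventuallyEq_sub (he.comp_symm_mem_smoothAt (hs c) _ (htgt _ hz))
      (htrans c a z hz)).1
  · intro c a z hz
    exact (lgrad_of_eventuallyEq_sub (he.comp_symm_mem_smoothAt (hs c) _ (htgt _ hz))
      (htrans c a z hz)).2

end Perturbation

variable [MeasurableSpace M] [BorelSpace M] [PolishSpace M] {ν : F.TransverseMeasure}

/-- The projection of a compact part of the set of degenerate critical points is negligible. -/
theorem IsNice.measure_image_tr_eq_zero (hf : F.IsNice ν f) (k : F.Box) {K : Set M}
    (hK : IsCompact K) (hKs : K ⊆ k.dom)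
    (hKB : K ⊆ {x | x ∈ F.crit f ∧ ¬ F.IsMorsePoint f x}) : k.μ ν (k.tr '' K) = 0 := by
  refine k.μ_eq_zero ν (hK.image_of_continuousOn (k.continuousOn_tr.mono hKs)).measurableSet ?_
  -- Every point on a plaque through `K` lies on a leaf with a degenerate critical point.
  refine measure_mono_null ?_ hf.null
  rintro x ⟨hx, y, hy, hyx⟩
  exact ⟨y, k.mem_leaf hx (hKs hy) hyx.symm, hKB hy⟩

variable [CompactSpace M] [IsManifold (𝓡 (p + q)) ∞ M]

/-- The degenerate critical points of a nice function are covered by finitely many compact sets in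
boxes, which are contained in open sets of small transverse size. -/
theorem IsNice.exists_cover (hf : F.IsNice ν f) {δ : ℝ≥0∞} (hδ : 0 < δ) :
    ∃ (n : ℕ) (k : Fin n → F.Box) (W : Fin n → Set (RSpace q)) (K : Fin n → Set M)
      (χ : Fin n → M → ℝ),
      (∀ i (V : Type) [NormedAddCommGroup V] [NormedSpace ℝ V]
        [FiniteDimensional ℝ V] (Λ : V →ₗ[ℝ] (M → ℝ)),
        (∀ c, ContMDiff (𝓡 (p + q)) 𝓘(ℝ, ℝ) ∞ (Λ c)) →
          ∀ᶠ c in nhds 0, (k i).AtMostTwo (f + Λ c)) ∧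
      (∀ i, IsOpen (W i)) ∧ (∑ i, 2 * (k i).μ ν (W i) ≤ δ) ∧ (∀ i, IsCompact (K i)) ∧
      (∀ i, K i ⊆ (k i).dom) ∧
      {x | x ∈ F.crit f ∧ ¬ F.IsMorsePoint f x} ⊆ (⋃ i, interior (K i)) ∧
      (∀ i, ContMDiff (𝓡 (p + q)) 𝓘(ℝ, ℝ) ∞ (χ i)) ∧
      (∀ i, ∀ x ∉ (k i).dom ∩ (k i).tr ⁻¹' (W i), ∀ᶠ y in nhds x, χ i y = 0) ∧
      (∀ i, ∀ x ∈ K i, ∀ᶠ y in nhds x, χ i y = 1) := by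
  set B := {x | x ∈ F.crit f ∧ ¬ F.IsMorsePoint f x} with hB
  have hBc : IsClosed B := F.isClosed_crit_diff_morse hf.smooth
  have := ChartedSpace.locallyCompactSpace (RSpace (p + q)) M
  have hbox : ∀ z : M, ∃ (k : F.Box) (H : Set M), IsCompact H ∧ z ∈ interior H ∧ H ⊆ k.dom ∧
      ∀ (V : Type) [NormedAddCommGroup V] [NormedSpace ℝ V]
        [FiniteDimensional ℝ V] (Λ : V →ₗ[ℝ] (M → ℝ)),
        (∀ c, ContMDiff (𝓡 (p + q)) 𝓘(ℝ, ℝ) ∞ (Λ c)) →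
          ∀ᶠ c in nhds 0, k.AtMostTwo (f + Λ c) := by
    intro z
    obtain ⟨k, hz, hk⟩ := F.exists_box_atMostTwo hf.smooth (hf.morse_or_birthDeath z)
    obtain ⟨H, hH, hzH, hHk⟩ := exists_compact_subset k.isOpen_dom hz
    exact ⟨k, H, hH, hzH, hHk, hk⟩
  choose kz Hz hHc hzH hHk hkz using hbox
  obtain ⟨s, -, hs⟩ := hBc.isCompact.elim_nhds_subcover (fun z => interior (Hz z))
    fun z _ => isOpen_interior.mem_nhds (hzH z)
  let z : Fin s.card → M := fun i => s.equivFin.symm i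
  have hcover : B ⊆ ⋃ i, interior (Hz (z i)) := by
    intro x hx
    obtain ⟨y, hy, hxy⟩ := mem_iUnion₂.1 (hs hx)
    refine mem_iUnion.2 ⟨s.equivFin ⟨y, hy⟩, ?_⟩
    simpa [z] using hxy
  have hBH : ∀ i, IsCompact (B ∩ Hz (z i)) := fun i => (hHc _).inter_left hBc
  -- The factor 2 anticipates two critical points per plaque; the `+ 1` keeps the denominator
  -- nonzero when no box is needed.
  have hδ' : 0 < δ / (2 * (s.card + 1)) :=
    ENNReal.div_pos hδ.ne' (ENNReal.mul_ne_top (by simp) (by simp))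
  -- The projection is null and the transverse measure is finite, so outer regularity supplies an
  -- open neighbourhood of small measure.
  have hW : ∀ i, ∃ W ⊇ (kz (z i)).tr '' (B ∩ Hz (z i)), IsOpen W ∧
      (kz (z i)).μ ν W < δ / (2 * (s.card + 1)) := fun i => by
    refine Set.exists_isOpen_lt_of_lt _ _ ?_
    rw [hf.measure_image_tr_eq_zero _ (hBH i) (inter_subset_right.trans (hHk _)) inter_subset_left]
    exact hδ'
  choose W hWs hWo hWm using hW
  let O : Fin s.card → Set M := fun i => (kz (z i)).dom ∩ (kz (z i)).tr ⁻¹' (W i)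
  have hO : ∀ i, IsOpen (O i) := fun i =>
    (kz (z i)).continuousOn_tr.isOpen_inter_preimage (kz (z i)).isOpen_dom (hWo i)
  have hBO : ∀ i, B ∩ Hz (z i) ⊆ O i := fun i x hx => ⟨hHk _ hx.2, hWs i ⟨x, hx, rfl⟩⟩
  -- `K i` lies between the degenerate points and the open set over `W i`, which leaves room for a
  -- cut-off equal to 1 near `K i` and supported over `W i`.
  choose K hKc hBK hKO using fun i => exists_compact_between (hBH i) (hO i) (hBO i)
  have hχ : ∀ i, ∃ χ : M → ℝ, ContMDiff (𝓡 (p + q)) 𝓘(ℝ, ℝ) ∞ χ ∧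
      (∀ x ∉ O i, ∀ᶠ y in nhds x, χ y = 0) ∧ (∀ x ∈ K i, ∀ᶠ y in nhds x, χ y = 1) := fun i => by
    obtain ⟨χ, h0, h1, -⟩ := exists_contMDiffMap_zero_one_nhds_of_isClosed (n := ⊤) (𝓡 (p + q))
      (hO i).isClosed_compl (hKc i).isClosed
      (disjoint_left.2 fun x hx hx' => hx (hKO i hx'))
    exact ⟨χ, χ.contMDiff, fun x hx => h0.filter_mono (nhds_le_nhdsSet hx),
      fun x hx => h1.filter_mono (nhds_le_nhdsSet hx)⟩
  choose χ hχs hχ0 hχ1 using hχ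
  refine ⟨s.card, fun i => kz (z i), W, K, χ, fun i => hkz _, hWo, ?_, hKc,
    fun i => (hKO i).trans inter_subset_left, ?_, hχs, hχ0, hχ1⟩
  · calc ∑ i, 2 * (kz (z i)).μ ν (W i) ≤ ∑ _i : Fin s.card, 2 * (δ / (2 * (s.card + 1))) :=
        Finset.sum_le_sum fun i _ => mul_le_mul' le_rfl (hWm i).le
      _ = s.card * (δ / (s.card + 1)) := by
        rw [Finset.sum_const, Finset.card_univ, Fintype.card_fin, nsmul_eq_mul]
        congr 1
        rw [← mul_div_assoc, ENNReal.mul_div_mul_left _ _ (by simp) (by simp)]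
      _ ≤ (s.card + 1) * (δ / (s.card + 1)) := by gcongr; exact le_self_add
      _ = δ := ENNReal.mul_div_cancel (by simp) (by simp)
  · intro x hx
    obtain ⟨i, hi⟩ := mem_iUnion.1 (hcover hx)
    exact mem_iUnion.2 ⟨i, hBK i ⟨hx, interior_subset hi⟩⟩

end Foliation

end

/-! ### Choice of the parameter and conclusion -/

section

namespace Foliation

variable {p q : ℕ} {M : Type*} [TopologicalSpace M] [ChartedSpace (RSpace (p + q)) M]
  {F : Foliation p q M} {f h : M → ℝ} [MeasurableSpace M] [BorelSpace M] [PolishSpace M]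
  {ν : F.TransverseMeasure}

/-- Two functions that agree outside of an open set have almost the same number of critical
points. -/
theorem abs_toReal_measure_morseCrit_sub_le {U : Set M} (hU : ∀ x ∉ U, f =ᶠ[nhds x] h) {δ : ℝ≥0∞}
    (hδ : δ ≠ ⊤) (hf : ν.toMeasure (F.crit f ∩ U) ≤ δ) (hh : ν.toMeasure (F.crit h ∩ U) ≤ δ)
    (hf' : ν.toMeasure (F.crit f) < ⊤) (hh' : ν.toMeasure (F.crit h) < ⊤) (i : ℕ) :
    |(ν.toMeasure (F.morseCrit h i)).toReal - (ν.toMeasure (F.morseCrit f i)).toReal| ≤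
      δ.toReal := by
  have key : ∀ f h : M → ℝ, (∀ x ∉ U, f =ᶠ[nhds x] h) → ν.toMeasure (F.crit f ∩ U) ≤ δ →
      ν.toMeasure (F.crit h) < ⊤ → (ν.toMeasure (F.morseCrit f i)).toReal ≤
        (ν.toMeasure (F.morseCrit h i)).toReal + δ.toReal := by
    intro f h hU hf hh
    have h1 : F.morseCrit f i ⊆ F.morseCrit h i ∪ F.crit f ∩ U := by
      intro x hx
      by_cases hxU : x ∈ U
      · exact Or.inr ⟨hx.1.1, hxU⟩
      · exact Or.inl ((F.morseCrit_congr (hU x hxU) i).1 hx)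
    have h2 : ν.toMeasure (F.morseCrit h i) ≠ ⊤ :=
      ((measure_mono fun x hx => hx.1.1).trans_lt hh).ne
    rw [← ENNReal.toReal_add h2 hδ]
    refine ENNReal.toReal_mono (ENNReal.add_ne_top.2 ⟨h2, hδ⟩) ?_
    exact (measure_mono h1).trans ((measure_union_le _ _).trans (add_le_add le_rfl hf))
  rw [abs_sub_le_iff]
  constructor
  · linarith [key h f (fun x hx => (hU x hx).symm) hh hf']
  · linarith [key f h hU hf hh']

variable [CompactSpace M] [IsManifold (𝓡 (p + q)) ∞ M]

/-- Stability holds for all parameters near 0, while the measure statements hold for almost all. A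
set of full measure is dense, so one parameter satisfies both. -/
theorem IsNice.exists_isNice (hp : 1 ≤ p) (g : F.EuclideanMetric) (hf : F.IsNice ν f) {ε : ℝ}
    (hε : 0 < ε) :
    ∃ h : M → ℝ, F.IsNice ν h ∧
      ∫⁻ x in F.regCrit h, (ENNReal.ofReal (g.singularValue h p x))⁻¹ ∂ν.toMeasure < ⊤ ∧
      ∀ i : ℕ, ν.toMeasure (F.morseCrit f i) < ⊤ ∧ ν.toMeasure (F.morseCrit h i) < ⊤ ∧
        |(ν.toMeasure (F.morseCrit h i)).toReal - (ν.toMeasure (F.morseCrit f i)).toReal| ≤ ε := by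
  obtain ⟨n, k, W, K, χ, htwo, hW, hsum, hK, hKk, hB, hχ, hχ0, hχ1⟩ :=
    hf.exists_cover (ENNReal.ofReal_pos.2 hε)
  have hΛ : ∀ c, ContMDiff (𝓡 (p + q)) 𝓘(ℝ, ℝ) ∞ (perturbation k χ c) :=
    contMDiff_perturbation hχ fun i x hx => hχ0 i x fun hx' => hx hx'.1
  have hs : ∀ c, ContMDiff (𝓡 (p + q)) 𝓘(ℝ, ℝ) ∞ (f + perturbation k χ c) := fun c =>
    hf.smooth.add (hΛ c)
  have hz : f + perturbation k χ 0 = f := by simp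
  have ev1 : ∀ᶠ c in nhds (0 : Fin n → RSpace p), ∀ x ∈ (univ : Set M),
      x ∈ F.crit (f + perturbation k χ c) → F.IsMorsePoint (f + perturbation k χ c) x ∨
        F.IsBirthDeath (f + perturbation k χ c) x := by
    refine isCompact_univ.eventually_forall_of_forall_eventually fun x _ => ?_
    refine F.eventually_morse_or_birthDeath hf.smooth hΛ ?_
    rw [hz]
    exact hf.morse_or_birthDeath x
  -- The interiors of the `K i` cover the degenerate points of `f`, so on the compact complement all
  -- critical points are Morse, which persists.
  have ev2 : ∀ᶠ c in nhds (0 : Fin n → RSpace p), ∀ x ∈ (⋃ i, interior (K i))ᶜ,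
      x ∈ F.crit (f + perturbation k χ c) → F.IsMorsePoint (f + perturbation k χ c) x := by
    have hc : IsCompact (⋃ i, interior (K i))ᶜ :=
      (isOpen_iUnion fun i => isOpen_interior).isClosed_compl.isCompact
    refine hc.eventually_forall_of_forall_eventually fun x hx => ?_
    refine F.eventually_isMorsePoint hf.smooth hΛ ?_
    rw [hz]
    intro hxc
    by_contra hM
    exact hx (hB ⟨hxc, hM⟩)
  have ev3 : ∀ᶠ c in nhds (0 : Fin n → RSpace p), ∀ i, (k i).AtMostTwo (f + perturbation k χ c) :=
    Filter.eventually_all.2 fun i => htwo i _ _ hΛ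
  have hT := fun i => isTranslationFamily_perturbation hf.smooth hΛ i (hK i) (hKk i) (hχ1 i)
  have ae1 := ae_all_iff.2 fun i =>
    (hT i).ae_measure_eq_zero ((k i).μ ν) (Measure.addHaar : Measure (Fin n → RSpace p))
  have ae2 := ae_all_iff.2 fun i =>
    (hT i).ae_exists_lintegral_lt_top ((k i).μ ν) (Measure.addHaar : Measure (Fin n → RSpace p))
  -- `hc1`, `hc2` and `hc3` are the stability properties; `hc4` and `hc5` come from Sard's theorem
  -- and the area formula on every `K i`.
  obtain ⟨c, ⟨hc1, hc2, hc3⟩, hc4, hc5⟩ :=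
    mem_closure_iff_nhds.1 (Measure.dense_of_ae (ae1.and ae2) 0) _ (ev1.and (ev2.and ev3))
  have hn : ∀ x ∈ F.crit (f + perturbation k χ c), F.IsMorsePoint (f + perturbation k χ c) x ∨
      F.IsBirthDeath (f + perturbation k χ c) x := fun x => hc1 x (mem_univ x)
  have hf2 : ∀ i, (k i).AtMostTwo f := fun i => by
    have := (htwo i _ _ hΛ).self_of_nhds
    rwa [hz] at this
  set h := f + perturbation k χ c with hh
  have hU : ∀ x ∉ ⋃ i, (k i).dom ∩ (k i).tr ⁻¹' W i, f =ᶠ[nhds x] h := by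
    intro x hx
    rw [mem_iUnion, not_exists] at hx
    filter_upwards [Filter.eventually_all.2 fun i => hχ0 i x (hx i)] with y hy
    simp [hh, perturbation_apply, hy]
  have hcount : ∀ u : M → ℝ, ContMDiff (𝓡 (p + q)) 𝓘(ℝ, ℝ) ∞ u → (∀ i, (k i).AtMostTwo u) →
      ν.toMeasure (F.crit u ∩ ⋃ i, (k i).dom ∩ (k i).tr ⁻¹' W i) ≤ ENNReal.ofReal ε := by
    intro u hu hu2
    rw [inter_iUnion]
    refine (measure_iUnion_fintype_le _ _).trans (le_trans ?_ hsum)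
    exact Finset.sum_le_sum fun i _ =>
      (hu2 i).measure_le ν (F.isClosed_crit hu) (hW i).measurableSet
  have hfin : ν.toMeasure (F.crit f) < ⊤ := measure_crit_lt_top ν hf.smooth hf.morse_or_birthDeath
  have hfin' : ν.toMeasure (F.crit h) < ⊤ := measure_crit_lt_top ν (hs c) hn
  refine ⟨h, ⟨hs c, hn, ?_⟩, ?_, fun i => ⟨?_, ?_, ?_⟩⟩
  · refine measure_saturation_eq_zero_of_cover ν k (A := {x | x ∈ F.crit h ∧ ¬ F.IsMorsePoint h x})
      hKk ?_ fun i => ?_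
    -- By `hc2` the degenerate critical points of `h` stay inside the `K i`, where `hc4` makes their
    -- projections null.
    · rintro x ⟨hxc, hxM⟩
      by_contra hx
      refine hxM (hc2 x (fun hx' => hx ?_) hxc)
      exact iUnion_mono (fun i => interior_subset) hx'
    · refine measure_mono_null ?_ (hc4 i)
      rintro _ ⟨x, ⟨⟨hxc, hxM⟩, hxK⟩, rfl⟩
      have he := isFoliatedChart_of_mem (k i).mem
      have hxs := (hKk i hxK).1
      refine ⟨((k i).chart x).1, ⟨x, hxK, rfl⟩, (he.mem_crit_iff hxs (hs c).contMDiffAt).1 hxc, ?_⟩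
      rw [he.isMorsePoint_iff_det hxs (hs c).contMDiffAt hxc, not_not] at hxM
      exact hxM
  · refine setLIntegral_lt_top_of_locally ν _ _ fun x => ?_
    -- Inside the `K i` the bound comes from the area formula; outside, `h` is Morse and the
    -- smallest singular value is locally bounded below on the critical set.
    by_cases hx : x ∈ ⋃ i, interior (K i)
    · obtain ⟨i, hi⟩ := mem_iUnion.1 hx
      obtain ⟨E, G, hE, hEi, hG, hEU, hGE, hlt⟩ := hc5 i
      exact (k i).exists_nhds_lintegral_lt_top ν hp g (hs c) hn (hKk i) hE hEi hG hEU hGE hlt hi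
    · exact exists_nhds_lintegral_lt_top_of_morse ν hp g (hs c) (hc2 x hx)
  · exact (measure_mono fun x hx => hx.1.1).trans_lt hfin
  · exact (measure_mono fun x hx => hx.1.1).trans_lt hfin'
  · have := abs_toReal_measure_morseCrit_sub_le hU ENNReal.ofReal_ne_top
      (hcount f hf.smooth hf2) (hcount h (hs c) hc3) hfin hfin' i
    rwa [ENNReal.toReal_ofReal hε.le] at this

end Foliation

end

end

theorem mainTheorem8 {p q : ℕ} (hp : 1 ≤ p) {M : Type*} [TopologicalSpace M]
    [ChartedSpace (RSpace (p + q)) M] [IsManifold (𝓡 (p + q)) ∞ M]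
    [CompactSpace M] [T2Space M] [MeasurableSpace M] [BorelSpace M]
    (F : Foliation p q M) (g : F.EuclideanMetric) (ν : F.TransverseMeasure)
    (f : M → ℝ) (hf : F.IsNice ν f) (ε : ℝ) (hε : 0 < ε) :
    ∃ h : M → ℝ, F.IsNice ν h ∧
      ∫⁻ x in F.regCrit h, (ENNReal.ofReal (g.singularValue h p x))⁻¹ ∂ν.toMeasure < ⊤ ∧
      ∀ i : ℕ, ν.toMeasure (F.morseCrit f i) < ⊤ ∧ ν.toMeasure (F.morseCrit h i) < ⊤ ∧
        |(ν.toMeasure (F.morseCrit h i)).toReal - (ν.toMeasure (F.morseCrit f i)).toReal| ≤ ε := by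
  -- A compact Hausdorff manifold is second countable and metrizable, hence Polish, as the arguments
  -- with Borel and analytic sets require.
  have := ChartedSpace.secondCountable_of_sigmaCompact (RSpace (p + q)) M
  have : TopologicalSpace.MetrizableSpace M := TopologicalSpace.metrizableSpace_of_t3_secondCountable M
  let _ := TopologicalSpace.metrizableSpaceMetric M
  have : PolishSpace M := inferInstance
  exact hf.exists_isNice hp g hε
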